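/- Graphs are finite and undirected and may have multiple edges but no loops; cubic means that every vertex has degree three; planar means embeddable in the plane; a 2-factor of $G$ is a spanning subgraph of $G$ in which every vertex has degree two, that is, a spanning subgraph whose components are cycles (two parallel edges form a cycle of length two). **Theorem.** Let $G$ be a connected planar cubic bipartite graph and let $e_1,e_2$ be any two edges of $G$. Then there exists a 2-factor of $G$ such that $e_1$ and $e_2$ are contained in the same cycle of the 2-factor. -/

import Mathlib

/-! Multigraphs are Mathlib's `Graph α β`: parallel edges (and, a priori, loops) are allowed. -/

namespace Graph

variable {α β : Type*}

/-- The degree of a vertex: the number of incident edges, a loop being counted twice. -/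
noncomputable def deg (G : Graph α β) (x : α) : ℕ∞ :=
  (G.incidenceSet x).encard + (G.loopSet x).encard

/-- Every vertex of `G` has degree `k`. -/
def IsRegular (G : Graph α β) (k : ℕ) : Prop :=
  ∀ x ∈ G.vertexSet, G.deg x = k

/-- A cubic graph is one in which every vertex has degree three. -/
def IsCubic (G : Graph α β) : Prop :=
  G.IsRegular 3

/-- `G` is connected: it has a vertex, and any two vertices are joined by a walk. -/
def IsConnected (G : Graph α β) : Prop :=
  G.vertexSet.Nonempty ∧
    ∀ x ∈ G.vertexSet, ∀ y ∈ G.vertexSet, Relation.ReflTransGen G.Adj x y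

/-- `G` is bipartite: its vertices can be split into two classes such that every edge
joins vertices of different classes. In particular, a bipartite graph has no loops. -/
def IsBipartite (G : Graph α β) : Prop :=
  ∃ A : Set α, ∀ e x y, G.IsLink e x y → (x ∈ A ↔ y ∉ A)

/-- A drawing of `G` in the Euclidean plane: the vertices are distinct points, every edge is a
simple arc between its ends (a simple closed curve for a loop), and the interior of an edge
contains no vertex and no point of another edge. -/
structure PlaneEmbedding (G : Graph α β) where
  /-- The point that represents a vertex. -/
  point : α → EuclideanSpace ℝ (Fin 2)
  /-- The continuous curve that represents an edge. -/
  arc : β → C(unitInterval, EuclideanSpace ℝ (Fin 2))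
  point_injOn : Set.InjOn point G.vertexSet
  arc_ends : ∀ e x y, G.IsLink e x y →
    (arc e 0 = point x ∧ arc e 1 = point y) ∨ (arc e 0 = point y ∧ arc e 1 = point x)
  arc_simple : ∀ e ∈ G.edgeSet, ∀ s t : unitInterval, arc e s = arc e t →
    s = t ∨ (s = 0 ∧ t = 1) ∨ (s = 1 ∧ t = 0)
  arc_ne_point : ∀ e ∈ G.edgeSet, ∀ x ∈ G.vertexSet, ∀ t : unitInterval,
    t ≠ 0 → t ≠ 1 → arc e t ≠ point x
  arc_disjoint : ∀ e ∈ G.edgeSet, ∀ f ∈ G.edgeSet, e ≠ f → ∀ s t : unitInterval,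
    s ≠ 0 → s ≠ 1 → t ≠ 0 → t ≠ 1 → arc e s ≠ arc f t

/-- `G` is planar: it can be embedded in the plane. -/
def IsPlanar (G : Graph α β) : Prop :=
  Nonempty G.PlaneEmbedding

/-- `C` is (the graph of) a cycle: a finite connected graph in which every vertex has degree two.
Two vertices joined by two parallel edges form a cycle of length two. -/
def IsCycleGraph (C : Graph α β) : Prop :=
  C.vertexSet.Finite ∧ C.IsConnected ∧ C.IsRegular 2

/-- `F` is a 2-factor of `G`: a spanning subgraph in which every vertex has degree two. -/
def IsTwoFactorOf (F G : Graph α β) : Prop :=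
  F.IsSpanningSubgraph G ∧ F.IsRegular 2

end Graph

set_option linter.unusedSectionVars false

/-! The proof is an induction on the number of edges, in which planarity enters only through
algebraic duality: `HasDual` asks for a graph on the same edges whose mod 2 cut space is the cycle
space of the given one. This property passes easily through the two operations of the induction,
deletion of an edge (`HasDual.erase`) and suppression of the two inner vertices of a path of length
three (`HasDual.suppress`), which keeps a graph bipartite.

If two edges are parallel, then either the graph is a triple edge, or one of the two is deleted and
the path left over is suppressed (`IsDigon.pairsOnCycle`). Otherwise the graph is simple, and each
nonempty star of the dual is an even set of at least four edges. Euler's inequality yields at least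
six stars with exactly four edges. An edge lies in at most two stars, so one of the resulting
4-cycles avoids both given edges (`Cubic.exists_isQuad_notMem`). Delete two opposite edges of it and
suppress its vertices. There are two ways to do so, and one of them leaves the graph connected:
otherwise there would be a bridge, which counting mod 3 excludes in a cubic bipartite graph
(`IsQuad.conn_or`). A 2-factor of the smaller graph lifts: a path through the 4-cycle uses one or
three of its edges, and an untouched 4-cycle becomes a new component (`IsQuad.exists_twoFactor`).

The dual is obtained without the Jordan curve theorem. A fine square grid turns a drawing into a
model of the graph as a minor of the grid (`IsDrawing.exists_isGridMinor`). In the grid itself, a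
set of edges without boundary is a coboundary of squares, by explicit summation
(`exists_coboundary_eq`). Duality descends to the minor when the squares on the two sides of each
deleted edge are identified (`IsGridMinor.hasDual`). -/

namespace BipartiteEdges

variable {α β : Type*} [DecidableEq α] [DecidableEq β]

/-! ### Degrees, linkage and connectivity

A bipartite multigraph is given by a finite set `E` of edges and two maps `a`, `b` which send
an edge to its end in the first and in the second class. -/

/-- The number of edges in `S` whose end under `a` is `x`. -/
def degOn (S : Finset β) (a : β → α) (x : α) : ℕ := (S.filter (fun f => a f = x)).card

/-- Two edges of `S` that share an end. -/
def Share (S : Finset β) (a b : β → α) (e f : β) : Prop :=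
  e ∈ S ∧ f ∈ S ∧ (a e = a f ∨ b e = b f)

/-- Two edges of `S` in the same component of `S`. -/
def Linked (S : Finset β) (a b : β → α) : β → β → Prop := Relation.ReflTransGen (Share S a b)

/-- The set `X` is a union of components of `E`. -/
def Closed (E : Finset β) (a b : β → α) (X : β → Prop) : Prop :=
  ∀ e f, Share E a b e f → X e → X f

/-- The edges in `E` form a connected graph. -/
def Conn (E : Finset β) (a b : β → α) : Prop :=
  ∀ X : β → Prop, Closed E a b X → (∃ e ∈ E, X e) → ∀ f ∈ E, X f

/-- Every vertex has degree three. -/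
def Cubic (E : Finset β) (a b : β → α) : Prop :=
  ∀ e ∈ E, degOn E a (a e) = 3 ∧ degOn E b (b e) = 3

/-- `S` is the edge set of a 2-factor. -/
def TwoFactor (E S : Finset β) (a b : β → α) : Prop :=
  S ⊆ E ∧ ∀ e ∈ E, degOn S a (a e) = 2 ∧ degOn S b (b e) = 2

lemma Share.symm {S : Finset β} {a b : β → α} {e f : β} (h : Share S a b e f) :
    Share S a b f e := ⟨h.2.1, h.1, h.2.2.imp Eq.symm Eq.symm⟩

lemma Linked.symm {S : Finset β} {a b : β → α} {e f : β} (h : Linked S a b e f) :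
    Linked S a b f e :=
  haveI : Std.Symm (Share S a b) := ⟨fun _ _ h => h.symm⟩
  Relation.ReflTransGen.stdSymm.symm _ _ h

lemma Linked.trans {S : Finset β} {a b : β → α} {e f g : β} (h : Linked S a b e f)
    (h' : Linked S a b f g) : Linked S a b e g := Relation.ReflTransGen.trans h h'

lemma Linked.refl {S : Finset β} {a b : β → α} (e : β) : Linked S a b e e :=
  Relation.ReflTransGen.refl

lemma linked_of_left {S : Finset β} {a b : β → α} {e f : β} (he : e ∈ S) (hf : f ∈ S)
    (h : a e = a f) : Linked S a b e f := Relation.ReflTransGen.single ⟨he, hf, Or.inl h⟩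

lemma linked_of_right {S : Finset β} {a b : β → α} {e f : β} (he : e ∈ S) (hf : f ∈ S)
    (h : b e = b f) : Linked S a b e f := Relation.ReflTransGen.single ⟨he, hf, Or.inr h⟩

/-- The map `φ` redirects edges that are not available in `T`. -/
lemma Linked.map {S T : Finset β} {a b a' b' : β → α} {φ : β → β} {e f : β}
    (h : Linked S a b e f)
    (hφ : ∀ e f, Share S a b e f → Linked T a' b' (φ e) (φ f)) : Linked T a' b' (φ e) (φ f) := by
  induction h with
  | refl => exact Linked.refl _
  | tail _ h ih => exact ih.trans (hφ _ _ h)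

lemma Closed.compl {E : Finset β} {a b : β → α} {X : β → Prop} (h : Closed E a b X) :
    Closed E a b (fun e => ¬ X e) := fun e f hs he hf => he (h f e hs.symm hf)

lemma degOn_insert {S : Finset β} {a : β → α} {e : β} (he : e ∉ S) (x : α) :
    degOn (insert e S) a x = (if a e = x then 1 else 0) + degOn S a x := by
  unfold degOn
  rw [Finset.filter_insert]
  split_ifs with h
  · rw [Finset.card_insert_of_notMem (by simp [he])]; omega
  · omega

lemma degOn_erase {S : Finset β} {a : β → α} {e : β} (he : e ∈ S) (x : α) :
    degOn S a x = (if a e = x then 1 else 0) + degOn (S.erase e) a x := by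
  rw [← degOn_insert (Finset.notMem_erase e S), Finset.insert_erase he]

lemma degOn_update {S : Finset β} {a : β → α} {p : β} (hp : p ∉ S) (y x : α) :
    degOn S (Function.update a p y) x = degOn S a x := by
  unfold degOn
  congr 1
  apply Finset.filter_congr
  intro f hf
  have : f ≠ p := fun h => hp (h ▸ hf)
  simp [Function.update_of_ne this]

lemma degOn_eq_zero {S : Finset β} {a : β → α} {x : α} (h : ∀ f ∈ S, a f ≠ x) :
    degOn S a x = 0 := by
  unfold degOn
  rw [Finset.card_eq_zero, Finset.filter_eq_empty_iff]
  exact fun f hf => h f hf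

/-- A set in which all fibres of `a` have `k` elements has a number of elements
that is divisible by `k`. -/
lemma dvd_card_of_degOn {S : Finset β} {a : β → α} {k : ℕ} (h : ∀ e ∈ S, degOn S a (a e) = k) :
    S.card = k * (S.image a).card := by
  rw [Finset.card_eq_sum_card_image a S]
  rw [Finset.sum_const_nat (m := k), mul_comm]
  intro x hx
  obtain ⟨e, he, rfl⟩ := Finset.mem_image.1 hx
  exact h e he

/-! ### Suppressing a path -/

/-- `p`, `q`, `r` are the edges of a path whose two inner vertices, the ends of `q`,
have degree two in `E`. -/
structure IsSeries (E : Finset β) (a b : β → α) (p q r : β) : Prop where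
  memp : p ∈ E
  memq : q ∈ E
  memr : r ∈ E
  ne_pq : p ≠ q
  ne_pr : p ≠ r
  ne_qr : q ≠ r
  left : a p = a q
  right : b q = b r
  eq_left : ∀ f ∈ E, a f = a q → f = p ∨ f = q
  eq_right : ∀ f ∈ E, b f = b q → f = q ∨ f = r

/-- The 2-factor, or part of one, of a graph that corresponds to one of the graph in which
the path `p`, `q`, `r` has been replaced with the edge `p`. -/
def expand (S : Finset β) (p q r : β) : Finset β := if p ∈ S then insert q (insert r S) else S

/-! ### Degrees and linkage under suppression. -/

section Series

variable {E S : Finset β} {a b : β → α} {p q r : β}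

lemma IsSeries.ar_ne (h : IsSeries E a b p q r) : a r ≠ a q := fun h' => by
  rcases h.eq_left r h.memr h' with h1 | h1
  · exact h.ne_pr h1.symm
  · exact h.ne_qr h1.symm

lemma subset_expand : S ⊆ expand S p q r := by
  unfold expand
  split_ifs
  · intro x hx; simp [hx]
  · exact Finset.Subset.refl _

lemma expand_of_mem (hp : p ∈ S) : expand S p q r = insert q (insert r S) := if_pos hp

lemma expand_of_notMem (hp : p ∉ S) : expand S p q r = S := if_neg hp

lemma IsSeries.expand_erase (h : IsSeries E a b p q r) :
    expand ((E.erase q).erase r) p q r = E := by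
  rw [expand_of_mem]
  · rw [Finset.erase_right_comm, Finset.insert_comm, Finset.insert_erase, Finset.insert_erase h.memr]
    simp [h.ne_qr, h.memq]
  · simp [h.ne_pq, h.ne_pr, h.memp]

/-- The path runs from `b p` through `a q` and `b q` to `a r`. The edge that replaces it keeps the
name `p` and the end `b p`, so that only `a` has to be updated; at `a r` the edge `r` is traded for
`p`. -/
lemma IsSeries.degOn_left (h : IsSeries E a b p q r) (hS : S ⊆ (E.erase q).erase r) {x : α}
    (hx : x ≠ a q) :
    degOn (expand S p q r) a x = degOn S (Function.update a p (a r)) x := by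
  have hq : q ∉ S := fun h' => by simpa using hS h'
  have hr : r ∉ S := fun h' => by simpa using hS h'
  by_cases hp : p ∈ S
  · rw [expand_of_mem hp, degOn_insert (by simp [hq, h.ne_qr]), degOn_insert hr,
      degOn_erase hp (a := Function.update a p (a r)), degOn_update (by simp),
      degOn_erase hp (a := a)]
    simp [h.left, hx.symm]
  · rw [expand_of_notMem hp, degOn_update hp]

lemma IsSeries.degOn_left_self (h : IsSeries E a b p q r) (hS : S ⊆ (E.erase q).erase r) :
    degOn (expand S p q r) a (a q) = if p ∈ S then 2 else 0 := by
  have hq : q ∉ S := fun h' => by simpa using hS h'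
  have hr : r ∉ S := fun h' => by simpa using hS h'
  have hz : ∀ f ∈ S.erase p, a f ≠ a q := by
    intro f hf h'
    rw [Finset.mem_erase] at hf
    have := hS hf.2
    simp only [Finset.mem_erase] at this
    rcases h.eq_left f this.2.2 h' with h1 | h1
    · exact hf.1 h1
    · exact this.2.1 h1
  by_cases hp : p ∈ S
  · rw [expand_of_mem hp, degOn_insert (by simp [hq, h.ne_qr]), degOn_insert hr,
      degOn_erase hp (a := a), degOn_eq_zero hz]
    simp [h.left, hp, h.ar_ne]
  · rw [expand_of_notMem hp, if_neg hp]
    rw [Finset.erase_eq_of_notMem hp] at hz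
    exact degOn_eq_zero hz

lemma IsSeries.degOn_right (h : IsSeries E a b p q r) (hS : S ⊆ (E.erase q).erase r) {x : α}
    (hx : x ≠ b q) :
    degOn (expand S p q r) b x = degOn S b x := by
  have hq : q ∉ S := fun h' => by simpa using hS h'
  have hr : r ∉ S := fun h' => by simpa using hS h'
  by_cases hp : p ∈ S
  · rw [expand_of_mem hp, degOn_insert (by simp [hq, h.ne_qr]), degOn_insert hr]
    simp [← h.right, hx.symm]
  · rw [expand_of_notMem hp]

lemma IsSeries.degOn_right_self (h : IsSeries E a b p q r) (hS : S ⊆ (E.erase q).erase r) :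
    degOn (expand S p q r) b (b q) = if p ∈ S then 2 else 0 := by
  have hq : q ∉ S := fun h' => by simpa using hS h'
  have hr : r ∉ S := fun h' => by simpa using hS h'
  have hz : ∀ f ∈ S, b f ≠ b q := by
    intro f hf h'
    have := hS hf
    simp only [Finset.mem_erase] at this
    rcases h.eq_right f this.2.2 h' with h1 | h1
    · exact this.2.1 h1
    · exact this.1 h1
  by_cases hp : p ∈ S
  · rw [expand_of_mem hp, degOn_insert (by simp [hq, h.ne_qr]), degOn_insert hr,
      degOn_eq_zero hz]
    simp [← h.right, hp]
  · rw [expand_of_notMem hp, if_neg hp]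
    exact degOn_eq_zero hz

/-- A step from `p` across its new end `a r` becomes a walk along `p`, `q`, `r`. -/
lemma IsSeries.linked_expand (h : IsSeries E a b p q r) {e f : β}
    (hl : Linked S (Function.update a p (a r)) b e f) : Linked (expand S p q r) a b e f := by
  refine hl.map (φ := id) ?_
  have key : ∀ e f, e ∈ S → f ∈ S → f ≠ p →
      Function.update a p (a r) e = Function.update a p (a r) f →
      Linked (expand S p q r) a b e f := by
    intro e f he hf hfp hs
    rw [Function.update_of_ne hfp] at hs
    by_cases hep : e = p
    · subst hep
      rw [Function.update_self] at hs
      rw [expand_of_mem he]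
      refine (linked_of_left (f := q) ?_ ?_ h.left).trans
        ((linked_of_right (f := r) ?_ ?_ h.right).trans (linked_of_left ?_ ?_ hs)) <;>
      simp [he, hf]
    · rw [Function.update_of_ne hep] at hs
      exact linked_of_left (subset_expand he) (subset_expand hf) hs
  rintro e f ⟨he, hf, hs | hs⟩
  · by_cases hfp : f = p
    · by_cases hep : e = p
      · subst hfp; subst hep; exact Linked.refl _
      · exact (key f e hf he hep hs.symm).symm
    · exact key e f he hf hfp hs
  · exact linked_of_right (subset_expand he) (subset_expand hf) hs

lemma IsSeries.linked_pq (_h : IsSeries E a b p q r) (hp : p ∈ S) (h' : a p = a q) :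
    Linked (expand S p q r) a b p q := by
  rw [expand_of_mem hp]
  exact linked_of_left (by simp [hp]) (by simp) h'

lemma IsSeries.linked_pr (h : IsSeries E a b p q r) (hp : p ∈ S) :
    Linked (expand S p q r) a b p r := by
  rw [expand_of_mem hp]
  exact (linked_of_left (f := q) (by simp [hp]) (by simp) h.left).trans
    (linked_of_right (by simp) (by simp) h.right)

end Series

/-! ### Abstract duals -/

/-- The mod 2 cycle space. -/
def IsCyc (E : Finset β) (a b : β → α) (z : β → ZMod 2) : Prop :=
  (∀ x, ∑ f ∈ E with a f = x, z f = 0) ∧ (∀ x, ∑ f ∈ E with b f = x, z f = 0)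

/-- There is an abstract dual graph, with vertex set `I`, whose edges are those of `E`, and whose
cut space is the cycle space of `E`. -/
def HasDual (E : Finset β) (a b : β → α) : Prop :=
  ∃ (I : Type) (L R : β → I), ∀ z : β → ZMod 2,
    IsCyc E a b z ↔ ∃ c : I → ZMod 2, ∀ e ∈ E, z e = c (L e) + c (R e)

lemma isCyc_congr {E : Finset β} {a b : β → α} {z z' : β → ZMod 2} (h : ∀ e ∈ E, z e = z' e) :
    IsCyc E a b z ↔ IsCyc E a b z' := by
  unfold IsCyc
  have : ∀ (g : β → α) (x : α), ∑ f ∈ E with g f = x, z f = ∑ f ∈ E with g f = x, z' f :=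
    fun g x => Finset.sum_congr rfl fun f hf => h f (Finset.mem_filter.1 hf).1
  simp only [this]

lemma sum_filter_erase {E : Finset β} {a : β → α} {z : β → ZMod 2} {q : β} (hq : q ∈ E) (x : α) :
    ∑ f ∈ E with a f = x, z f =
      (if a q = x then z q else 0) + ∑ f ∈ E.erase q with a f = x, z f := by
  rw [Finset.sum_filter, Finset.sum_filter,
    Finset.add_sum_erase E (fun f => if a f = x then z f else 0) hq]

/-- Deletion contracts the dual edge: the cycles without `q` are the cuts with `c (L q) = c (R q)`,
that is, those given by functions on the quotient. -/
lemma HasDual.erase {E : Finset β} {a b : β → α} (h : HasDual E a b) {q : β} (hq : q ∈ E) :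
    HasDual (E.erase q) a b := by
  obtain ⟨I, L, R, h⟩ := h
  refine ⟨Quot (fun i j => i = L q ∧ j = R q), fun e => Quot.mk _ (L e), fun e => Quot.mk _ (R e),
    fun z => ?_⟩
  have e1 : IsCyc (E.erase q) a b z ↔ IsCyc E a b (Function.update z q 0) := by
    have : ∀ e ∈ E.erase q, z e = Function.update z q 0 e := fun e he => by
      rw [Function.update_of_ne (Finset.ne_of_mem_erase he)]
    rw [isCyc_congr this]
    unfold IsCyc
    simp only [sum_filter_erase hq, Function.update_self, ite_self, zero_add]
  rw [e1, h]
  constructor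
  · rintro ⟨c, hc⟩
    have hq' : c (L q) = c (R q) := by
      have := hc q hq
      rw [Function.update_self] at this
      exact CharTwo.add_eq_zero.1 this.symm
    refine ⟨Quot.lift c ?_, fun e he => ?_⟩
    · rintro _ _ ⟨rfl, rfl⟩; exact hq'
    · have := hc e (Finset.mem_of_mem_erase he)
      rwa [Function.update_of_ne (Finset.ne_of_mem_erase he)] at this
  · rintro ⟨c, hc⟩
    refine ⟨fun i => c (Quot.mk _ i), fun e he => ?_⟩
    by_cases heq : e = q
    · subst heq
      have : Quot.mk (fun i j => i = L e ∧ j = R e) (L e) = Quot.mk _ (R e) :=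
        Quot.sound ⟨rfl, rfl⟩
      rw [Function.update_self]
      simp only [this]
      exact (CharTwo.add_self_eq_zero _).symm
    · rw [Function.update_of_ne heq]
      exact hc e (Finset.mem_erase.2 ⟨heq, he⟩)

/-- Contraction deletes the dual edges of `q` and `r`, so the same dual vertices and end maps serve.
The point is that a cycle is constant on the path and hence determined by its restriction. -/
lemma HasDual.suppress {E : Finset β} {a b : β → α} (h : HasDual E a b) {p q r : β}
    (hs : IsSeries E a b p q r) :
    HasDual ((E.erase q).erase r) (Function.update a p (a r)) b := by
  obtain ⟨I, L, R, h⟩ := h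
  set E' := (E.erase q).erase r with hE'
  have hpE' : p ∈ E' := by simp [hE', hs.ne_pq, hs.ne_pr, hs.memp]
  have hrE : r ∈ E.erase q := by simp [hs.ne_qr.symm, hs.memr]
  have qr : q ≠ r := hs.ne_qr
  -- Without `q` and `r`, only `p` is left at `a q` and nothing is left at `b q`.
  have hz : ∀ x, x = a q → ∀ w : β → ZMod 2, ∑ f ∈ E'.erase p with a f = x, w f = 0 := by
    rintro _ rfl w
    refine Finset.sum_eq_zero fun f hf => ?_
    simp only [hE', Finset.mem_filter, Finset.mem_erase] at hf
    rcases hs.eq_left f hf.1.2.2.2 hf.2 with h1 | h1 <;> simp_all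
  have hz' : ∀ x, x = b q → ∀ w : β → ZMod 2, ∑ f ∈ E' with b f = x, w f = 0 := by
    rintro _ rfl w
    refine Finset.sum_eq_zero fun f hf => ?_
    simp only [hE', Finset.mem_filter, Finset.mem_erase] at hf
    rcases hs.eq_right f hf.1.2.2 hf.2 with h1 | h1 <;> simp_all
  have hupd : ∀ x (w : β → ZMod 2), ∑ f ∈ E'.erase p with Function.update a p (a r) f = x, w f =
      ∑ f ∈ E'.erase p with a f = x, w f := by
    intro x w
    refine Finset.sum_congr (Finset.filter_congr fun f hf => ?_) fun _ _ => rfl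
    rw [Function.update_of_ne (Finset.ne_of_mem_erase hf)]
  have sumA : ∀ x (w : β → ZMod 2), ∑ f ∈ E with a f = x, w f =
      (if a q = x then w q else 0) + ((if a r = x then w r else 0) +
        ((if a q = x then w p else 0) + ∑ f ∈ E'.erase p with a f = x, w f)) := by
    intro x w
    rw [sum_filter_erase hs.memq, sum_filter_erase hrE, sum_filter_erase hpE', hs.left]
  have sumA' : ∀ x (w : β → ZMod 2), ∑ f ∈ E' with Function.update a p (a r) f = x, w f =
      (if a r = x then w p else 0) + ∑ f ∈ E'.erase p with a f = x, w f := by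
    intro x w
    rw [sum_filter_erase hpE', hupd, Function.update_self]
  have sumB : ∀ x (w : β → ZMod 2), ∑ f ∈ E with b f = x, w f =
      (if b q = x then w q else 0) + ((if b q = x then w r else 0) +
        ∑ f ∈ E' with b f = x, w f) := by
    intro x w
    rw [sum_filter_erase hs.memq, sum_filter_erase hrE, hs.right]
  have char : ∀ w, IsCyc E a b w ↔
      (w p = w q ∧ w q = w r) ∧ IsCyc E' (Function.update a p (a r)) b w := by
    intro w
    constructor
    · rintro ⟨h1, h2⟩
      have hpq : w p = w q := by
        have := h1 (a q)
        rw [sumA, hz _ rfl, if_pos rfl, if_pos rfl, if_neg hs.ar_ne] at this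
        simp only [zero_add, add_zero] at this
        exact (CharTwo.add_eq_zero.1 this).symm
      have hqr : w q = w r := by
        have := h2 (b q)
        rw [sumB, hz' _ rfl, if_pos rfl, if_pos rfl] at this
        simp only [add_zero] at this
        exact (CharTwo.add_eq_zero.1 this)
      refine ⟨⟨hpq, hqr⟩, fun x => ?_, fun x => ?_⟩
      · have := h1 x
        rw [sumA] at this
        rw [sumA', hpq, hqr]
        rw [hpq, hqr] at this
        by_cases hx : a q = x
        · rw [hz x hx.symm]; subst hx; simp [hs.ar_ne]
        · simpa [hx] using this
      · have := h2 x
        rw [sumB] at this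
        by_cases hx : b q = x
        · exact hz' x hx.symm w
        · simpa [hx] using this
    · rintro ⟨⟨hpq, hqr⟩, h1, h2⟩
      refine ⟨fun x => ?_, fun x => ?_⟩
      · have := h1 x
        rw [sumA'] at this
        rw [sumA, hpq, hqr]
        rw [hpq, hqr] at this
        by_cases hx : a q = x
        · rw [hz x hx.symm]; subst hx
          simp only [hs.ar_ne, if_true, if_false, zero_add, add_zero]
          exact CharTwo.add_self_eq_zero _
        · simpa [hx] using this
      · rw [sumB, h2 x, hqr]
        by_cases hx : b q = x
        · simp only [hx, if_true, add_zero]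
          exact CharTwo.add_self_eq_zero _
        · simp [hx]
  refine ⟨I, L, R, fun z => ?_⟩
  -- A cycle of the reduced graph is extended to `q` and `r` by its value on `p`.
  have hcong : ∀ e ∈ E', z e = Function.update (Function.update z q (z p)) r (z p) e := by
    intro e he
    simp only [hE', Finset.mem_erase] at he
    rw [Function.update_of_ne he.1, Function.update_of_ne he.2.1]
  constructor
  · intro hcyc
    obtain ⟨c, hc⟩ := (h (Function.update (Function.update z q (z p)) r (z p))).1
      ((char _).2 ⟨by simp [hs.ne_pq, hs.ne_pr, hs.ne_qr], (isCyc_congr hcong).1 hcyc⟩)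
    refine ⟨c, fun e he => ?_⟩
    rw [hcong e he]
    exact hc e (by simp only [hE', Finset.mem_erase] at he; exact he.2.2)
  · rintro ⟨c, hc⟩
    have := ((char _).1 ((h (fun e => c (L e) + c (R e))).2 ⟨c, fun _ _ => rfl⟩)).2
    exact (isCyc_congr hc).2 this

/-! ### Surviving vertices and components under suppression. -/

section Series

variable {E S : Finset β} {a b : β → α} {p q r : β}

lemma IsSeries.mem_erase_of_right (h : IsSeries E a b p q r) {g : β} (hg : g ∈ E)
    (hb : b g ≠ b q) : g ∈ (E.erase q).erase r := by
  simp only [Finset.mem_erase]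
  exact ⟨fun h' => hb (h' ▸ h.right.symm), fun h' => hb (h' ▸ rfl), hg⟩

lemma IsSeries.exists_left (h : IsSeries E a b p q r) {g : β} (hg : g ∈ E) (ha : a g ≠ a q) :
    ∃ f ∈ (E.erase q).erase r, Function.update a p (a r) f = a g := by
  by_cases hgr : g = r
  · exact ⟨p, by simp [h.ne_pq, h.ne_pr, h.memp], by simp [hgr]⟩
  · refine ⟨g, ?_, ?_⟩
    · simp only [Finset.mem_erase]
      exact ⟨hgr, fun h' => ha (h' ▸ rfl), hg⟩
    · rw [Function.update_of_ne]
      exact fun h' => ha (h' ▸ h.left)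

lemma IsSeries.update_ne (h : IsSeries E a b p q r) {f : β} (hf : f ∈ (E.erase q).erase r) :
    Function.update a p (a r) f ≠ a q := by
  by_cases hp : f = p
  · subst hp; simpa using h.ar_ne
  · rw [Function.update_of_ne hp]
    intro h'
    simp only [Finset.mem_erase] at hf
    rcases h.eq_left f hf.2.2 h' with h1 | h1
    · exact hp h1
    · exact hf.2.1 h1

lemma IsSeries.right_ne (h : IsSeries E a b p q r) {f : β} (hf : f ∈ (E.erase q).erase r) :
    b f ≠ b q := by
  intro h'
  simp only [Finset.mem_erase] at hf
  rcases h.eq_right f hf.2.2 h' with h1 | h1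
  · exact hf.2.1 h1
  · exact hf.1 h1

lemma IsSeries.exists_update_eq (h : IsSeries E a b p q r) {f : β}
    (hf : f ∈ (E.erase q).erase r) : ∃ g ∈ E, Function.update a p (a r) f = a g := by
  by_cases hp : f = p
  · subst hp; exact ⟨r, h.memr, by simp⟩
  · exact ⟨f, by simp only [Finset.mem_erase] at hf; exact hf.2.2, Function.update_of_ne hp _ _⟩

/-- Collapsing the path to `p` maps edges with a common end to such edges, or to a single edge.
Pulling back along it carries connectedness to the reduced graph. -/
lemma IsSeries.closed_comp (h : IsSeries E a b p q r) {X : β → Prop}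
    (hX : Closed ((E.erase q).erase r) (Function.update a p (a r)) b X) :
    Closed E a b (fun g => X (if g = q ∨ g = r then p else g)) := by
  have hp : p ∈ (E.erase q).erase r := by simp [h.ne_pq, h.ne_pr, h.memp]
  rintro g k ⟨hg, hk, hs | hs⟩ hXg
  · by_cases ha : a g = a q
    · have hk' := h.eq_left k hk (hs ▸ ha)
      have hg' := h.eq_left g hg ha
      have e : ∀ f, f = p ∨ f = q → (if f = q ∨ f = r then p else f) = p := by
        rintro f (rfl | rfl) <;> simp
      simp only [e _ hk']
      simpa only [e _ hg'] using hXg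
    · have e : ∀ f ∈ E, a f ≠ a q → (if f = q ∨ f = r then p else f) ∈ (E.erase q).erase r ∧
          Function.update a p (a r) (if f = q ∨ f = r then p else f) = a f := by
        intro f hf hfa
        have hfq : f ≠ q := fun h' => hfa (h' ▸ rfl)
        have hfp : f ≠ p := fun h' => hfa (h' ▸ h.left)
        by_cases hfr : f = r
        · subst hfr; simp [hp]
        · simp [hfq, hfr, hfp, hf]
      obtain ⟨h1, h2⟩ := e g hg ha
      obtain ⟨h3, h4⟩ := e k hk (hs ▸ ha)
      exact hX _ _ ⟨h1, h3, Or.inl (by rw [h2, h4, hs])⟩ hXg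
  · by_cases hb : b g = b q
    · have hk' := h.eq_right k hk (hs ▸ hb)
      have hg' := h.eq_right g hg hb
      simp only [if_pos hk']
      simpa only [if_pos hg'] using hXg
    · have e : ∀ f ∈ E, b f ≠ b q → ¬ (f = q ∨ f = r) := by
        rintro f _ hfb (h' | h')
        · exact hfb (h' ▸ rfl)
        · exact hfb (h' ▸ h.right.symm)
      have hb' : b k ≠ b q := hs ▸ hb
      simp only [if_neg (e k hk hb')]
      simp only [if_neg (e g hg hb)] at hXg
      exact hX _ _ ⟨h.mem_erase_of_right hg hb, h.mem_erase_of_right hk hb', Or.inr hs⟩ hXg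

end Series

lemma exists_third {E : Finset β} {a : β → α} {x : α} (h : degOn E a x = 3) {p q : β}
    (hp : p ∈ E) (hq : q ∈ E) (hpx : a p = x) (hqx : a q = x) (hpq : p ≠ q) :
    ∃ r ∈ E, a r = x ∧ r ≠ p ∧ r ≠ q ∧ ∀ f ∈ E, a f = x → f = p ∨ f = q ∨ f = r := by
  rw [degOn_erase hp, degOn_erase (e := q) (by simp [hq, hpq.symm])] at h
  rw [if_pos hpx, if_pos hqx] at h
  have h1 : degOn ((E.erase p).erase q) a x = 1 := by omega
  obtain ⟨r, hr⟩ := Finset.card_eq_one.1 h1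
  have hr' := fun f => Finset.ext_iff.1 hr f
  simp only [Finset.mem_filter, Finset.mem_erase, Finset.mem_singleton] at hr'
  have := (hr' r).2 rfl
  refine ⟨r, this.1.2.2, this.2, this.1.2.1, this.1.1, fun f hf hfx => ?_⟩
  by_cases h1 : f = p
  · exact Or.inl h1
  by_cases h2 : f = q
  · exact Or.inr (Or.inl h2)
  exact Or.inr (Or.inr ((hr' f).1 ⟨⟨h2, h1, hf⟩, hfx⟩))

lemma exists_two {E : Finset β} {a : β → α} {x : α} (h : degOn E a x = 3) {p : β}
    (hp : p ∈ E) (hpx : a p = x) :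
    ∃ q ∈ E, ∃ r ∈ E, a q = x ∧ a r = x ∧ q ≠ p ∧ r ≠ p ∧ q ≠ r := by
  rw [degOn_erase hp, if_pos hpx] at h
  have h1 : degOn (E.erase p) a x = 2 := by omega
  obtain ⟨q, r, hqr, hr⟩ := Finset.card_eq_two.1 h1
  have hr' := fun f => Finset.ext_iff.1 hr f
  simp only [Finset.mem_filter, Finset.mem_erase, Finset.mem_singleton, Finset.mem_insert] at hr'
  have h1 := (hr' q).2 (Or.inl rfl)
  have h2 := (hr' r).2 (Or.inr rfl)
  exact ⟨q, h1.1.2, r, h2.1.2, h1.2, h2.2, h1.1.1, h2.1.1, hqr⟩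

/-- Any two edges lie on a common cycle of a 2-factor. -/
def PairsOnCycle (E : Finset β) (a b : β → α) : Prop :=
  ∀ e₁ ∈ E, ∀ e₂ ∈ E, ∃ S, TwoFactor E S a b ∧ e₁ ∈ S ∧ e₂ ∈ S ∧ Linked S a b e₁ e₂

/-! ### Reduction of parallel edges. -/

section Digon

variable {E : Finset β} {a b : β → α}

/-- Three parallel edges exhaust the degrees of their ends, so by connectedness they are the whole
graph, and any two of them form a 2-factor. -/
lemma pairsOnCycle_of_triple (hconn : Conn E a b) (hcub : Cubic E a b) {p p' s : β}
    (hp : p ∈ E) (hp' : p' ∈ E) (hs : s ∈ E) (hpp' : p ≠ p') (hsp : s ≠ p) (hsp' : s ≠ p')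
    (ha' : a p' = a p) (hb' : b p' = b p) (has : a s = a p) (hbs : b s = b p) :
    PairsOnCycle E a b := by
  obtain ⟨t, -, -, ht1, ht2, ht⟩ := exists_third (hcub p hp).1 hp hp' rfl ha' hpp'
  obtain ⟨u, -, -, hu1, hu2, hu⟩ := exists_third (hcub p hp).2 hp hp' rfl hb' hpp'
  have hst : s = t := by rcases ht s hs has with h | h | h <;> [exact (hsp h).elim; exact (hsp' h).elim; exact h]
  have hsu : s = u := by rcases hu s hs hbs with h | h | h <;> [exact (hsp h).elim; exact (hsp' h).elim; exact h]
  subst hst; subst hsu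
  have hall : ∀ f ∈ E, a f = a p ∧ b f = b p := by
    refine hconn (fun f => a f = a p ∧ b f = b p) ?_ ⟨p, hp, rfl, rfl⟩
    rintro e f ⟨he, hf, h | h⟩ ⟨h1, h2⟩
    · rcases ht f hf (h ▸ h1) with rfl | rfl | rfl <;> simp [*]
    · rcases hu f hf (h ▸ h2) with rfl | rfl | rfl <;> simp [*]
  have hdeg : ∀ S ⊆ E, ∀ e ∈ E, degOn S a (a e) = S.card ∧ degOn S b (b e) = S.card := by
    intro S hS e he
    unfold degOn
    rw [Finset.filter_true_of_mem, Finset.filter_true_of_mem]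
    · exact ⟨rfl, rfl⟩
    · intro f hf; rw [(hall f (hS hf)).2, (hall e he).2]
    · intro f hf; rw [(hall f (hS hf)).1, (hall e he).1]
  have main : ∀ e₁ ∈ E, ∀ e₂ ∈ E, e₁ ≠ e₂ →
      ∃ S, TwoFactor E S a b ∧ e₁ ∈ S ∧ e₂ ∈ S ∧ Linked S a b e₁ e₂ := by
    intro e₁ h₁ e₂ h₂ hne
    have hsub : {e₁, e₂} ⊆ E := by
      intro x hx
      simp only [Finset.mem_insert, Finset.mem_singleton] at hx
      rcases hx with rfl | rfl <;> assumption
    refine ⟨{e₁, e₂}, ⟨hsub, fun e he => ?_⟩, by simp, by simp,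
      linked_of_left (by simp) (by simp) (by rw [(hall _ h₁).1, (hall _ h₂).1])⟩
    rw [(hdeg _ hsub e he).1, (hdeg _ hsub e he).2, Finset.card_pair hne]
    exact ⟨rfl, rfl⟩
  intro e₁ h₁ e₂ h₂
  by_cases hne : e₁ = e₂
  · subst hne
    obtain ⟨g, hg, hgne⟩ : ∃ g ∈ E, e₁ ≠ g := by
      by_cases h : e₁ = p
      · exact ⟨p', hp', h ▸ hpp'⟩
      · exact ⟨p, hp, h⟩
    obtain ⟨S, hS, h1, -, -⟩ := main e₁ h₁ g hg hgne
    exact ⟨S, hS, h1, h1, Linked.refl _⟩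
  · exact main e₁ h₁ e₂ h₂ hne

/-- The edges `p` and `p'` are parallel, with ends `x` and `y`; the third edges at `x` and `y` are
`s` and `t`. -/
structure IsDigon (E : Finset β) (a b : β → α) (p p' s t : β) : Prop where
  memp : p ∈ E
  memp' : p' ∈ E
  mems : s ∈ E
  memt : t ∈ E
  ne_pp' : p ≠ p'
  ne_sp : s ≠ p
  ne_sp' : s ≠ p'
  ne_tp : t ≠ p
  ne_tp' : t ≠ p'
  ne_st : s ≠ t
  left : a p' = a p
  right : b p' = b p
  lefts : a s = a p
  rightt : b t = b p
  eq_left : ∀ f ∈ E, a f = a p → f = p ∨ f = p' ∨ f = s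
  eq_right : ∀ f ∈ E, b f = b p → f = p ∨ f = p' ∨ f = t

variable {p p' s t : β}

lemma IsDigon.swap (h : IsDigon E a b p p' s t) : IsDigon E a b p' p s t where
  memp := h.memp'
  memp' := h.memp
  mems := h.mems
  memt := h.memt
  ne_pp' := h.ne_pp'.symm
  ne_sp := h.ne_sp'
  ne_sp' := h.ne_sp
  ne_tp := h.ne_tp'
  ne_tp' := h.ne_tp
  ne_st := h.ne_st
  left := h.left.symm
  right := h.right.symm
  lefts := h.lefts.trans h.left.symm
  rightt := h.rightt.trans h.right.symm
  eq_left := fun f hf h' => by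
    rcases h.eq_left f hf (h'.trans h.left) with h1 | h1 | h1 <;> simp [h1]
  eq_right := fun f hf h' => by
    rcases h.eq_right f hf (h'.trans h.right) with h1 | h1 | h1 <;> simp [h1]

lemma IsDigon.isSeries (h : IsDigon E a b p p' s t) : IsSeries (E.erase p') a b s p t where
  memp := by simp [h.ne_sp', h.mems]
  memq := by simp [h.ne_pp', h.memp]
  memr := by simp [h.ne_tp', h.memt]
  ne_pq := h.ne_sp
  ne_pr := h.ne_st
  ne_qr := h.ne_tp.symm
  left := h.lefts
  right := h.rightt.symm
  eq_left := fun f hf h' => by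
    rw [Finset.mem_erase] at hf
    rcases h.eq_left f hf.2 h' with h1 | h1 | h1 <;> simp_all
  eq_right := fun f hf h' => by
    rw [Finset.mem_erase] at hf
    rcases h.eq_right f hf.2 h' with h1 | h1 | h1 <;> simp_all

lemma IsDigon.conn (h : IsDigon E a b p p' s t) (hc : Conn E a b) :
    Conn (((E.erase p').erase p).erase t) (Function.update a s (a t)) b := by
  rintro X hX ⟨e, he, hXe⟩ f hf
  have h1 := h.isSeries.closed_comp hX
  set Y : β → Prop := fun g => X (if g = p ∨ g = t then s else g) with hY
  have hYe : ∀ g ∈ ((E.erase p').erase p).erase t, g ≠ p' ∧ g ∈ E ∧ (Y g ↔ X g) := by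
    intro g hg
    simp only [Finset.mem_erase] at hg
    simp [hY, hg]
  -- Sending `p'` to the parallel edge `p` changes no end.
  have hZ : Closed E a b (fun g => Y (if g = p' then p else g)) := by
    rintro g k ⟨hg, hk, hs⟩ hYg
    have key : ∀ k ∈ E, (if k = p' then p else k) ∈ E.erase p' ∧
        a (if k = p' then p else k) = a k ∧ b (if k = p' then p else k) = b k := by
      intro k hk
      by_cases hk' : k = p'
      · subst hk'; simp [h.ne_pp', h.memp, h.left, h.right]
      · simp [hk', hk]
    obtain ⟨g1, g2, g3⟩ := key g hg
    obtain ⟨k1, k2, k3⟩ := key k hk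
    exact h1 _ _ ⟨g1, k1, by rw [g2, g3, k2, k3]; exact hs⟩ hYg
  have := hc _ hZ ⟨e, (hYe e he).2.1, by
    simp only [if_neg (hYe e he).1]; exact (hYe e he).2.2.2 hXe⟩ f (hYe f hf).2.1
  simp only [if_neg (hYe f hf).1] at this
  exact (hYe f hf).2.2.1 this

/-- Without `p'`, only the ends of `p` lose degree, and these are the suppressed vertices. -/
lemma IsDigon.cubic (h : IsDigon E a b p p' s t) (hc : Cubic E a b) :
    Cubic (((E.erase p').erase p).erase t) (Function.update a s (a t)) b := by
  intro f hf
  have hs := h.isSeries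
  constructor
  · rw [← hs.degOn_left (Finset.Subset.refl _) (hs.update_ne hf), hs.expand_erase]
    obtain ⟨g, hg, hgf⟩ := hs.exists_update_eq hf
    have := hs.update_ne hf
    rw [hgf] at this ⊢
    rw [← (hc g (Finset.mem_of_mem_erase hg)).1, degOn_erase h.memp', if_neg]
    · omega
    · rw [h.left]; exact this.symm
  · have := hs.right_ne hf
    rw [← hs.degOn_right (Finset.Subset.refl _) this, hs.expand_erase]
    have hfE : f ∈ E := by simp only [Finset.mem_erase] at hf; exact hf.2.2.2
    rw [← (hc f hfE).2, degOn_erase h.memp', if_neg]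
    · omega
    · rw [h.right]; exact this.symm

/-- The cycle through `s` is led along `s`, `p`, `t` and thereby covers both ends of `p`. -/
lemma IsDigon.twoFactor_expand (h : IsDigon E a b p p' s t) {S : Finset β}
    (hS : TwoFactor (((E.erase p').erase p).erase t) S (Function.update a s (a t)) b)
    (hs : s ∈ S) : TwoFactor E (expand S s p t) a b := by
  have hser := h.isSeries
  refine ⟨?_, fun e he => ⟨?_, ?_⟩⟩
  · rw [expand_of_mem hs]
    intro f hf
    simp only [Finset.mem_insert] at hf
    rcases hf with rfl | rfl | hf
    · exact h.memp
    · exact h.memt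
    · have := hS.1 hf
      simp only [Finset.mem_erase] at this
      exact this.2.2.2
  · by_cases ha : a e = a p
    · rw [ha, hser.degOn_left_self hS.1, if_pos hs]
    · have hep : e ≠ p' := fun h' => ha (h' ▸ h.left)
      obtain ⟨f, hf, hfe⟩ := hser.exists_left (g := e) (by simp [hep, he]) ha
      rw [hser.degOn_left hS.1 ha, ← hfe, (hS.2 f hf).1]
  · by_cases hb : b e = b p
    · rw [hb, hser.degOn_right_self hS.1, if_pos hs]
    · have hep : e ≠ p' := fun h' => hb (h' ▸ h.right)
      have hf := hser.mem_erase_of_right (g := e) (by simp [hep, he]) hb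
      rw [hser.degOn_right hS.1 hb, (hS.2 e hf).2]

/-- When the 2-factor avoids `s`, both ends of `p` are still uncovered, and the digon is added as a
cycle of its own. -/
lemma IsDigon.twoFactor_insert (h : IsDigon E a b p p' s t) {S : Finset β}
    (hS : TwoFactor (((E.erase p').erase p).erase t) S (Function.update a s (a t)) b)
    (hs : s ∉ S) : TwoFactor E (insert p (insert p' S)) a b := by
  have hser := h.isSeries
  have hsub : ∀ f ∈ S, f ≠ p ∧ f ≠ p' ∧ f ∈ E := fun f hf => by
    have := hS.1 hf
    simp only [Finset.mem_erase] at this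
    exact ⟨this.2.1, this.2.2.1, this.2.2.2⟩
  have hp' : p' ∉ S := fun h' => (hsub _ h').2.1 rfl
  have hp : p ∉ insert p' S := by
    rw [Finset.mem_insert]
    rintro (h' | h')
    · exact h.ne_pp' h'
    · exact (hsub _ h').1 rfl
  refine ⟨?_, fun e he => ⟨?_, ?_⟩⟩
  · intro f hf
    simp only [Finset.mem_insert] at hf
    rcases hf with rfl | rfl | hf
    · exact h.memp
    · exact h.memp'
    · exact (hsub f hf).2.2
  · rw [degOn_insert hp, degOn_insert hp', h.left]
    by_cases ha : a e = a p
    · have := hser.degOn_left_self hS.1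
      rw [expand_of_notMem hs, if_neg hs] at this
      rw [ha, this]; simp
    · have hep : e ≠ p' := fun h' => ha (h' ▸ h.left)
      obtain ⟨f, hf, hfe⟩ := hser.exists_left (g := e) (by simp [hep, he]) ha
      have := hser.degOn_left hS.1 ha
      rw [expand_of_notMem hs] at this
      rw [this, ← hfe, (hS.2 f hf).1, hfe]; simp [Ne.symm ha]
  · rw [degOn_insert hp, degOn_insert hp', h.right]
    by_cases hb : b e = b p
    · have := hser.degOn_right_self hS.1
      rw [expand_of_notMem hs, if_neg hs] at this
      rw [hb, this]; simp
    · have hep : e ≠ p' := fun h' => hb (h' ▸ h.right)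
      have hf := hser.mem_erase_of_right (g := e) (by simp [hep, he]) hb
      rw [(hS.2 e hf).2]; simp [Ne.symm hb]

lemma IsDigon.pairsOnCycle (h : IsDigon E a b p p' s t) (hc : Cubic E a b)
    (ih : PairsOnCycle (((E.erase p').erase p).erase t) (Function.update a s (a t)) b) :
    PairsOnCycle E a b := by
  have hsE : s ∈ ((E.erase p').erase p).erase t := by
    simp [h.ne_st, h.ne_sp, h.ne_sp', h.mems]
  have retr : ∀ e ∈ E, e ≠ p → e ≠ p' → ∃ f ∈ ((E.erase p').erase p).erase t,
      ∀ S : Finset β, f ∈ S → e ∈ expand S s p t ∧ Linked (expand S s p t) a b e f := by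
    intro e he hep hep'
    by_cases het : e = t
    · subst het
      refine ⟨s, hsE, fun S hS => ⟨?_, (h.isSeries.linked_pr hS).symm⟩⟩
      simp [expand_of_mem hS]
    · exact ⟨e, by simp [het, hep, hep', he], fun S hS => ⟨subset_expand hS, Linked.refl _⟩⟩
  have outer : ∀ e₁ ∈ E, ∀ e₂ ∈ E, e₁ ≠ p → e₁ ≠ p' → e₂ ≠ p → e₂ ≠ p' →
      ∃ S, TwoFactor E S a b ∧ e₁ ∈ S ∧ e₂ ∈ S ∧ Linked S a b e₁ e₂ := by
    intro e₁ h₁ e₂ h₂ n1 n2 n3 n4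
    obtain ⟨f₁, hf₁, g₁⟩ := retr e₁ h₁ n1 n2
    obtain ⟨f₂, hf₂, g₂⟩ := retr e₂ h₂ n3 n4
    obtain ⟨S, hS, i1, i2, hl⟩ := ih f₁ hf₁ f₂ hf₂
    have hL : Linked (expand S s p t) a b e₁ e₂ :=
      ((g₁ S i1).2.trans (h.isSeries.linked_expand hl)).trans (g₂ S i2).2.symm
    by_cases hs : s ∈ S
    · exact ⟨_, h.twoFactor_expand hS hs, (g₁ S i1).1, (g₂ S i2).1, hL⟩
    · have hsub : expand S s p t ⊆ insert p (insert p' S) := by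
        rw [expand_of_notMem hs]; intro x hx; simp [hx]
      refine ⟨_, h.twoFactor_insert hS hs, hsub (g₁ S i1).1, hsub (g₂ S i2).1, ?_⟩
      exact hL.map (φ := id) fun e f hsh =>
        Relation.ReflTransGen.single ⟨hsub hsh.1, hsub hsh.2.1, hsh.2.2⟩
  -- When one of the edges is `p`, the smaller 2-factor is asked to contain `s`, so that its lift
  -- runs through `p`. Quantifying over `p` and `p'` again covers the exchanged roles.
  have mixed : ∀ p p', IsDigon E a b p p' s t →
      PairsOnCycle (((E.erase p').erase p).erase t) (Function.update a s (a t)) b →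
      ∀ e₂ ∈ E, e₂ ≠ p' →
      ∃ S, TwoFactor E S a b ∧ p ∈ S ∧ e₂ ∈ S ∧ Linked S a b p e₂ := by
    intro p p' h ih e₂ h₂ hne
    have hsE : s ∈ ((E.erase p').erase p).erase t := by
      simp [h.ne_st, h.ne_sp, h.ne_sp', h.mems]
    have retr : ∃ f ∈ ((E.erase p').erase p).erase t,
        ∀ S : Finset β, s ∈ S → f ∈ S →
          e₂ ∈ expand S s p t ∧ Linked (expand S s p t) a b e₂ f := by
      by_cases h1 : e₂ = t
      · refine ⟨s, hsE, fun S hS _ => ⟨?_, ?_⟩⟩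
        · simp [expand_of_mem hS, h1]
        · rw [h1]; exact (h.isSeries.linked_pr hS).symm
      by_cases h2 : e₂ = p
      · refine ⟨s, hsE, fun S hS _ => ⟨?_, ?_⟩⟩
        · simp [expand_of_mem hS, h2]
        · rw [h2]; exact (h.isSeries.linked_pq hS h.lefts).symm
      · exact ⟨e₂, by simp [h1, h2, hne, h₂],
          fun S _ hS => ⟨subset_expand hS, Linked.refl _⟩⟩
    obtain ⟨f, hf, hg⟩ := retr
    obtain ⟨S, hS, i1, i2, hl⟩ := ih s hsE f hf
    refine ⟨_, h.twoFactor_expand hS i1, by simp [expand_of_mem i1], (hg S i1 i2).1, ?_⟩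
    exact ((h.isSeries.linked_pq i1 h.lefts).symm.trans (h.isSeries.linked_expand hl)).trans
      (hg S i1 i2).2.symm
  have ih' : PairsOnCycle (((E.erase p).erase p').erase t) (Function.update a s (a t)) b := by
    rwa [Finset.erase_right_comm (a := p)]
  -- To have both `p` and `p'`, the smaller 2-factor must avoid `s`. It does if it contains the
  -- other two edges at `b s`, since `s` would be a third one there.
  have both : ∃ S, TwoFactor E S a b ∧ p ∈ S ∧ p' ∈ S ∧ Linked S a b p p' := by
    obtain ⟨g, hg, k, hk, hgs, hks, hgn, hkn, hgk⟩ := exists_two (h.cubic hc s hsE).2 hsE rfl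
    obtain ⟨S, hS, i1, i2, -⟩ := ih g hg k hk
    have hs : s ∉ S := by
      intro hs
      have := (hS.2 s hsE).2
      rw [degOn_erase hs, degOn_erase (e := g) (by simp [hgn, i1]),
        degOn_erase (e := k) (by simp [hkn, hgk.symm, i2]), if_pos rfl, if_pos hgs,
        if_pos hks] at this
      omega
    refine ⟨_, h.twoFactor_insert hS hs, by simp, by simp, linked_of_left (by simp) (by simp)
      h.left.symm⟩
  intro e₁ h₁ e₂ h₂
  have symm : ∀ {e f : β}, (∃ S, TwoFactor E S a b ∧ e ∈ S ∧ f ∈ S ∧ Linked S a b e f) →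
      ∃ S, TwoFactor E S a b ∧ f ∈ S ∧ e ∈ S ∧ Linked S a b f e := by
    rintro e f ⟨S, x1, x2, x3, x4⟩
    exact ⟨S, x1, x3, x2, x4.symm⟩
  by_cases c1 : e₁ = p
  · subst c1
    by_cases c2 : e₂ = p'
    · subst c2; exact both
    · exact mixed _ _ h ih e₂ h₂ c2
  by_cases c2 : e₁ = p'
  · subst c2
    by_cases c3 : e₂ = p
    · subst c3; exact symm both
    · exact mixed _ _ h.swap ih' e₂ h₂ c3
  by_cases c3 : e₂ = p
  · subst c3; exact symm (mixed _ _ h ih e₁ h₁ c2)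
  by_cases c4 : e₂ = p'
  · subst c4; exact symm (mixed _ _ h.swap ih' e₁ h₁ c1)
  exact outer e₁ h₁ e₂ h₂ c1 c2 c3 c4

end Digon

/-- The edges `q₁₂`, `q₂₃`, `q₃₄`, `q₄₁` form a 4-cycle with vertices `v₁`, `v₂`, `v₃`, `v₄`,
where `v₁` and `v₃` are in the first class, and `fᵢ` is the third edge at `vᵢ`. -/
structure IsQuad (E : Finset β) (a b : β → α) (f₁ f₂ f₃ f₄ q₁₂ q₂₃ q₃₄ q₄₁ : β) : Prop where
  mem : f₁ ∈ E ∧ f₂ ∈ E ∧ f₃ ∈ E ∧ f₄ ∈ E ∧ q₁₂ ∈ E ∧ q₂₃ ∈ E ∧ q₃₄ ∈ E ∧ q₄₁ ∈ E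
  nodup : [f₁, f₂, f₃, f₄, q₁₂, q₂₃, q₃₄, q₄₁].Nodup
  left₁ : ∀ f ∈ E, a f = a q₁₂ ↔ f = f₁ ∨ f = q₁₂ ∨ f = q₄₁
  right₂ : ∀ f ∈ E, b f = b q₁₂ ↔ f = f₂ ∨ f = q₁₂ ∨ f = q₂₃
  left₃ : ∀ f ∈ E, a f = a q₃₄ ↔ f = f₃ ∨ f = q₃₄ ∨ f = q₂₃
  right₄ : ∀ f ∈ E, b f = b q₃₄ ↔ f = f₄ ∨ f = q₃₄ ∨ f = q₄₁

/-- The edges that remain when a 4-cycle is reduced. -/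
def reduceEdges (E : Finset β) (f₂ f₄ q₁₂ q₂₃ q₃₄ q₄₁ : β) : Finset β :=
  (((((E.erase q₂₃).erase q₄₁).erase q₁₂).erase f₂).erase q₃₄).erase f₄

/-- The new ends of the edges that remain when a 4-cycle is reduced. -/
def reduceEnd (a : β → α) (f₁ f₂ f₃ f₄ : β) : β → α :=
  Function.update (Function.update a f₁ (a f₂)) f₃ (a f₄)

lemma mem_reduceEdges {E : Finset β} {f₂ f₄ q₁₂ q₂₃ q₃₄ q₄₁ e : β} :
    e ∈ reduceEdges E f₂ f₄ q₁₂ q₂₃ q₃₄ q₄₁ ↔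
      e ≠ f₄ ∧ e ≠ q₃₄ ∧ e ≠ f₂ ∧ e ≠ q₁₂ ∧ e ≠ q₄₁ ∧ e ≠ q₂₃ ∧ e ∈ E := by
  simp [reduceEdges]

/-! ### The two reductions of a 4-cycle. -/

section Quad

variable {E S : Finset β} {a b : β → α} {f₁ f₂ f₃ f₄ q₁₂ q₂₃ q₃₄ q₄₁ : β}

/-- The same 4-cycle, traversed in the opposite direction. -/
lemma IsQuad.swap (h : IsQuad E a b f₁ f₂ f₃ f₄ q₁₂ q₂₃ q₃₄ q₄₁) :
    IsQuad E a b f₁ f₄ f₃ f₂ q₄₁ q₃₄ q₂₃ q₁₂ := by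
  obtain ⟨h1, h2, h3, h4, h5, h6⟩ := h
  have e1 := (h3 q₄₁ (by tauto)).2 (by tauto)
  have e2 := (h4 q₂₃ (by tauto)).2 (by tauto)
  have e3 := (h5 q₂₃ (by tauto)).2 (by tauto)
  have e4 := (h6 q₄₁ (by tauto)).2 (by tauto)
  refine ⟨by tauto, ?_, ?_, ?_, ?_, ?_⟩
  · simp only [List.nodup_cons, List.mem_cons, List.not_mem_nil, or_false, not_or,
      List.nodup_nil, not_false_eq_true, and_true] at h2 ⊢
    grind
  · intro f hf; rw [e1, h3 f hf]; tauto
  · intro f hf; rw [e4, h6 f hf]; tauto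
  · intro f hf; rw [e3, h5 f hf]; tauto
  · intro f hf; rw [e2, h4 f hf]; tauto

lemma IsQuad.ends (h : IsQuad E a b f₁ f₂ f₃ f₄ q₁₂ q₂₃ q₃₄ q₄₁) :
    a f₁ = a q₁₂ ∧ a q₄₁ = a q₁₂ ∧ b f₂ = b q₁₂ ∧ b q₂₃ = b q₁₂ ∧ a f₃ = a q₃₄ ∧
      a q₂₃ = a q₃₄ ∧ b f₄ = b q₃₄ ∧ b q₄₁ = b q₃₄ ∧ a q₁₂ ≠ a q₃₄ ∧ b q₁₂ ≠ b q₃₄ ∧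
      a f₂ ≠ a q₁₂ ∧ a f₂ ≠ a q₃₄ ∧ a f₄ ≠ a q₁₂ ∧ a f₄ ≠ a q₃₄ ∧
      b f₁ ≠ b q₁₂ ∧ b f₁ ≠ b q₃₄ ∧ b f₃ ≠ b q₁₂ ∧ b f₃ ≠ b q₃₄ := by
  obtain ⟨⟨m1, m2, m3, m4, m5, m6, m7, m8⟩, h2, h3, h4, h5, h6⟩ := h
  simp only [List.nodup_cons, List.mem_cons, List.not_mem_nil, or_false, not_or,
      List.nodup_nil, not_false_eq_true, and_true] at h2
  refine ⟨(h3 _ m1).2 (by tauto), (h3 _ m8).2 (by tauto), (h4 _ m2).2 (by tauto),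
    (h4 _ m6).2 (by tauto), (h5 _ m3).2 (by tauto), (h5 _ m6).2 (by tauto),
    (h6 _ m4).2 (by tauto), (h6 _ m8).2 (by tauto), ?_, ?_, ?_, ?_, ?_, ?_, ?_, ?_, ?_, ?_⟩ <;>
  · intro h'
    first
    | have := (h5 _ (by assumption)).1 h'; grind
    | have := (h6 _ (by assumption)).1 h'; grind
    | have := (h3 _ (by assumption)).1 h'; grind
    | have := (h4 _ (by assumption)).1 h'; grind

/-- Without `q₂₃` and `q₄₁`, all vertices of the 4-cycle have degree two. The reduction suppresses
the path `f₁`, `q₁₂`, `f₂` and after it the path `f₃`, `q₃₄`, `f₄`. -/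
lemma IsQuad.isSeries₁ (h : IsQuad E a b f₁ f₂ f₃ f₄ q₁₂ q₂₃ q₃₄ q₄₁) :
    IsSeries ((E.erase q₂₃).erase q₄₁) a b f₁ q₁₂ f₂ := by
  obtain ⟨⟨m1, m2, m3, m4, m5, m6, m7, m8⟩, h2, h3, h4, h5, h6⟩ := h
  simp only [List.nodup_cons, List.mem_cons, List.not_mem_nil, or_false, not_or,
      List.nodup_nil, not_false_eq_true, and_true] at h2
  constructor <;> (try simp only [Finset.mem_erase]) <;> grind

lemma IsQuad.isSeries₂ (h : IsQuad E a b f₁ f₂ f₃ f₄ q₁₂ q₂₃ q₃₄ q₄₁) :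
    IsSeries ((((E.erase q₂₃).erase q₄₁).erase q₁₂).erase f₂)
      (Function.update a f₁ (a f₂)) b f₃ q₃₄ f₄ := by
  have he := h.ends
  obtain ⟨⟨m1, m2, m3, m4, m5, m6, m7, m8⟩, h2, h3, h4, h5, h6⟩ := h
  simp only [List.nodup_cons, List.mem_cons, List.not_mem_nil, or_false, not_or,
      List.nodup_nil, not_false_eq_true, and_true] at h2
  constructor <;> (try simp only [Finset.mem_erase, Function.update_apply]) <;> grind

/-- The first suppression does not move the end of `f₄`, as `f₄ ≠ f₁`; so `reduceEnd` is the effect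
of two successive suppressions. -/
lemma IsQuad.reduceEnd_eq (h : IsQuad E a b f₁ f₂ f₃ f₄ q₁₂ q₂₃ q₃₄ q₄₁) :
    reduceEnd a f₁ f₂ f₃ f₄ = Function.update (Function.update a f₁ (a f₂)) f₃
      (Function.update a f₁ (a f₂) f₄) := by
  have h2 := h.nodup
  simp only [List.nodup_cons, List.mem_cons, List.not_mem_nil, or_false, not_or,
      List.nodup_nil, not_false_eq_true, and_true] at h2
  rw [reduceEnd, Function.update_of_ne (a := f₄)]
  tauto

lemma IsQuad.hasDual (h : IsQuad E a b f₁ f₂ f₃ f₄ q₁₂ q₂₃ q₃₄ q₄₁) (hd : HasDual E a b) :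
    HasDual (reduceEdges E f₂ f₄ q₁₂ q₂₃ q₃₄ q₄₁) (reduceEnd a f₁ f₂ f₃ f₄) b := by
  have h2 := h.nodup
  simp only [List.nodup_cons, List.mem_cons, List.not_mem_nil, or_false, not_or,
      List.nodup_nil, not_false_eq_true, and_true] at h2
  rw [h.reduceEnd_eq]
  refine (HasDual.suppress ?_ h.isSeries₁).suppress h.isSeries₂
  have := h.mem
  exact (hd.erase (by tauto)).erase (by simp; tauto)

lemma IsQuad.cubic (h : IsQuad E a b f₁ f₂ f₃ f₄ q₁₂ q₂₃ q₃₄ q₄₁) (hc : Cubic E a b) :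
    Cubic (reduceEdges E f₂ f₄ q₁₂ q₂₃ q₃₄ q₄₁) (reduceEnd a f₁ f₂ f₃ f₄) b := by
  rw [h.reduceEnd_eq]
  unfold reduceEdges
  have s1 := h.isSeries₁
  have s2 := h.isSeries₂
  have he := h.ends
  have hm := h.mem
  have h2 := h.nodup
  simp only [List.nodup_cons, List.mem_cons, List.not_mem_nil, or_false, not_or,
      List.nodup_nil, not_false_eq_true, and_true] at h2
  intro f hf
  constructor
  · have n2 := s2.update_ne hf
    rw [← s2.degOn_left (Finset.Subset.refl _) n2, s2.expand_erase]
    obtain ⟨g, hg, hgf⟩ := s2.exists_update_eq hf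
    rw [hgf] at n2 ⊢
    have n1 := s1.update_ne hg
    rw [← s1.degOn_left (Finset.Subset.refl _) n1, s1.expand_erase]
    obtain ⟨k, hk, hkg⟩ := s1.exists_update_eq hg
    rw [hkg] at n1 n2 ⊢
    rw [Function.update_of_ne (a := q₃₄) (by tauto)] at n2
    have hkE : k ∈ E := by simp only [Finset.mem_erase] at hk; exact hk.2.2
    rw [← (hc k hkE).1, degOn_erase (show q₂₃ ∈ E by tauto), if_neg (by grind),
      degOn_erase (S := E.erase q₂₃) (e := q₄₁) (by simp [h2, Ne.symm, hm]), if_neg (by grind)]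
    omega
  · have n2 := s2.right_ne hf
    have hf' := Finset.mem_of_mem_erase (Finset.mem_of_mem_erase hf)
    have n1 := s1.right_ne hf'
    rw [← s2.degOn_right (Finset.Subset.refl _) n2, s2.expand_erase,
      ← s1.degOn_right (Finset.Subset.refl _) n1, s1.expand_erase]
    have hfE : f ∈ E := by simp only [Finset.mem_erase] at hf'; exact hf'.2.2.2.2
    rw [← (hc f hfE).2, degOn_erase (show q₂₃ ∈ E by tauto), if_neg (by grind),
      degOn_erase (S := E.erase q₂₃) (e := q₄₁) (by simp [h2, Ne.symm, hm]), if_neg (by grind)]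
    omega

/-- The deleted edges meet only edges at the 4-cycle. If those all have the truth value `P`, giving
`P` to the deleted edges as well keeps the set closed. -/
lemma IsQuad.closed_extend (h : IsQuad E a b f₁ f₂ f₃ f₄ q₁₂ q₂₃ q₃₄ q₄₁) {Y : β → Prop} {P : Prop}
    (hY : Closed ((E.erase q₂₃).erase q₄₁) a b Y) (y1 : Y f₁ ↔ P) (y2 : Y f₂ ↔ P)
    (y3 : Y f₃ ↔ P) (y4 : Y f₄ ↔ P) (y1' : Y q₁₂ ↔ P) (y3' : Y q₃₄ ↔ P) :
    Closed E a b (fun g => if g = q₂₃ ∨ g = q₄₁ then P else Y g) := by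
  have he := h.ends
  have key : ∀ g ∈ E, a g = a q₁₂ ∨ a g = a q₃₄ ∨ b g = b q₁₂ ∨ b g = b q₃₄ →
      ((if g = q₂₃ ∨ g = q₄₁ then P else Y g) ↔ P) := by
    intro g hg hs
    rw [h.left₁ g hg, h.left₃ g hg, h.right₂ g hg, h.right₄ g hg] at hs
    clear he
    split_ifs with hif
    · rfl
    · rcases hs with (rfl | rfl | rfl) | (rfl | rfl | rfl) | (rfl | rfl | rfl) |
        (rfl | rfl | rfl) <;> first | assumption | exact (hif (Or.inl rfl)).elim |
          exact (hif (Or.inr rfl)).elim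
  have key2 : ∀ g k, g ∈ E → k ∈ E → (a g = a k ∨ b g = b k) → (g = q₂₃ ∨ g = q₄₁) →
      ((if g = q₂₃ ∨ g = q₄₁ then P else Y g) ↔
      (if k = q₂₃ ∨ k = q₄₁ then P else Y k)) := by
    intro g k hg hk hs hgq
    have : (a g = a q₁₂ ∨ a g = a q₃₄) ∧ (b g = b q₁₂ ∨ b g = b q₃₄) := by
      rcases hgq with rfl | rfl <;> simp [he]
    have h1 : a g = a q₁₂ ∨ a g = a q₃₄ ∨ b g = b q₁₂ ∨ b g = b q₃₄ := by
      rcases this.1 with h | h <;> simp [h]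
    have h2 : a k = a q₁₂ ∨ a k = a q₃₄ ∨ b k = b q₁₂ ∨ b k = b q₃₄ := by
      rcases hs with hs | hs <;> rw [← hs]
      · exact this.1.elim Or.inl fun h => Or.inr (Or.inl h)
      · exact Or.inr (Or.inr this.2)
    rw [key g hg h1, key k hk h2]
  rintro g k ⟨hg, hk, hs⟩ hXg
  by_cases hgq : g = q₂₃ ∨ g = q₄₁
  · exact (key2 g k hg hk hs hgq).1 hXg
  by_cases hkq : k = q₂₃ ∨ k = q₄₁
  · exact (key2 k g hk hg (hs.imp Eq.symm Eq.symm) hkq).2 hXg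
  rw [if_neg hkq]
  rw [if_neg hgq] at hXg
  rw [not_or] at hgq hkq
  exact hY g k ⟨by simp [hgq, hg], by simp [hkq, hk], hs⟩ hXg

/-- If one of the two ways to reduce a 4-cycle does not give a connected graph, then the two new
edges are in different components. -/
lemma IsQuad.exists_closed (h : IsQuad E a b f₁ f₂ f₃ f₄ q₁₂ q₂₃ q₃₄ q₄₁) (hc : Conn E a b)
    (hn : ¬ Conn (reduceEdges E f₂ f₄ q₁₂ q₂₃ q₃₄ q₄₁) (reduceEnd a f₁ f₂ f₃ f₄) b) :
    ∃ X, Closed (reduceEdges E f₂ f₄ q₁₂ q₂₃ q₃₄ q₄₁) (reduceEnd a f₁ f₂ f₃ f₄) b X ∧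
      X f₁ ∧ ¬ X f₃ := by
  have s1 := h.isSeries₁
  have s2 := h.isSeries₂
  have he := h.ends
  have hm := h.mem
  have h2 := h.nodup
  simp only [List.nodup_cons, List.mem_cons, List.not_mem_nil, or_false, not_or,
      List.nodup_nil, not_false_eq_true, and_true] at h2
  unfold Conn at hn
  push Not at hn
  obtain ⟨X, hX, ⟨e, heE, hXe⟩, f, hfE, hXf⟩ := hn
  -- If `X` agrees on the two new edges, it extends to a closed set that contradicts the
  -- connectedness of `E`. Otherwise `X` or its complement is as required.
  by_cases hiff : X f₁ ↔ X f₃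
  · exfalso
    have hX' := hX
    rw [h.reduceEnd_eq] at hX'
    have c1 := s1.closed_comp (s2.closed_comp hX')
    set Y : β → Prop := fun g => (fun g => X (if g = q₃₄ ∨ g = f₄ then f₃ else g))
      (if g = q₁₂ ∨ g = f₂ then f₁ else g) with hY
    have hYe : ∀ g ∈ reduceEdges E f₂ f₄ q₁₂ q₂₃ q₃₄ q₄₁, Y g ↔ X g := by
      intro g hg
      rw [mem_reduceEdges] at hg
      simp [hY, hg]
    have y1 : Y f₁ ↔ X f₁ := by simp [hY, h2]
    have y3 : Y f₃ ↔ X f₁ := by simp [hY, h2, hiff, Ne.symm]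
    have y1' : Y q₁₂ ↔ X f₁ := by simp [hY, h2]
    have y2 : Y f₂ ↔ X f₁ := by simp [hY, h2]
    have y3' : Y q₃₄ ↔ X f₁ := by simp [hY, h2, hiff, Ne.symm]
    have y4 : Y f₄ ↔ X f₁ := by simp [hY, h2, hiff, Ne.symm]
    have hZ := h.closed_extend c1 y1 y2 y3 y4 y1' y3'
    have g1 := mem_reduceEdges.1 heE
    have g2 := mem_reduceEdges.1 hfE
    have := hc _ hZ ⟨e, g1.2.2.2.2.2.2, by
      rw [if_neg (by simp [g1]), hYe e heE]; exact hXe⟩ f g2.2.2.2.2.2.2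
    rw [if_neg (by simp [g2]), hYe f hfE] at this
    exact hXf this
  · by_cases h1 : X f₁
    · exact ⟨X, hX, h1, by tauto⟩
    · exact ⟨_, hX.compl, h1, by tauto⟩

/-- One of the two ways to reduce a 4-cycle gives a connected graph. -/
lemma IsQuad.conn_or (h : IsQuad E a b f₁ f₂ f₃ f₄ q₁₂ q₂₃ q₃₄ q₄₁) (hc : Conn E a b)
    (hcub : Cubic E a b) :
    Conn (reduceEdges E f₂ f₄ q₁₂ q₂₃ q₃₄ q₄₁) (reduceEnd a f₁ f₂ f₃ f₄) b ∨
    Conn (reduceEdges E f₄ f₂ q₄₁ q₃₄ q₂₃ q₁₂) (reduceEnd a f₁ f₄ f₃ f₂) b := by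
  by_contra! hcon
  obtain ⟨X, hX, hX1, hX3⟩ := h.exists_closed hc hcon.1
  obtain ⟨Y, hY, hY1, hY3⟩ := h.swap.exists_closed hc hcon.2
  have he := h.ends
  have hm := h.mem
  have h2 := h.nodup
  simp only [List.nodup_cons, List.mem_cons, List.not_mem_nil, or_false, not_or,
      List.nodup_nil, not_false_eq_true, and_true] at h2
  classical
  -- If both reductions fail, `T` is attached to the rest of the graph by the bridge `f₁` only.
  -- Every vertex of the second class that meets `T` has its three edges in `T`, and so does every
  -- vertex of the first class other than `a f₁`, where `T` contains just `f₁`. Thus 3 divides both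
  -- `T.card` and `T.card - 1`.
  set T := (reduceEdges E f₂ f₄ q₁₂ q₂₃ q₃₄ q₄₁).filter (fun e => X e ∧ Y e) with hT
  have memT : ∀ e, e ∈ T ↔ e ∈ reduceEdges E f₂ f₄ q₁₂ q₂₃ q₃₄ q₄₁ ∧ X e ∧ Y e := by
    intro e; rw [hT, Finset.mem_filter]
  have hmem : ∀ e, e ∈ reduceEdges E f₄ f₂ q₄₁ q₃₄ q₂₃ q₁₂ ↔
      e ∈ reduceEdges E f₂ f₄ q₁₂ q₂₃ q₃₄ q₄₁ := by
    intro e; rw [mem_reduceEdges, mem_reduceEdges]; tauto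
  have m1 : f₁ ∈ reduceEdges E f₂ f₄ q₁₂ q₂₃ q₃₄ q₄₁ := by rw [mem_reduceEdges]; grind
  have m3 : f₃ ∈ reduceEdges E f₂ f₄ q₁₂ q₂₃ q₃₄ q₄₁ := by rw [mem_reduceEdges]; grind
  have hT1 : f₁ ∈ T := (memT _).2 ⟨m1, hX1, hY1⟩
  have d1 : T.card = 3 * (T.image b).card := by
    refine dvd_card_of_degOn fun e heT => ?_
    obtain ⟨h1, hXe, hYe⟩ := (memT e).1 heT
    have h1' := mem_reduceEdges.1 h1
    have hbne : b e ≠ b q₁₂ ∧ b e ≠ b q₃₄ := by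
      have r2 := h.right₂ e h1'.2.2.2.2.2.2
      have r4 := h.right₄ e h1'.2.2.2.2.2.2
      grind
    rw [← (hcub e h1'.2.2.2.2.2.2).2]
    refine le_antisymm (Finset.card_le_card (Finset.filter_subset_filter _ ?_))
      (Finset.card_le_card ?_)
    · intro f hf
      exact (mem_reduceEdges.1 ((memT f).1 hf).1).2.2.2.2.2.2
    · intro f hf
      rw [Finset.mem_filter] at hf ⊢
      have hfr : f ∈ reduceEdges E f₂ f₄ q₁₂ q₂₃ q₃₄ q₄₁ := by
        rw [mem_reduceEdges]; grind
      refine ⟨(memT f).2 ⟨hfr, hX e f ⟨h1, hfr, Or.inr hf.2.symm⟩ hXe,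
        hY e f ⟨(hmem _).2 h1, (hmem _).2 hfr, Or.inr hf.2.symm⟩ hYe⟩, hf.2⟩
  have d2 : (T.erase f₁).card = 3 * ((T.erase f₁).image a).card := by
    refine dvd_card_of_degOn fun e heT => ?_
    rw [Finset.mem_erase] at heT
    obtain ⟨hef, heT⟩ := heT
    obtain ⟨h1, hXe, hYe⟩ := (memT e).1 heT
    have h1' := mem_reduceEdges.1 h1
    have hef3 : e ≠ f₃ := fun h' => hX3 (h' ▸ hXe)
    have hane : a e ≠ a q₁₂ ∧ a e ≠ a q₃₄ := by
      have r2 := h.left₁ e h1'.2.2.2.2.2.2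
      have r4 := h.left₃ e h1'.2.2.2.2.2.2
      grind
    rw [← (hcub e h1'.2.2.2.2.2.2).1]
    refine le_antisymm (Finset.card_le_card (Finset.filter_subset_filter _ ?_))
      (Finset.card_le_card ?_)
    · intro f hf
      exact (mem_reduceEdges.1 ((memT f).1 (Finset.mem_of_mem_erase hf)).1).2.2.2.2.2.2
    · intro f hf
      rw [Finset.mem_filter] at hf ⊢
      have r13 : f₁ ≠ f₃ := by grind
      -- The edge `f₃` inherits the end of `f₂` in the second reduction and that of `f₄` in the
      -- first. If `f` were one of these, then `Y` or `X` would spread from `e` to `f₃`.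
      have ne2 : f ≠ f₂ := by
        rintro rfl
        refine hY3 (hY e f₃ ⟨(hmem _).2 h1, (hmem _).2 m3, Or.inl ?_⟩ hYe)
        simp only [reduceEnd, Function.update_self, Function.update_of_ne hef3,
          Function.update_of_ne hef]
        exact hf.2.symm
      have ne4 : f ≠ f₄ := by
        rintro rfl
        refine hX3 (hX e f₃ ⟨h1, m3, Or.inl ?_⟩ hXe)
        simp only [reduceEnd, Function.update_self, Function.update_of_ne hef3,
          Function.update_of_ne hef]
        exact hf.2.symm
      have ne1 : f ≠ f₁ := by grind
      have ne3 : f ≠ f₃ := by grind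
      have hfr : f ∈ reduceEdges E f₂ f₄ q₁₂ q₂₃ q₃₄ q₄₁ := by
        rw [mem_reduceEdges]; grind
      have hse : ∀ g k, reduceEnd a f₁ g f₃ k e = reduceEnd a f₁ g f₃ k f := by
        intro g k
        simp only [reduceEnd, Function.update_of_ne hef3, Function.update_of_ne hef,
          Function.update_of_ne ne1, Function.update_of_ne ne3]
        exact hf.2.symm
      refine ⟨Finset.mem_erase.2 ⟨ne1, (memT f).2 ⟨hfr, hX e f ⟨h1, hfr, Or.inl (hse _ _)⟩ hXe,
        hY e f ⟨(hmem _).2 h1, (hmem _).2 hfr, Or.inl (hse _ _)⟩ hYe⟩⟩, hf.2⟩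
  have := Finset.card_erase_add_one hT1
  omega

end Quad

/-! ### Lifting 2-factors through the reduction of a 4-cycle. -/

section Quad

variable {E S : Finset β} {a b : β → α} {f₁ f₂ f₃ f₄ q₁₂ q₂₃ q₃₄ q₄₁ : β}

/-- The set of edges, of the graph without `q₂₃` and `q₄₁`, that corresponds to the set `S` of
edges of the graph in which the 4-cycle is reduced. -/
def expandQuad (S : Finset β) (f₁ f₂ f₃ f₄ q₁₂ q₃₄ : β) : Finset β :=
  expand (expand S f₃ q₃₄ f₄) f₁ q₁₂ f₂

lemma mem_expand {p q r e : β} :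
    e ∈ expand S p q r ↔ e ∈ S ∨ (p ∈ S ∧ (e = q ∨ e = r)) := by
  unfold expand
  split_ifs with h
  · simp only [Finset.mem_insert, h, true_and]; tauto
  · simp [h]

lemma IsQuad.mem_expandQuad (h : IsQuad E a b f₁ f₂ f₃ f₄ q₁₂ q₂₃ q₃₄ q₄₁) {e : β} :
    e ∈ expandQuad S f₁ f₂ f₃ f₄ q₁₂ q₃₄ ↔
      e ∈ S ∨ (f₃ ∈ S ∧ (e = q₃₄ ∨ e = f₄)) ∨ (f₁ ∈ S ∧ (e = q₁₂ ∨ e = f₂)) := by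
  have h2 := h.nodup
  simp only [List.nodup_cons, List.mem_cons, List.not_mem_nil, or_false, not_or,
      List.nodup_nil, not_false_eq_true, and_true] at h2
  unfold expandQuad
  simp only [mem_expand, h2, or_false, and_false, or_assoc]

lemma IsQuad.expandQuad_subset (h : IsQuad E a b f₁ f₂ f₃ f₄ q₁₂ q₂₃ q₃₄ q₄₁)
    (hS : S ⊆ reduceEdges E f₂ f₄ q₁₂ q₂₃ q₃₄ q₄₁) :
    expandQuad S f₁ f₂ f₃ f₄ q₁₂ q₃₄ ⊆ (E.erase q₂₃).erase q₄₁ := by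
  have h2 := h.nodup
  have hm := h.mem
  simp only [List.nodup_cons, List.mem_cons, List.not_mem_nil, or_false, not_or,
      List.nodup_nil, not_false_eq_true, and_true] at h2
  intro e he
  rw [h.mem_expandQuad] at he
  rcases he with he | ⟨-, rfl | rfl⟩ | ⟨-, rfl | rfl⟩
  · have := mem_reduceEdges.1 (hS he)
    simp [this]
  all_goals simp [h2, hm, Ne.symm]

/-- Only the vertices of the 4-cycle can remain uncovered, and they do so in pairs: the ends of
`q₁₂` if `f₁ ∉ S`, and those of `q₃₄` if `f₃ ∉ S`. -/
lemma IsQuad.degOn_expandQuad (h : IsQuad E a b f₁ f₂ f₃ f₄ q₁₂ q₂₃ q₃₄ q₄₁)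
    (hS : TwoFactor (reduceEdges E f₂ f₄ q₁₂ q₂₃ q₃₄ q₄₁) S (reduceEnd a f₁ f₂ f₃ f₄) b) :
    (∀ e ∈ E, a e ≠ a q₁₂ → a e ≠ a q₃₄ →
      degOn (expandQuad S f₁ f₂ f₃ f₄ q₁₂ q₃₄) a (a e) = 2) ∧
    (∀ e ∈ E, b e ≠ b q₁₂ → b e ≠ b q₃₄ →
      degOn (expandQuad S f₁ f₂ f₃ f₄ q₁₂ q₃₄) b (b e) = 2) ∧
    degOn (expandQuad S f₁ f₂ f₃ f₄ q₁₂ q₃₄) a (a q₁₂) = (if f₁ ∈ S then 2 else 0) ∧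
    degOn (expandQuad S f₁ f₂ f₃ f₄ q₁₂ q₃₄) b (b q₁₂) = (if f₁ ∈ S then 2 else 0) ∧
    degOn (expandQuad S f₁ f₂ f₃ f₄ q₁₂ q₃₄) a (a q₃₄) = (if f₃ ∈ S then 2 else 0) ∧
    degOn (expandQuad S f₁ f₂ f₃ f₄ q₁₂ q₃₄) b (b q₃₄) = (if f₃ ∈ S then 2 else 0) := by
  have h2 := h.nodup
  have hm := h.mem
  have he := h.ends
  simp only [List.nodup_cons, List.mem_cons, List.not_mem_nil, or_false, not_or,
      List.nodup_nil, not_false_eq_true, and_true] at h2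
  have s1 := h.isSeries₁
  have s2 := h.isSeries₂
  rw [h.reduceEnd_eq] at hS
  unfold reduceEdges at hS
  have hu : Function.update a f₁ (a f₂) q₃₄ = a q₃₄ := by
    rw [Function.update_of_ne]; simp [h2, Ne.symm]
  have hsub : expand S f₃ q₃₄ f₄ ⊆ (((E.erase q₂₃).erase q₄₁).erase q₁₂).erase f₂ := by
    intro e h'
    rw [mem_expand] at h'
    rcases h' with h' | ⟨-, rfl | rfl⟩
    · exact Finset.mem_of_mem_erase (Finset.mem_of_mem_erase (hS.1 h'))
    all_goals simp [h2, hm, Ne.symm]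
  have hf1 : f₁ ∈ expand S f₃ q₃₄ f₄ ↔ f₁ ∈ S := by
    rw [mem_expand]; simp [h2]
  unfold expandQuad
  refine ⟨?_, ?_, ?_, ?_, ?_, ?_⟩
  · intro e heE n1 n2
    have heE' : e ∈ (E.erase q₂₃).erase q₄₁ := by
      rw [Finset.mem_erase, Finset.mem_erase]
      refine ⟨?_, ?_, heE⟩
      · rintro rfl; exact n1 (by simp [he])
      · rintro rfl; exact n2 (by simp [he])
    obtain ⟨f, hf, hfe⟩ := s1.exists_left heE' n1
    rw [s1.degOn_left hsub n1, ← hfe]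
    have n2' : Function.update a f₁ (a f₂) f ≠ Function.update a f₁ (a f₂) q₃₄ := by
      rw [hfe, hu]; exact n2
    obtain ⟨g, hg, hgf⟩ := s2.exists_left hf n2'
    rw [s2.degOn_left hS.1 n2', ← hgf, (hS.2 g hg).1]
  · intro e heE n1 n2
    have heE' : e ∈ (E.erase q₂₃).erase q₄₁ := by
      rw [Finset.mem_erase, Finset.mem_erase]
      refine ⟨?_, ?_, heE⟩
      · rintro rfl; exact n2 (by simp [he])
      · rintro rfl; exact n1 (by simp [he])
    have hf := s1.mem_erase_of_right heE' n1
    rw [s1.degOn_right hsub n1]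
    have hg := s2.mem_erase_of_right hf n2
    rw [s2.degOn_right hS.1 n2, (hS.2 e hg).2]
  · rw [s1.degOn_left_self hsub]; simp only [hf1]
  · rw [s1.degOn_right_self hsub]; simp only [hf1]
  · rw [s1.degOn_left hsub (by exact Ne.symm he.2.2.2.2.2.2.2.2.1), ← hu, s2.degOn_left_self hS.1]
  · rw [s1.degOn_right hsub (by exact Ne.symm he.2.2.2.2.2.2.2.2.2.1), s2.degOn_right_self hS.1]

/-- A 2-factor of the reduced graph gives a 2-factor of the graph. -/
lemma IsQuad.exists_twoFactor (h : IsQuad E a b f₁ f₂ f₃ f₄ q₁₂ q₂₃ q₃₄ q₄₁)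
    (hS : TwoFactor (reduceEdges E f₂ f₄ q₁₂ q₂₃ q₃₄ q₄₁) S (reduceEnd a f₁ f₂ f₃ f₄) b) :
    ∃ T, TwoFactor E T a b ∧
      (∀ e ∈ expandQuad S f₁ f₂ f₃ f₄ q₁₂ q₃₄, e ≠ q₁₂ → e ≠ q₃₄ → e ∈ T) ∧
      ∀ e f, e ≠ q₁₂ → e ≠ q₃₄ → f ≠ q₁₂ → f ≠ q₃₄ →
        Linked (expandQuad S f₁ f₂ f₃ f₄ q₁₂ q₃₄) a b e f → Linked T a b e f := by
  obtain ⟨d1, d2, d3, d4, d5, d6⟩ := h.degOn_expandQuad hS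
  have hsub := h.expandQuad_subset hS.1
  have hmemS : ∀ e, e ∈ S → e ≠ q₁₂ ∧ e ≠ q₃₄ := fun e he => by
    have := mem_reduceEdges.1 (hS.1 he); simp [this]
  have m12 : q₁₂ ∈ expandQuad S f₁ f₂ f₃ f₄ q₁₂ q₃₄ ↔ f₁ ∈ S := by
    have h2 := h.nodup
    simp only [List.nodup_cons, List.mem_cons, List.not_mem_nil, or_false, not_or,
      List.nodup_nil, not_false_eq_true, and_true] at h2
    have : q₁₂ ∉ S := fun h' => (hmemS _ h').1 rfl
    rw [h.mem_expandQuad]; simp [h2, this, Ne.symm]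
  have m34 : q₃₄ ∈ expandQuad S f₁ f₂ f₃ f₄ q₁₂ q₃₄ ↔ f₃ ∈ S := by
    have h2 := h.nodup
    simp only [List.nodup_cons, List.mem_cons, List.not_mem_nil, or_false, not_or,
      List.nodup_nil, not_false_eq_true, and_true] at h2
    have : q₃₄ ∉ S := fun h' => (hmemS _ h').2 rfl
    rw [h.mem_expandQuad]; simp [h2, this, Ne.symm]
  have m2 : f₁ ∈ S → f₁ ∈ expandQuad S f₁ f₂ f₃ f₄ q₁₂ q₃₄ ∧
      f₂ ∈ expandQuad S f₁ f₂ f₃ f₄ q₁₂ q₃₄ := fun h' => by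
    rw [h.mem_expandQuad, h.mem_expandQuad]; simp [h']
  have m4 : f₃ ∈ S → f₃ ∈ expandQuad S f₁ f₂ f₃ f₄ q₁₂ q₃₄ ∧
      f₄ ∈ expandQuad S f₁ f₂ f₃ f₄ q₁₂ q₃₄ := fun h' => by
    rw [h.mem_expandQuad, h.mem_expandQuad]; simp [h']
  set S₁ := expandQuad S f₁ f₂ f₃ f₄ q₁₂ q₃₄ with hS₁
  have n23 : q₂₃ ∉ S₁ := fun h' => by simpa using hsub h'
  have n41 : q₄₁ ∉ S₁ := fun h' => by simpa using hsub h'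
  have hsubE : ∀ e ∈ S₁, e ∈ E := fun e he =>
    Finset.mem_of_mem_erase (Finset.mem_of_mem_erase (hsub he))
  obtain ⟨-, c1, c2, c3, c4, c5, c6, c7, c8, c9, -⟩ := h.ends
  obtain ⟨k1, k2, k3, k4, k5, k6, k7, k8⟩ := h.mem
  have h2 := h.nodup
  simp only [List.nodup_cons, List.mem_cons, List.not_mem_nil, or_false, not_or,
      List.nodup_nil, not_false_eq_true, and_true] at h2
  have cases_a : ∀ T : Finset β, (∀ e ∈ E, a e ≠ a q₁₂ → a e ≠ a q₃₄ → degOn T a (a e) = 2) →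
      degOn T a (a q₁₂) = 2 → degOn T a (a q₃₄) = 2 → ∀ e ∈ E, degOn T a (a e) = 2 := by
    intro T t1 t2 t3 e he
    by_cases x1 : a e = a q₁₂
    · rw [x1, t2]
    by_cases x2 : a e = a q₃₄
    · rw [x2, t3]
    exact t1 e he x1 x2
  have cases_b : ∀ T : Finset β, (∀ e ∈ E, b e ≠ b q₁₂ → b e ≠ b q₃₄ → degOn T b (b e) = 2) →
      degOn T b (b q₁₂) = 2 → degOn T b (b q₃₄) = 2 → ∀ e ∈ E, degOn T b (b e) = 2 := by
    intro T t1 t2 t3 e he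
    by_cases x1 : b e = b q₁₂
    · rw [x1, t2]
    by_cases x2 : b e = b q₃₄
    · rw [x2, t3]
    exact t1 e he x1 x2
  -- If both paths are used, nothing is missing. If just one is used, its middle edge is replaced by
  -- the other three edges of the 4-cycle, which pick up the two missing vertices. If none is used,
  -- the 4-cycle becomes a new component.
  by_cases i1 : f₁ ∈ S <;> by_cases i3 : f₃ ∈ S
  · rw [if_pos i1] at d3 d4
    rw [if_pos i3] at d5 d6
    refine ⟨S₁, ⟨hsubE, fun e he => ⟨cases_a _ d1 d3 d5 e he, cases_b _ d2 d4 d6 e he⟩⟩,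
      fun e he _ _ => he, fun e f _ _ _ _ h => h⟩
  · rw [if_pos i1] at d3 d4
    rw [if_neg i3] at d5 d6
    have u1 : q₁₂ ∈ S₁ := m12.2 i1
    have u2 : q₃₄ ∉ S₁ := fun h' => i3 (m34.1 h')
    set T := insert q₂₃ (insert q₃₄ (insert q₄₁ (S₁.erase q₁₂))) with hT
    have hST : ∀ e ∈ S₁, e ≠ q₁₂ → e ∈ T := fun e he hne => by simp [hT, he, hne]
    -- The removed edge is counted on the left, which avoids truncated subtraction.
    have da : ∀ x, degOn T a x + (if a q₁₂ = x then 1 else 0) = (if a q₂₃ = x then 1 else 0) +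
        ((if a q₃₄ = x then 1 else 0) + (if a q₄₁ = x then 1 else 0)) + degOn S₁ a x := by
      intro x
      rw [degOn_erase u1, hT, degOn_insert (by simp [h2, n23, Ne.symm]),
        degOn_insert (by simp [h2, u2]), degOn_insert (by simp [n41])]
      omega
    have db : ∀ x, degOn T b x + (if b q₁₂ = x then 1 else 0) = (if b q₂₃ = x then 1 else 0) +
        ((if b q₃₄ = x then 1 else 0) + (if b q₄₁ = x then 1 else 0)) + degOn S₁ b x := by
      intro x
      rw [degOn_erase u1, hT, degOn_insert (by simp [h2, n23, Ne.symm]),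
        degOn_insert (by simp [h2, u2]), degOn_insert (by simp [n41])]
      omega
    refine ⟨T, ⟨?_, fun e he => ⟨cases_a T ?_ ?_ ?_ e he, cases_b T ?_ ?_ ?_ e he⟩⟩,
      fun e he h1 _ => hST e he h1, ?_⟩
    · intro e he
      simp only [hT, Finset.mem_insert, Finset.mem_erase] at he
      rcases he with rfl | rfl | rfl | he <;> first | assumption | exact hsubE _ he.2
    · intro e he n1 n2
      have := da (a e)
      rw [d1 e he n1 n2, c5, c1, if_neg n1.symm, if_neg n2.symm] at this
      omega
    · have := da (a q₁₂)
      rw [d3, c5, c1, if_pos rfl, if_neg c8.symm] at this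
      omega
    · have := da (a q₃₄)
      rw [d5, c5, c1, if_pos rfl, if_neg c8] at this
      omega
    · intro e he n1 n2
      have := db (b e)
      rw [d2 e he n1 n2, c3, c7, if_neg n1.symm, if_neg n2.symm] at this
      omega
    · have := db (b q₁₂)
      rw [d4, c3, c7, if_pos rfl, if_neg c9.symm] at this
      omega
    · have := db (b q₃₄)
      rw [d6, c3, c7, if_pos rfl, if_neg c9] at this
      omega
    · intro e f e1 _ f1 _ hl
      have f1T : f₁ ∈ T := hST _ (m2 i1).1 h2.1.2.2.2.1
      have f2T : f₂ ∈ T := hST _ (m2 i1).2 h2.2.1.2.2.1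
      have l12 : Linked T a b f₁ f₂ := by
        refine (linked_of_left (f := q₄₁) f1T (by simp [hT]) ?_).trans
          ((linked_of_right (f := q₃₄) (by simp [hT]) (by simp [hT]) c7).trans
          ((linked_of_left (f := q₂₃) (by simp [hT]) (by simp [hT]) c5.symm).trans
          (linked_of_right (by simp [hT]) f2T ?_)))
        · rw [c1, (h.left₁ _ k1).2 (by simp)]
        · rw [c3, c2]
      have key : ∀ g, Share S₁ a b q₁₂ g → g ≠ q₁₂ → Linked T a b f₁ g := by
        rintro g ⟨-, hg, hs | hs⟩ hgn
        · rcases (h.left₁ g (hsubE g hg)).1 hs.symm with rfl | rfl | rfl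
          · exact Linked.refl _
          · exact (hgn rfl).elim
          · exact (n41 hg).elim
        · rcases (h.right₂ g (hsubE g hg)).1 hs.symm with rfl | rfl | rfl
          · exact l12
          · exact (hgn rfl).elim
          · exact (n23 hg).elim
      -- Walks through the removed edge `q₁₂` are diverted to `f₁`, which is linked to `f₂` the long
      -- way round the 4-cycle.
      have := hl.map (φ := fun g => if g = q₁₂ then f₁ else g) (T := T) (a' := a) (b' := b) ?_
      · simpa only [if_neg e1, if_neg f1] using this
      · intro g k hs
        by_cases g1 : g = q₁₂
        · subst g1
          by_cases g2 : k = g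
          · subst g2; exact Linked.refl _
          · rw [if_pos rfl, if_neg g2]; exact key k hs g2
        · by_cases g2 : k = q₁₂
          · subst g2; rw [if_pos rfl, if_neg g1]; exact (key g hs.symm g1).symm
          · rw [if_neg g1, if_neg g2]
            exact Relation.ReflTransGen.single ⟨hST _ hs.1 g1, hST _ hs.2.1 g2, hs.2.2⟩
  · rw [if_neg i1] at d3 d4
    rw [if_pos i3] at d5 d6
    have u1 : q₃₄ ∈ S₁ := m34.2 i3
    have u2 : q₁₂ ∉ S₁ := fun h' => i1 (m12.1 h')
    set T := insert q₂₃ (insert q₁₂ (insert q₄₁ (S₁.erase q₃₄))) with hT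
    have hST : ∀ e ∈ S₁, e ≠ q₃₄ → e ∈ T := fun e he hne => by simp [hT, he, hne]
    have da : ∀ x, degOn T a x + (if a q₃₄ = x then 1 else 0) = (if a q₂₃ = x then 1 else 0) +
        ((if a q₁₂ = x then 1 else 0) + (if a q₄₁ = x then 1 else 0)) + degOn S₁ a x := by
      intro x
      rw [degOn_erase u1, hT, degOn_insert (by simp [h2, n23, Ne.symm]),
        degOn_insert (by simp [h2, u2]), degOn_insert (by simp [n41])]
      omega
    have db : ∀ x, degOn T b x + (if b q₃₄ = x then 1 else 0) = (if b q₂₃ = x then 1 else 0) +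
        ((if b q₁₂ = x then 1 else 0) + (if b q₄₁ = x then 1 else 0)) + degOn S₁ b x := by
      intro x
      rw [degOn_erase u1, hT, degOn_insert (by simp [h2, n23, Ne.symm]),
        degOn_insert (by simp [h2, u2]), degOn_insert (by simp [n41])]
      omega
    refine ⟨T, ⟨?_, fun e he => ⟨cases_a T ?_ ?_ ?_ e he, cases_b T ?_ ?_ ?_ e he⟩⟩,
      fun e he _ h1 => hST e he h1, ?_⟩
    · intro e he
      simp only [hT, Finset.mem_insert, Finset.mem_erase] at he
      rcases he with rfl | rfl | rfl | he <;> first | assumption | exact hsubE _ he.2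
    · intro e he n1 n2
      have := da (a e)
      rw [d1 e he n1 n2, c5, c1, if_neg n1.symm, if_neg n2.symm] at this
      omega
    · have := da (a q₁₂)
      rw [d3, c5, c1, if_pos rfl, if_neg c8.symm] at this
      omega
    · have := da (a q₃₄)
      rw [d5, c5, c1, if_pos rfl, if_neg c8] at this
      omega
    · intro e he n1 n2
      have := db (b e)
      rw [d2 e he n1 n2, c3, c7, if_neg n1.symm, if_neg n2.symm] at this
      omega
    · have := db (b q₁₂)
      rw [d4, c3, c7, if_pos rfl, if_neg c9.symm] at this
      omega
    · have := db (b q₃₄)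
      rw [d6, c3, c7, if_pos rfl, if_neg c9] at this
      omega
    · intro e f _ e1 _ f1 hl
      have f3T : f₃ ∈ T := hST _ (m4 i3).1 h2.2.2.1.2.2.2.1
      have f4T : f₄ ∈ T := hST _ (m4 i3).2 h2.2.2.2.1.2.2.1
      have l34 : Linked T a b f₃ f₄ := by
        refine (linked_of_left (f := q₂₃) f3T (by simp [hT]) ?_).trans
          ((linked_of_right (f := q₁₂) (by simp [hT]) (by simp [hT]) c3).trans
          ((linked_of_left (f := q₄₁) (by simp [hT]) (by simp [hT]) c1.symm).trans
          (linked_of_right (by simp [hT]) f4T ?_)))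
        · rw [c5, c4]
        · rw [c7, c6]
      have key : ∀ g, Share S₁ a b q₃₄ g → g ≠ q₃₄ → Linked T a b f₃ g := by
        rintro g ⟨-, hg, hs | hs⟩ hgn
        · rcases (h.left₃ g (hsubE g hg)).1 hs.symm with rfl | rfl | rfl
          · exact Linked.refl _
          · exact (hgn rfl).elim
          · exact (n23 hg).elim
        · rcases (h.right₄ g (hsubE g hg)).1 hs.symm with rfl | rfl | rfl
          · exact l34
          · exact (hgn rfl).elim
          · exact (n41 hg).elim
      have := hl.map (φ := fun g => if g = q₃₄ then f₃ else g) (T := T) (a' := a) (b' := b) ?_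
      · simpa only [if_neg e1, if_neg f1] using this
      · intro g k hs
        by_cases g1 : g = q₃₄
        · subst g1
          by_cases g2 : k = g
          · subst g2; exact Linked.refl _
          · rw [if_pos rfl, if_neg g2]; exact key k hs g2
        · by_cases g2 : k = q₃₄
          · subst g2; rw [if_pos rfl, if_neg g1]; exact (key g hs.symm g1).symm
          · rw [if_neg g1, if_neg g2]
            exact Relation.ReflTransGen.single ⟨hST _ hs.1 g1, hST _ hs.2.1 g2, hs.2.2⟩
  · rw [if_neg i1] at d3 d4
    rw [if_neg i3] at d5 d6
    have u1 : q₃₄ ∉ S₁ := fun h' => i3 (m34.1 h')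
    have u2 : q₁₂ ∉ S₁ := fun h' => i1 (m12.1 h')
    set T := insert q₂₃ (insert q₁₂ (insert q₄₁ (insert q₃₄ S₁))) with hT
    have hST : ∀ e ∈ S₁, e ∈ T := fun e he => by simp [hT, he]
    have da : ∀ x, degOn T a x = (if a q₂₃ = x then 1 else 0) +
        ((if a q₁₂ = x then 1 else 0) + ((if a q₄₁ = x then 1 else 0) +
        (if a q₃₄ = x then 1 else 0))) + degOn S₁ a x := by
      intro x
      rw [hT, degOn_insert (by simp [h2, n23, Ne.symm]),
        degOn_insert (by simp [h2, u2]), degOn_insert (by simp [n41, h2, Ne.symm]),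
        degOn_insert u1]
      omega
    have db : ∀ x, degOn T b x = (if b q₂₃ = x then 1 else 0) +
        ((if b q₁₂ = x then 1 else 0) + ((if b q₄₁ = x then 1 else 0) +
        (if b q₃₄ = x then 1 else 0))) + degOn S₁ b x := by
      intro x
      rw [hT, degOn_insert (by simp [h2, n23, Ne.symm]),
        degOn_insert (by simp [h2, u2]), degOn_insert (by simp [n41, h2, Ne.symm]),
        degOn_insert u1]
      omega
    refine ⟨T, ⟨?_, fun e he => ⟨cases_a T ?_ ?_ ?_ e he, cases_b T ?_ ?_ ?_ e he⟩⟩,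
      fun e he _ _ => hST e he, ?_⟩
    · intro e he
      simp only [hT, Finset.mem_insert] at he
      rcases he with rfl | rfl | rfl | rfl | he <;> first | assumption | exact hsubE _ he
    · intro e he n1 n2
      have := da (a e)
      rw [d1 e he n1 n2, c5, c1, if_neg n1.symm, if_neg n2.symm] at this
      omega
    · have := da (a q₁₂)
      rw [d3, c5, c1, if_pos rfl, if_neg c8.symm] at this
      omega
    · have := da (a q₃₄)
      rw [d5, c5, c1, if_pos rfl, if_neg c8] at this
      omega
    · intro e he n1 n2
      have := db (b e)
      rw [d2 e he n1 n2, c3, c7, if_neg n1.symm, if_neg n2.symm] at this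
      omega
    · have := db (b q₁₂)
      rw [d4, c3, c7, if_pos rfl, if_neg c9.symm] at this
      omega
    · have := db (b q₃₄)
      rw [d6, c3, c7, if_pos rfl, if_neg c9] at this
      omega
    · intro e f _ _ _ _ hl
      exact hl.map (φ := id) fun g k hs =>
        Relation.ReflTransGen.single ⟨hST _ hs.1, hST _ hs.2.1, hs.2.2⟩

/-- The lift may give up `q₁₂` or `q₃₄`, which is why the two edges must lie off the 4-cycle. In the
reduced graph `f₂` and `f₄` are represented by `f₁` and `f₃`. -/
lemma IsQuad.exists_linked (h : IsQuad E a b f₁ f₂ f₃ f₄ q₁₂ q₂₃ q₃₄ q₄₁)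
    (ih : PairsOnCycle (reduceEdges E f₂ f₄ q₁₂ q₂₃ q₃₄ q₄₁) (reduceEnd a f₁ f₂ f₃ f₄) b)
    {e₁ e₂ : β} (he₁ : e₁ ∈ E) (he₂ : e₂ ∈ E) (hn₁ : e₁ ∉ ({q₁₂, q₂₃, q₃₄, q₄₁} : Finset β))
    (hn₂ : e₂ ∉ ({q₁₂, q₂₃, q₃₄, q₄₁} : Finset β)) :
    ∃ S, TwoFactor E S a b ∧ e₁ ∈ S ∧ e₂ ∈ S ∧ Linked S a b e₁ e₂ := by
  have h2 := h.nodup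
  simp only [List.nodup_cons, List.mem_cons, List.not_mem_nil, or_false, not_or,
      List.nodup_nil, not_false_eq_true, and_true] at h2
  have hm := h.mem
  simp only [Finset.mem_insert, Finset.mem_singleton, not_or] at hn₁ hn₂
  have s1 := h.isSeries₁
  have s2 := h.isSeries₂
  have lift : ∀ (S : Finset β) e f, Linked S (reduceEnd a f₁ f₂ f₃ f₄) b e f →
      Linked (expandQuad S f₁ f₂ f₃ f₄ q₁₂ q₃₄) a b e f := by
    intro S e f hl
    rw [h.reduceEnd_eq] at hl
    exact s1.linked_expand (s2.linked_expand hl)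
  have retr : ∀ e ∈ E, (¬ e = q₁₂ ∧ ¬ e = q₂₃ ∧ ¬ e = q₃₄ ∧ ¬ e = q₄₁) →
      ∃ f ∈ reduceEdges E f₂ f₄ q₁₂ q₂₃ q₃₄ q₄₁, ∀ S : Finset β, f ∈ S →
        e ∈ expandQuad S f₁ f₂ f₃ f₄ q₁₂ q₃₄ ∧
        Linked (expandQuad S f₁ f₂ f₃ f₄ q₁₂ q₃₄) a b e f := by
    intro e he hn
    by_cases c2 : e = f₂
    · subst c2
      refine ⟨f₁, by rw [mem_reduceEdges]; simp [h2, hm], fun S hS => ⟨?_, ?_⟩⟩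
      · rw [h.mem_expandQuad]; simp [hS]
      · exact (s1.linked_pr (by rw [mem_expand]; exact Or.inl hS)).symm
    by_cases c4 : e = f₄
    · subst c4
      refine ⟨f₃, by rw [mem_reduceEdges]; simp [h2, hm, Ne.symm], fun S hS => ⟨?_, ?_⟩⟩
      · rw [h.mem_expandQuad]; simp [hS]
      · exact (s1.linked_expand (s2.linked_pr hS)).symm
    · refine ⟨e, by rw [mem_reduceEdges]; simp [c2, c4, hn, he], fun S hS => ⟨?_, Linked.refl _⟩⟩
      rw [h.mem_expandQuad]; exact Or.inl hS
  obtain ⟨g₁, hg₁, r₁⟩ := retr e₁ he₁ hn₁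
  obtain ⟨g₂, hg₂, r₂⟩ := retr e₂ he₂ hn₂
  obtain ⟨S, hS, i1, i2, hl⟩ := ih g₁ hg₁ g₂ hg₂
  obtain ⟨T, hT, t1, t2⟩ := h.exists_twoFactor hS
  exact ⟨T, hT, t1 _ (r₁ S i1).1 hn₁.1 hn₁.2.2.1, t1 _ (r₂ S i2).1 hn₂.1 hn₂.2.2.1,
    t2 _ _ hn₁.1 hn₁.2.2.1 hn₂.1 hn₂.2.2.1
      (((r₁ S i1).2.trans (lift _ _ _ hl)).trans (r₂ S i2).2.symm)⟩

end Quad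

/-! ### Short even sets of edges -/

lemma exists_other {D : Finset β} {a : β → α} (hD : ∀ x, Even (degOn D a x)) {e : β}
    (he : e ∈ D) : ∃ f ∈ D, f ≠ e ∧ a f = a e := by
  have h := hD (a e)
  rw [degOn_erase he, if_pos rfl] at h
  have : 0 < degOn (D.erase e) a (a e) := by
    rcases Nat.eq_zero_or_pos (degOn (D.erase e) a (a e)) with h0 | h0
    · rw [h0] at h; exact absurd h (by decide)
    · exact h0
  obtain ⟨f, hf⟩ := Finset.card_pos.1 this
  rw [Finset.mem_filter, Finset.mem_erase] at hf
  exact ⟨f, hf.1.2, hf.1.1, hf.2⟩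

/-- No two edges of `E` are parallel. -/
def Simple (E : Finset β) (a b : β → α) : Prop :=
  ∀ e ∈ E, ∀ f ∈ E, a e = a f → b e = b f → e = f

/-- Even degrees allow any edge `d1` to be continued to a walk `d0`, `d1`, `d2`, `d3`; simplicity
makes these edges distinct. -/
lemma Simple.four_le_card {D : Finset β} {a b : β → α} (hs : Simple D a b)
    (ha : ∀ x, Even (degOn D a x)) (hb : ∀ x, Even (degOn D b x)) (hne : D.Nonempty) :
    4 ≤ D.card := by
  obtain ⟨d1, m1⟩ := hne
  obtain ⟨d2, m2, n2, h2⟩ := exists_other hb m1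
  obtain ⟨d3, m3, n3, h3⟩ := exists_other ha m2
  obtain ⟨d0, m0, n0, h0⟩ := exists_other ha m1
  have a12 : a d1 ≠ a d2 := fun h => n2 (hs _ m2 _ m1 h.symm h2)
  have hsub : ({d0, d1, d2, d3} : Finset β) ⊆ D := by
    intro x hx
    simp only [Finset.mem_insert, Finset.mem_singleton] at hx
    rcases hx with rfl | rfl | rfl | rfl <;> assumption
  have hcard : ({d0, d1, d2, d3} : Finset β).card = 4 := by
    rw [Finset.card_insert_of_notMem, Finset.card_insert_of_notMem, Finset.card_pair]
    all_goals try simp only [Finset.mem_insert, Finset.mem_singleton, not_or]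
    all_goals grind
  rw [← hcard]
  exact Finset.card_le_card hsub

/-- If the walk `d0`, `d1`, `d2`, `d3` does not close up, it can be continued at both ends, and `D`
has six edges. -/
lemma Simple.exists_four_cycle {D : Finset β} {a b : β → α} (hs : Simple D a b)
    (ha : ∀ x, Even (degOn D a x)) (hb : ∀ x, Even (degOn D b x)) (hne : D.Nonempty)
    (hcard : D.card < 6) :
    ∃ d1 ∈ D, ∃ d2 ∈ D, ∃ d3 ∈ D, ∃ d0 ∈ D, b d2 = b d1 ∧ a d3 = a d2 ∧ a d0 = a d1 ∧
      b d0 = b d3 ∧ a d1 ≠ a d2 ∧ b d1 ≠ b d3 := by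
  obtain ⟨d1, m1⟩ := hne
  obtain ⟨d2, m2, n2, h2⟩ := exists_other hb m1
  obtain ⟨d3, m3, n3, h3⟩ := exists_other ha m2
  obtain ⟨d0, m0, n0, h0⟩ := exists_other ha m1
  have a12 : a d1 ≠ a d2 := fun h => n2 (hs _ m2 _ m1 h.symm h2)
  have b13 : b d1 ≠ b d3 := fun h => n3 (hs _ m3 _ m2 h3 (by rw [h2, h]))
  by_cases h03 : b d0 = b d3
  · exact ⟨d1, m1, d2, m2, d3, m3, d0, m0, h2, h3, h0, h03, a12, b13⟩
  exfalso
  have b01 : b d0 ≠ b d1 := fun h => n0 (hs _ m0 _ m1 h0 h)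
  obtain ⟨d4, m4, n4, h4⟩ := exists_other hb m3
  obtain ⟨d5, m5, n5, h5⟩ := exists_other hb m0
  have hsub : ({d0, d1, d2, d3, d4, d5} : Finset β) ⊆ D := by
    intro x hx
    simp only [Finset.mem_insert, Finset.mem_singleton] at hx
    rcases hx with rfl | rfl | rfl | rfl | rfl | rfl <;> assumption
  have : ({d0, d1, d2, d3, d4, d5} : Finset β).card = 6 := by
    rw [Finset.card_insert_of_notMem, Finset.card_insert_of_notMem, Finset.card_insert_of_notMem,
      Finset.card_insert_of_notMem, Finset.card_pair]
    all_goals try simp only [Finset.mem_insert, Finset.mem_singleton, not_or]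
    all_goals grind
  have := Finset.card_le_card hsub
  omega

/-- Simplicity keeps the third edges apart: one shared by neighbouring vertices of the 4-cycle would
be parallel to a side. -/
lemma Cubic.exists_isQuad {E : Finset β} {a b : β → α} (hc : Cubic E a b) (hs : Simple E a b)
    {q₁₂ q₂₃ q₃₄ q₄₁ : β} (m1 : q₁₂ ∈ E) (m2 : q₂₃ ∈ E) (m3 : q₃₄ ∈ E) (m4 : q₄₁ ∈ E)
    (h2 : b q₂₃ = b q₁₂) (h3 : a q₃₄ = a q₂₃) (h1 : a q₄₁ = a q₁₂) (h4 : b q₄₁ = b q₃₄)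
    (h13 : a q₁₂ ≠ a q₂₃) (h24 : b q₁₂ ≠ b q₃₄) :
    ∃ f₁ f₂ f₃ f₄, IsQuad E a b f₁ f₂ f₃ f₄ q₁₂ q₂₃ q₃₄ q₄₁ := by
  obtain ⟨f₁, k1, i1, j1, l1, t1⟩ := exists_third (hc q₁₂ m1).1 m1 m4 rfl h1 (by grind)
  obtain ⟨f₂, k2, i2, j2, l2, t2⟩ := exists_third (hc q₁₂ m1).2 m1 m2 rfl h2 (by grind)
  obtain ⟨f₃, k3, i3, j3, l3, t3⟩ := exists_third (hc q₃₄ m3).1 m3 m2 rfl h3.symm (by grind)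
  obtain ⟨f₄, k4, i4, j4, l4, t4⟩ := exists_third (hc q₃₄ m3).2 m3 m4 rfl h4 (by grind)
  have n12 : f₁ ≠ f₂ := fun h => j1 (hs _ k1 _ m1 i1 (h ▸ i2))
  have n14 : f₁ ≠ f₄ := fun h => l1 (hs _ k1 _ m4 (i1.trans h1.symm) (h ▸ i4.trans h4.symm))
  have n32 : f₃ ≠ f₂ := fun h => l3 (hs _ k3 _ m2 (i3.trans h3) (h ▸ i2.trans h2.symm))
  have n34 : f₃ ≠ f₄ := fun h => j3 (hs _ k3 _ m3 i3 (h ▸ i4))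
  refine ⟨f₁, f₂, f₃, f₄, ⟨k1, k2, k3, k4, m1, m2, m3, m4⟩, ?_, ?_, ?_, ?_, ?_⟩
  · simp only [List.nodup_cons, List.mem_cons, List.not_mem_nil, or_false, not_or,
      List.nodup_nil, not_false_eq_true, and_true]
    and_intros <;> grind
  · intro f hf; constructor
    · intro h; have := t1 f hf h; tauto
    · rintro (rfl | rfl | rfl) <;> first | assumption | rfl
  · intro f hf; constructor
    · intro h; have := t2 f hf h; tauto
    · rintro (rfl | rfl | rfl) <;> first | assumption | rfl
  · intro f hf; constructor
    · intro h; have := t3 f hf h; tauto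
    · rintro (rfl | rfl | rfl) <;> first | assumption | rfl | exact h3.symm
  · intro f hf; constructor
    · intro h; have := t4 f hf h; tauto
    · rintro (rfl | rfl | rfl) <;> first | assumption | rfl

/-! ### Euler's inequality -/

/-- The edges that join the vertex `i` of the dual graph to another vertex. -/
def star {I : Type*} [DecidableEq I] (E : Finset β) (L R : β → I) (i : I) : Finset β :=
  {e ∈ E | L e ≠ R e ∧ (L e = i ∨ R e = i)}

lemma even_degOn_of_isCyc {E D : Finset β} {a b : β → α} (hD : D ⊆ E)
    (h : IsCyc E a b (fun e => if e ∈ D then 1 else 0)) :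
    (∀ x, Even (degOn D a x)) ∧ ∀ x, Even (degOn D b x) := by
  have key : ∀ (g : β → α) x, ∑ f ∈ E with g f = x, (if f ∈ D then 1 else 0 : ZMod 2) =
      (degOn D g x : ZMod 2) := by
    intro g x
    rw [Finset.sum_boole, degOn, Finset.filter_filter]
    congr 2
    ext f
    simp only [Finset.mem_filter]
    exact ⟨fun h => ⟨h.2.2, h.2.1⟩, fun h => ⟨hD h.1, h.2, h.1⟩⟩
  refine ⟨fun x => ?_, fun x => ?_⟩
  · rw [← ZMod.natCast_eq_zero_iff_even, ← key]; exact h.1 x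
  · rw [← ZMod.natCast_eq_zero_iff_even, ← key]; exact h.2 x

/-- The mod 2 cycle space as a subspace. -/
def cycleSpace (E : Finset β) (a b : β → α) : Submodule (ZMod 2) (E → ZMod 2) where
  carrier := {z | (∀ x, ∑ f : E, (if a f = x then z f else 0) = 0) ∧
    (∀ x, ∑ f : E, (if b f = x then z f else 0) = 0)}
  add_mem' := by
    rintro z w ⟨h1, h2⟩ ⟨h3, h4⟩
    refine ⟨fun x => ?_, fun x => ?_⟩
    · have := congrArg₂ (· + ·) (h1 x) (h3 x)
      simp only [← Finset.sum_add_distrib, add_zero] at this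
      refine Eq.trans ?_ this
      refine Finset.sum_congr rfl fun f _ => ?_
      split_ifs <;> simp
    · have := congrArg₂ (· + ·) (h2 x) (h4 x)
      simp only [← Finset.sum_add_distrib, add_zero] at this
      refine Eq.trans ?_ this
      refine Finset.sum_congr rfl fun f _ => ?_
      split_ifs <;> simp
  zero_mem' := by simp
  smul_mem' := by
    rintro c z ⟨h1, h2⟩
    refine ⟨fun x => ?_, fun x => ?_⟩
    · have := congrArg (c * ·) (h1 x)
      simpa [Finset.mul_sum] using this
    · have := congrArg (c * ·) (h2 x)
      simpa [Finset.mul_sum] using this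

/-- The boundary map of the graph. -/
def boundary (E : Finset β) (a b : β → α) :
    (E → ZMod 2) →ₗ[ZMod 2] (E.image a → ZMod 2) × (E.image b → ZMod 2) where
  toFun z := (fun x => ∑ f : E, (if a f = x then z f else 0), fun x => ∑ f : E, (if b f = x then z f else 0))
  map_add' z w := by
    ext x <;> simp only [Pi.add_apply, Prod.fst_add, Prod.snd_add, ← Finset.sum_add_distrib] <;>
    refine Finset.sum_congr rfl fun f _ => ?_ <;> split_ifs <;> simp
  map_smul' c z := by
    ext x <;> simp [Finset.mul_sum]

lemma ker_boundary_le (E : Finset β) (a b : β → α) :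
    LinearMap.ker (boundary E a b) ≤ cycleSpace E a b := by
  intro z hz
  rw [LinearMap.mem_ker, boundary, LinearMap.coe_mk, AddHom.coe_mk, Prod.mk_eq_zero] at hz
  refine ⟨fun x => ?_, fun x => ?_⟩
  · by_cases hx : x ∈ E.image a
    · exact congrFun hz.1 ⟨x, hx⟩
    · refine Finset.sum_eq_zero fun f _ => if_neg ?_
      rintro rfl
      exact hx (Finset.mem_image_of_mem _ f.2)
  · by_cases hx : x ∈ E.image b
    · exact congrFun hz.2 ⟨x, hx⟩
    · refine Finset.sum_eq_zero fun f _ => if_neg ?_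
      rintro rfl
      exact hx (Finset.mem_image_of_mem _ f.2)

/-- Rank and nullity of `boundary`. The extra 1 arises because the totals of a boundary over the two
classes agree, so that `boundary` is not surjective. -/
lemma card_add_one_le_finrank_cycleSpace {E : Finset β} (a b : β → α) (hE : E.Nonempty) :
    E.card + 1 ≤ Module.finrank (ZMod 2) (cycleSpace E a b) + (E.image a).card +
      (E.image b).card := by
  have h1 := LinearMap.finrank_range_add_finrank_ker (boundary E a b)
  have h2 := Submodule.finrank_mono (ker_boundary_le E a b)
  have hlt : LinearMap.range (boundary E a b) < ⊤ := by
    rw [lt_top_iff_ne_top]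
    intro htop
    obtain ⟨e, he⟩ := hE
    have hmem : ((Pi.single ⟨a e, Finset.mem_image_of_mem _ he⟩ 1, 0) :
        (E.image a → ZMod 2) × (E.image b → ZMod 2)) ∈ LinearMap.range (boundary E a b) := by
      rw [htop]; trivial
    obtain ⟨z, hz⟩ := hmem
    have key : ∀ g : β → α, ∑ x : E.image g, ∑ f : E, (if g f = x then z f else 0) =
        ∑ f, z f := by
      intro g
      rw [Finset.sum_comm]
      refine Finset.sum_congr rfl fun f _ => ?_
      rw [Finset.sum_eq_single ⟨g f, Finset.mem_image_of_mem _ f.2⟩]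
      · simp
      · intro x _ hx
        rw [if_neg]
        rintro h
        exact hx (Subtype.ext h.symm)
      · intro h; exact absurd (Finset.mem_univ _) h
    have e1 := key a
    have e2 := key b
    rw [Prod.ext_iff] at hz
    have hz1 : ∀ x : E.image a, ∑ f : E, (if a f = x then z f else 0) = _ := fun x => congrFun hz.1 x
    have hz2 : ∀ x : E.image b, ∑ f : E, (if b f = x then z f else 0) = _ := fun x => congrFun hz.2 x
    rw [Finset.sum_congr rfl fun x _ => hz1 x] at e1
    rw [Finset.sum_congr rfl fun x _ => hz2 x, ← e1] at e2
    simp at e2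
  have h3 := Submodule.finrank_lt hlt.ne
  simp only [Module.finrank_prod, Module.finrank_pi, Fintype.card_coe] at h1 h3
  omega

/-- Cycles are coboundaries of functions on `J`, and the constant functions have coboundary zero.
The positive rank makes `J` nonempty, so that the constant 1 is not zero. -/
lemma finrank_cycleSpace_add_one_le {I : Type} [DecidableEq I] {E : Finset β} {a b : β → α}
    {L R : β → I}
    (h : ∀ z : β → ZMod 2, IsCyc E a b z → ∃ c : I → ZMod 2, ∀ e ∈ E, z e = c (L e) + c (R e))
    (hpos : 0 < Module.finrank (ZMod 2) (cycleSpace E a b)) {J : Finset I}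
    (hJ : ∀ i, i ∈ J ↔ (star E L R i).Nonempty) :
    Module.finrank (ZMod 2) (cycleSpace E a b) + 1 ≤ J.card := by
  let T : (J → ZMod 2) →ₗ[ZMod 2] (E → ZMod 2) :=
    -- The default 0 is harmless: an edge of `E` with an end outside `J` is a loop of the dual,
    -- whose two terms cancel.
    { toFun := fun c e => (if h : L e ∈ J then c ⟨L e, h⟩ else 0) +
        (if h : R e ∈ J then c ⟨R e, h⟩ else 0)
      map_add' := by
        intro c d; ext e; simp only [Pi.add_apply]; split_ifs <;> ring
      map_smul' := by
        intro c d; ext e; simp only [Pi.smul_apply, smul_eq_mul, RingHom.id_apply]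
        split_ifs <;> ring }
  have hLR : ∀ e ∈ E, L e ≠ R e → L e ∈ J ∧ R e ∈ J := fun e he hne =>
    ⟨(hJ _).2 ⟨e, by simp [star, he, hne]⟩, (hJ _).2 ⟨e, by simp [star, he, hne]⟩⟩
  have hle : cycleSpace E a b ≤ LinearMap.range T := by
    intro z hz
    set w : β → ZMod 2 := fun e => if h : e ∈ E then z ⟨e, h⟩ else 0 with hw
    have hwz : ∀ g : β → α, ∀ x, ∑ f ∈ E with g f = x, w f =
        ∑ f : E, (if g f = x then z f else 0) := by
      intro g x
      rw [Finset.sum_filter, ← Finset.sum_coe_sort E]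
      refine Finset.sum_congr rfl fun f _ => ?_
      simp [hw]
    obtain ⟨c, hc⟩ := h w ⟨fun x => by rw [hwz]; exact hz.1 x, fun x => by rw [hwz]; exact hz.2 x⟩
    refine ⟨fun i => c i, ?_⟩
    ext ⟨e, he⟩
    have := hc e he
    simp only [hw, dif_pos he] at this
    rw [this]
    simp only [T, LinearMap.coe_mk, AddHom.coe_mk]
    by_cases hne : L e = R e
    · rw [hne, CharTwo.add_self_eq_zero, CharTwo.add_self_eq_zero]
    · rw [dif_pos (hLR e he hne).1, dif_pos (hLR e he hne).2]
  have h1 := LinearMap.finrank_range_add_finrank_ker T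
  have h2 := Submodule.finrank_mono hle
  rw [Module.finrank_pi, Fintype.card_coe] at h1
  have hJne : J.Nonempty := by
    rw [← Finset.card_pos]; omega
  have h3 : 0 < Module.finrank (ZMod 2) (LinearMap.ker T) := by
    rw [Module.finrank_pos_iff_exists_ne_zero]
    refine ⟨⟨fun _ => 1, ?_⟩, ?_⟩
    · rw [LinearMap.mem_ker]
      ext ⟨e, he⟩
      simp only [T, LinearMap.coe_mk, AddHom.coe_mk]
      by_cases hne : L e = R e
      · rw [hne, CharTwo.add_self_eq_zero]; rfl
      · rw [dif_pos (hLR e he hne).1, dif_pos (hLR e he hne).2]; rfl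
    · obtain ⟨i, hi⟩ := hJne
      intro h0
      have := congrFun (congrArg Subtype.val h0) ⟨i, hi⟩
      exact one_ne_zero this
  omega

lemma sum_card_star_le {I : Type} [DecidableEq I] (E : Finset β) (L R : β → I) (J : Finset I) :
    ∑ i ∈ J, (star E L R i).card ≤ 2 * E.card := by
  have h1 : ∀ i ∈ J, (star E L R i).card ≤
      ∑ e ∈ E, ((if L e = i then 1 else 0) + (if R e = i then 1 else 0)) := by
    intro i _
    rw [star, Finset.card_filter]
    refine Finset.sum_le_sum fun e _ => ?_
    split_ifs <;> simp_all
  refine (Finset.sum_le_sum h1).trans ?_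
  rw [Finset.sum_comm, mul_comm, ← smul_eq_mul, ← Finset.sum_const]
  refine Finset.sum_le_sum fun e _ => ?_
  rw [Finset.sum_add_distrib, Finset.sum_ite_eq, Finset.sum_ite_eq]
  split_ifs <;> simp

/-- A simple cubic bipartite graph with an abstract dual has a 4-cycle that avoids two given
edges. -/
lemma Cubic.exists_isQuad_notMem {E : Finset β} {a b : β → α} (hc : Cubic E a b)
    (hs : Simple E a b) (hd : HasDual E a b) {e₁ e₂ : β} (he₁ : e₁ ∈ E) :
    ∃ f₁ f₂ f₃ f₄ q₁₂ q₂₃ q₃₄ q₄₁, IsQuad E a b f₁ f₂ f₃ f₄ q₁₂ q₂₃ q₃₄ q₄₁ ∧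
      e₁ ∉ ({q₁₂, q₂₃, q₃₄, q₄₁} : Finset β) ∧ e₂ ∉ ({q₁₂, q₂₃, q₃₄, q₄₁} : Finset β) := by
  classical
  obtain ⟨I, L, R, h⟩ := hd
  set J : Finset I := ((E.image L) ∪ (E.image R)).filter (fun i => (star E L R i).Nonempty)
    with hJdef
  have hJ : ∀ i, i ∈ J ↔ (star E L R i).Nonempty := by
    intro i
    rw [hJdef, Finset.mem_filter]
    refine ⟨fun h => h.2, fun h => ⟨?_, h⟩⟩
    obtain ⟨e, he⟩ := h
    rw [star, Finset.mem_filter] at he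
    rw [Finset.mem_union]
    rcases he.2.2 with rfl | rfl
    · exact Or.inl (Finset.mem_image_of_mem _ he.1)
    · exact Or.inr (Finset.mem_image_of_mem _ he.1)
  have hA := dvd_card_of_degOn (fun e he => (hc e he).1)
  have hB := dvd_card_of_degOn (fun e he => (hc e he).2)
  -- Each class has `E.card / 3` vertices, so the rank is at least `E.card / 3 + 1` and `J.card` at
  -- least `E.card / 3 + 2`.
  have hrank := card_add_one_le_finrank_cycleSpace a b ⟨e₁, he₁⟩
  have hrank' := finrank_cycleSpace_add_one_le (fun z hz => (h z).1 hz) (by omega) hJ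
  have hsub : ∀ i, star E L R i ⊆ E := fun i => Finset.filter_subset _ _
  -- A star is the cut of the indicator function of `i`, hence a cycle.
  have heven : ∀ i, (∀ x, Even (degOn (star E L R i) a x)) ∧
      ∀ x, Even (degOn (star E L R i) b x) := by
    intro i
    refine even_degOn_of_isCyc (hsub i) ((h _).2 ⟨fun j => if j = i then 1 else 0, ?_⟩)
    intro e he
    simp only [star, Finset.mem_filter, he, true_and]
    by_cases h1 : L e = i <;> by_cases h2 : R e = i
    · simp [h1, h2]; decide
    · have : L e ≠ R e := fun h => h2 (h ▸ h1)
      simp only [h1, h2] at this ⊢; simp [this]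
    · have : L e ≠ R e := fun h => h1 (h ▸ h2)
      simp only [h1, h2] at this ⊢; simp [this]
    · simp [h1, h2]
  have hsimple : ∀ i, Simple (star E L R i) a b := fun i e he f hf =>
    hs e (hsub i he) f (hsub i hf)
  -- Otherwise all stars have at least six edges, apart from at most four stars at the ends of `e₁`
  -- and `e₂`, which have at least four. Then `6 * J.card ≤ 2 * E.card + 8`, whereas the rank gives
  -- `6 * J.card ≥ 2 * E.card + 12`.
  obtain ⟨i, hiJ, hi6, hi1, hi2⟩ : ∃ i ∈ J, (star E L R i).card < 6 ∧ e₁ ∉ star E L R i ∧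
      e₂ ∉ star E L R i := by
    by_contra! hcon
    have hsum := sum_card_star_le E L R J
    have hlow : ∀ i ∈ J, 6 ≤ (star E L R i).card +
        (if i ∈ ({L e₁, R e₁, L e₂, R e₂} : Finset I) then 2 else 0) := by
      intro i hi
      have h4 := (hsimple i).four_le_card (heven i).1 (heven i).2 ((hJ i).1 hi)
      by_cases h6 : (star E L R i).card < 6
      · rw [if_pos]
        · omega
        · simp only [Finset.mem_insert, Finset.mem_singleton]
          by_cases hm : e₁ ∈ star E L R i
          · rw [star, Finset.mem_filter] at hm
            rcases hm.2.2 with h | h <;> simp [h]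
          · have hm := hcon i hi h6 hm
            rw [star, Finset.mem_filter] at hm
            rcases hm.2.2 with h | h <;> simp [h]
      · omega
    have hlow' := Finset.sum_le_sum hlow
    rw [Finset.sum_add_distrib, Finset.sum_const, smul_eq_mul, ← Finset.sum_filter,
      Finset.sum_const, smul_eq_mul] at hlow'
    have : (J.filter (· ∈ ({L e₁, R e₁, L e₂, R e₂} : Finset I))).card ≤ 4 := by
      refine (Finset.card_le_card (t := {L e₁, R e₁, L e₂, R e₂}) ?_).trans Finset.card_le_four
      intro i hi
      exact (Finset.mem_filter.1 hi).2
    omega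
  obtain ⟨d1, m1, d2, m2, d3, m3, d0, m0, k1, k2, k3, k4, k5, k6⟩ :=
    (hsimple i).exists_four_cycle (heven i).1 (heven i).2 ((hJ i).1 hiJ) hi6
  obtain ⟨f₁, f₂, f₃, f₄, hq⟩ := hc.exists_isQuad hs (hsub i m1) (hsub i m2) (hsub i m3)
    (hsub i m0) k1 k2 k3 k4 k5 k6
  refine ⟨f₁, f₂, f₃, f₄, d1, d2, d3, d0, hq, ?_, ?_⟩
  · intro hm
    simp only [Finset.mem_insert, Finset.mem_singleton] at hm
    rcases hm with rfl | rfl | rfl | rfl <;> exact hi1 (by assumption)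
  · intro hm
    simp only [Finset.mem_insert, Finset.mem_singleton] at hm
    rcases hm with rfl | rfl | rfl | rfl <;> exact hi2 (by assumption)

/-- Any two edges of a connected cubic bipartite graph with an abstract dual lie on a common cycle
of a 2-factor. -/
theorem pairsOnCycle_of_hasDual {E : Finset β} {a b : β → α} (hconn : Conn E a b)
    (hc : Cubic E a b) (hd : HasDual E a b) : PairsOnCycle E a b := by
  induction hn : E.card using Nat.strong_induction_on generalizing E a b with
  | _ n ih =>
    subst hn
    by_cases hs : Simple E a b
    · intro e₁ he₁ e₂ he₂
      obtain ⟨f₁, f₂, f₃, f₄, q₁₂, q₂₃, q₃₄, q₄₁, hq, hn₁, hn₂⟩ :=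
        hc.exists_isQuad_notMem hs hd he₁ (e₂ := e₂)
      have hlt : ∀ f₂ f₄ q₁₂ q₂₃ q₃₄ q₄₁, q₁₂ ∈ E →
          (reduceEdges E f₂ f₄ q₁₂ q₂₃ q₃₄ q₄₁).card < E.card := by
        intro f₂ f₄ q₁₂ q₂₃ q₃₄ q₄₁ hm
        refine Finset.card_lt_card ⟨fun e he => (mem_reduceEdges.1 he).2.2.2.2.2.2, fun h => ?_⟩
        exact (mem_reduceEdges.1 (h hm)).2.2.2.1 rfl
      rcases hq.conn_or hconn hc with h | h
      · exact hq.exists_linked (ih _ (hlt _ _ _ _ _ _ hq.mem.2.2.2.2.1) h (hq.cubic hc)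
          (hq.hasDual hd) rfl) he₁ he₂ hn₁ hn₂
      · refine hq.swap.exists_linked (ih _ (hlt _ _ _ _ _ _ hq.swap.mem.2.2.2.2.1) h
          (hq.swap.cubic hc) (hq.swap.hasDual hd) rfl) he₁ he₂ ?_ ?_
        · simp only [Finset.mem_insert, Finset.mem_singleton] at hn₁ ⊢; tauto
        · simp only [Finset.mem_insert, Finset.mem_singleton] at hn₂ ⊢; tauto
    · unfold Simple at hs
      push Not at hs
      obtain ⟨p, hp, p', hp', ha, hb, hne⟩ := hs
      obtain ⟨s, ms, as, sp, sp', hs⟩ := exists_third (hc p hp).1 hp hp' rfl ha.symm hne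
      obtain ⟨t, mt, bt, tp, tp', ht⟩ := exists_third (hc p hp).2 hp hp' rfl hb.symm hne
      by_cases hst : s = t
      · subst hst
        exact pairsOnCycle_of_triple hconn hc hp hp' ms hne sp sp' ha.symm hb.symm as bt
      · have hD : IsDigon E a b p p' s t :=
          ⟨hp, hp', ms, mt, hne, sp, sp', tp, tp', hst, ha.symm, hb.symm, as, bt, hs, ht⟩
        refine hD.pairsOnCycle hc (ih _ ?_ (hD.conn hconn) (hD.cubic hc)
          ((hd.erase hp').suppress hD.isSeries) rfl)
        refine Finset.card_lt_card ⟨fun e he => ?_, fun h => ?_⟩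
        · simp only [Finset.mem_erase] at he; exact he.2.2.2
        · have := h hp
          simp at this

/-! ### The square grid -/

/-- The edges of the square grid with vertex set `ℤ × ℤ`: the edge `((i, j), true)` is horizontal
and joins `(i, j)` and `(i + 1, j)`; the edge `((i, j), false)` is vertical and joins `(i, j)` and
`(i, j + 1)`. -/
abbrev GridEdge : Type := (ℤ × ℤ) × Bool

namespace GridEdge

/-- One end of an edge. -/
def src (ε : GridEdge) : ℤ × ℤ := ε.1

/-- The other end of an edge. -/
def tgt (ε : GridEdge) : ℤ × ℤ := if ε.2 then (ε.1.1 + 1, ε.1.2) else (ε.1.1, ε.1.2 + 1)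

/-- One of the two squares at an edge; squares are named by their lower left corners. -/
def side (ε : GridEdge) : ℤ × ℤ := ε.1

/-- The other square at an edge. -/
def side' (ε : GridEdge) : ℤ × ℤ := if ε.2 then (ε.1.1, ε.1.2 - 1) else (ε.1.1 - 1, ε.1.2)

end GridEdge

open GridEdge

/-- The mod 2 boundary of a (possibly infinite) set of grid edges. -/
def gridBoundary : (GridEdge → ZMod 2) →ₗ[ZMod 2] (ℤ × ℤ → ZMod 2) where
  toFun z g := (z (g, true) + z ((g.1 - 1, g.2), true)) + (z (g, false) + z ((g.1, g.2 - 1), false))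
  map_add' z w := by ext g; simp only [Pi.add_apply]; ring
  map_smul' c z := by ext g; simp only [Pi.smul_apply, smul_eq_mul, RingHom.id_apply]; ring

lemma gridBoundary_apply (z : GridEdge → ZMod 2) (g : ℤ × ℤ) : gridBoundary z g =
    (z (g, true) + z ((g.1 - 1, g.2), true)) + (z (g, false) + z ((g.1, g.2 - 1), false)) := rfl

lemma gridBoundary_single (ε : GridEdge) :
    gridBoundary (Pi.single ε 1) = Pi.single ε.src 1 + Pi.single ε.tgt 1 := by
  obtain ⟨⟨i, j⟩, b⟩ := ε
  ext ⟨k, l⟩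
  rw [gridBoundary_apply]
  have e1 : (i = k ∧ j = l) = ((k = i) ∧ l = j) := by rw [eq_comm (a := i), eq_comm (a := j)]
  cases b <;>
  simp only [src, tgt, Pi.add_apply, Pi.single_apply, Prod.mk.injEq, if_true, if_false,
    Bool.false_eq_true, and_true, and_false, reduceCtorEq, add_zero, zero_add,
    sub_eq_iff_eq_add]

/-- Each of the four squares around a grid point has two edges there, so its value cancels. -/
lemma gridBoundary_coboundary (c : ℤ × ℤ → ZMod 2) :
    gridBoundary (fun ε => c ε.side + c ε.side') = 0 := by
  ext ⟨i, j⟩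
  simp only [gridBoundary_apply, side, side', Pi.zero_apply, if_true, if_false,
    Bool.false_eq_true]
  have h := fun x : ZMod 2 => CharTwo.add_self_eq_zero x
  linear_combination h (c (i, j)) + h (c (i, j - 1)) + h (c (i - 1, j)) + h (c (i - 1, j - 1))

lemma exists_sub_eq (d : ℤ → ZMod 2) (x : ZMod 2) :
    ∃ s : ℤ → ZMod 2, s 0 = x ∧ ∀ n, d n = s n + s (n - 1) := by
  refine ⟨fun n => x + (∑ k ∈ Finset.Ioc 0 n, d k + ∑ k ∈ Finset.Ioc n 0, d k), by simp, fun n => ?_⟩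
  have h := fun x : ZMod 2 => CharTwo.add_self_eq_zero x
  rcases le_or_gt n 0 with hn | hn
  · have e1 : Finset.Ioc 0 n = ∅ := Finset.Ioc_eq_empty (by omega)
    have e2 : Finset.Ioc 0 (n - 1) = ∅ := Finset.Ioc_eq_empty (by omega)
    have e3 : Finset.Ioc (n - 1) 0 = insert n (Finset.Ioc n 0) := by
      ext k; simp only [Finset.mem_insert, Finset.mem_Ioc]; omega
    simp only [e1, e2, e3]
    rw [Finset.sum_insert (by simp)]
    linear_combination - h x - h (∑ k ∈ Finset.Ioc n 0, d k)
  · have e1 : Finset.Ioc n 0 = ∅ := Finset.Ioc_eq_empty (by omega)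
    have e2 : Finset.Ioc (n - 1) 0 = ∅ := Finset.Ioc_eq_empty (by omega)
    have e3 : Finset.Ioc 0 n = insert n (Finset.Ioc 0 (n - 1)) := by
      ext k; simp only [Finset.mem_insert, Finset.mem_Ioc]; omega
    simp only [e1, e2, e3]
    rw [Finset.sum_insert (by simp)]
    linear_combination - h x - h (∑ k ∈ Finset.Ioc 0 (n - 1), d k)

/-- Every set of grid edges without boundary separates the squares into two classes. -/
lemma exists_coboundary_eq {z : GridEdge → ZMod 2} (hz : gridBoundary z = 0) :
    ∃ c : ℤ × ℤ → ZMod 2, ∀ ε, z ε = c ε.side + c ε.side' := by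
  -- The values on the squares of row 0 are summed up across the vertical edges, then along each
  -- column across the horizontal ones. The condition at the other vertical edges follows by
  -- induction, as zero boundary makes the defect equal in adjacent rows.
  obtain ⟨s, -, hs⟩ := exists_sub_eq (fun i => z ((i, 0), false)) 0
  choose t ht0 ht using fun i => exists_sub_eq (fun j => z ((i, j), true)) (s i)
  have h := fun x : ZMod 2 => CharTwo.add_self_eq_zero x
  have step : ∀ i j, (z ((i, j), false) + t i j + t (i - 1) j) =
      (z ((i, j - 1), false) + t i (j - 1) + t (i - 1) (j - 1)) := by
    intro i j
    have := congrFun hz (i, j)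
    simp only [gridBoundary_apply, Pi.zero_apply, ht] at this
    linear_combination this - h (t i (j - 1)) - h (t (i - 1) (j - 1)) - h (z ((i, j - 1), false))
  have main : ∀ j i, z ((i, j), false) + t i j + t (i - 1) j = 0 := by
    intro j
    induction j using Int.induction_on with
    | zero =>
      intro i
      rw [ht0, ht0, hs]
      linear_combination h (s i) + h (s (i - 1))
    | succ n ih =>
      intro i
      rw [step, add_sub_cancel_right]
      exact ih i
    | pred n ih =>
      intro i
      rw [← step]
      exact ih i
  refine ⟨fun g => t g.1 g.2, ?_⟩
  rintro ⟨⟨i, j⟩, b⟩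
  cases b
  · simp only [side, side', Bool.false_eq_true, if_false]
    linear_combination main j i - h (t i j) - h (t (i - 1) j)
  · simp only [side, side', if_true]
    exact ht i j

/-- Adjacency in the subgraph of the grid induced on `C`. -/
def GridAdj (C : Set (ℤ × ℤ)) (x y : ℤ × ℤ) : Prop :=
  x ∈ C ∧ y ∈ C ∧ ∃ ε : GridEdge, (ε.src = x ∧ ε.tgt = y) ∨ (ε.src = y ∧ ε.tgt = x)

/-- The subgraph of the grid induced on `C` is connected. -/
def GridConnected (C : Set (ℤ × ℤ)) : Prop :=
  ∀ x ∈ C, ∀ y ∈ C, Relation.ReflTransGen (GridAdj C) x y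

lemma GridAdj.symm {C : Set (ℤ × ℤ)} {x y : ℤ × ℤ} (h : GridAdj C x y) : GridAdj C y x :=
  ⟨h.2.1, h.1, h.2.2.imp fun _ h => h.symm⟩

/-- The chain is the mod 2 sum of the edges of a walk. -/
lemma exists_chain {C : Set (ℤ × ℤ)} {x y : ℤ × ℤ} (h : Relation.ReflTransGen (GridAdj C) x y) :
    ∃ p : GridEdge → ZMod 2, (∀ ε, p ε ≠ 0 → ε.src ∈ C ∧ ε.tgt ∈ C) ∧
      gridBoundary p = Pi.single x 1 + Pi.single y 1 := by
  induction h with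
  | refl => exact ⟨0, by simp, by rw [map_zero]; exact (CharTwo.add_self_eq_zero _).symm⟩
  | @tail u w _ hadj ih =>
    obtain ⟨p, hp, hb⟩ := ih
    obtain ⟨hu, hw, ε, hε⟩ := hadj
    have hsub : ε.src ∈ C ∧ ε.tgt ∈ C := by
      rcases hε with ⟨h1, h2⟩ | ⟨h1, h2⟩ <;> rw [h1, h2] <;> exact ⟨by assumption, by assumption⟩
    have hbd : gridBoundary (Pi.single ε 1) = Pi.single u 1 + Pi.single w 1 := by
      rw [gridBoundary_single]
      rcases hε with ⟨h1, h2⟩ | ⟨h1, h2⟩ <;> rw [h1, h2]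
      exact add_comm _ _
    refine ⟨p + Pi.single ε 1, fun δ hδ => ?_, ?_⟩
    · by_cases hδε : δ = ε
      · rw [hδε]; exact hsub
      · refine hp δ ?_
        rwa [Pi.add_apply, Pi.single_eq_of_ne hδε, add_zero] at hδ
    · rw [map_add, hb, hbd]
      have := CharTwo.add_self_eq_zero (Pi.single u 1 : ℤ × ℤ → ZMod 2)
      linear_combination this

lemma sum_eq_sum_shift {K : Finset (ℤ × ℤ)} {w : ℤ × ℤ → ZMod 2} {d : ℤ × ℤ}
    (h : ∀ g, w g ≠ 0 → (g ∈ K ↔ g + d ∈ K)) : ∑ g ∈ K, w g = ∑ g ∈ K, w (g - d) := by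
  refine Finset.sum_bij_ne_zero (fun g _ _ => g + d) (fun g hg hw => (h g hw).1 hg)
    (fun g _ _ g' _ _ hgg => add_right_cancel hgg) (fun g hg hw => ?_) (fun g _ _ => by simp)
  exact ⟨g - d, (h _ hw).2 (by simpa using hg), hw, by simp⟩

/-- Each edge of the support is counted at both of its ends or at neither. -/
lemma sum_gridBoundary_eq_zero {K : Finset (ℤ × ℤ)} {w : GridEdge → ZMod 2}
    (h : ∀ ε : GridEdge, w ε ≠ 0 → (ε.src ∈ K ↔ ε.tgt ∈ K)) :
    ∑ g ∈ K, gridBoundary w g = 0 := by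
  have e1 : ∑ g ∈ K, w (g, true) = ∑ g ∈ K, w ((g.1 - 1, g.2), true) := by
    rw [sum_eq_sum_shift (w := fun g => w (g, true)) (d := (1, 0))]
    · simp only [Prod.sub_def, sub_zero]
    · intro g hg; simpa [src, tgt, Prod.add_def] using h _ hg
  have e2 : ∑ g ∈ K, w (g, false) = ∑ g ∈ K, w ((g.1, g.2 - 1), false) := by
    rw [sum_eq_sum_shift (w := fun g => w (g, false)) (d := (0, 1))]
    · simp only [Prod.sub_def, sub_zero]
    · intro g hg; simpa [src, tgt, Prod.add_def] using h _ hg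
  simp only [gridBoundary_apply, Finset.sum_add_distrib, e1, e2, CharTwo.add_self_eq_zero]

/-- The branch sets `C` and the grid edges `f` form a model of the graph as a minor of the grid. -/
structure IsGridMinor (E : Finset β) (a b : β → α) (C : α → Set (ℤ × ℤ)) (f : β → GridEdge) :
    Prop where
  finite : ∀ v, (C v).Finite
  connected : ∀ v, GridConnected (C v)
  disjoint : ∀ u v g, g ∈ C u → g ∈ C v → u = v
  injOn : ∀ e ∈ E, ∀ e' ∈ E, f e = f e' → e = e'
  ends : ∀ e ∈ E, ((f e).src ∈ C (a e) ∧ (f e).tgt ∈ C (b e)) ∨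
    ((f e).src ∈ C (b e) ∧ (f e).tgt ∈ C (a e))

/-! ### Grid minors have abstract duals. -/

section Minor

variable {E : Finset β} {a b : β → α} {C : α → Set (ℤ × ℤ)} {f : β → GridEdge}

/-- Each grid edge `f e` is prolonged inside the two branch sets to base points. In the combination
with coefficients `z`, the boundary at a base point is a vertex sum of `z`, hence zero. -/
lemma IsGridMinor.exists_lift (h : IsGridMinor E a b C f) (hab : ∀ e ∈ E, a e ≠ b e)
    {z : β → ZMod 2} (hz : IsCyc E a b z) :
    ∃ w : GridEdge → ZMod 2, gridBoundary w = 0 ∧ (∀ e ∈ E, w (f e) = z e) ∧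
      ∀ ε, w ε ≠ 0 → (∃ v, ε.src ∈ C v ∧ ε.tgt ∈ C v) ∨ ∃ e ∈ E, ε = f e := by
  classical
  let base : α → ℤ × ℤ := fun v => if hv : (C v).Nonempty then hv.some else 0
  have hbase : ∀ v x, x ∈ C v → base v ∈ C v := fun v x hx => by
    have : (C v).Nonempty := ⟨x, hx⟩
    simp only [base, dif_pos this]
    exact this.some_mem
  have hchain : ∀ e ∈ E, ∃ p : GridEdge → ZMod 2,
      gridBoundary p = Pi.single (base (a e)) 1 + Pi.single (base (b e)) 1 ∧
      p (f e) = 1 ∧ ∀ ε, p ε ≠ 0 → (∃ v, ε.src ∈ C v ∧ ε.tgt ∈ C v) ∨ ε = f e := by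
    intro e he
    obtain ⟨x, y, hx, hy, hxy⟩ : ∃ x y, x ∈ C (a e) ∧ y ∈ C (b e) ∧
        gridBoundary (Pi.single (f e) 1) = Pi.single x 1 + Pi.single y 1 := by
      rcases h.ends e he with ⟨h1, h2⟩ | ⟨h1, h2⟩
      · exact ⟨_, _, h1, h2, gridBoundary_single _⟩
      · exact ⟨_, _, h2, h1, by rw [gridBoundary_single, add_comm]⟩
    have hout : ¬ ∃ v, (f e).src ∈ C v ∧ (f e).tgt ∈ C v := by
      rintro ⟨v, h1, h2⟩
      rcases h.ends e he with ⟨h3, h4⟩ | ⟨h3, h4⟩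
      · exact hab e he ((h.disjoint _ _ _ h3 h1).trans (h.disjoint _ _ _ h2 h4))
      · exact hab e he ((h.disjoint _ _ _ h4 h2).trans (h.disjoint _ _ _ h1 h3))
    obtain ⟨p, hp, hpb⟩ := exists_chain (h.connected (a e) x hx _ (hbase _ x hx))
    obtain ⟨q, hq, hqb⟩ := exists_chain (h.connected (b e) y hy _ (hbase _ y hy))
    refine ⟨Pi.single (f e) 1 + p + q, ?_, ?_, ?_⟩
    · rw [map_add, map_add, hxy, hpb, hqb]
      have h1 := CharTwo.add_self_eq_zero (Pi.single x 1 : ℤ × ℤ → ZMod 2)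
      have h2 := CharTwo.add_self_eq_zero (Pi.single y 1 : ℤ × ℤ → ZMod 2)
      linear_combination h1 + h2
    · have hp0 : p (f e) = 0 := by
        by_contra h0; exact hout ⟨_, hp _ h0⟩
      have hq0 : q (f e) = 0 := by
        by_contra h0; exact hout ⟨_, hq _ h0⟩
      simp [hp0, hq0]
    · intro ε hε
      by_cases h1 : ε = f e
      · exact Or.inr h1
      · left
        by_cases h2 : p ε = 0
        · refine ⟨b e, hq ε fun h3 => hε ?_⟩
          simp [h2, h3, h1]
        · exact ⟨a e, hp ε h2⟩
  choose! p hp1 hp2 hp3 using hchain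
  refine ⟨∑ e ∈ E, z e • p e, ?_, ?_, ?_⟩
  · rw [map_sum]
    have key : ∀ k : β → α, (∀ e ∈ E, base (k e) ∈ C (k e)) →
        (∀ x, ∑ f ∈ E with k f = x, z f = 0) →
        ∑ e ∈ E, z e • (Pi.single (base (k e)) 1 : ℤ × ℤ → ZMod 2) = 0 := by
      intro k hk hzk
      ext g
      simp only [Finset.sum_apply, Pi.smul_apply, Pi.single_apply, smul_eq_mul, mul_ite, mul_one,
        mul_zero, Pi.zero_apply]
      by_cases hg : ∃ e ∈ E, g = base (k e)
      · obtain ⟨e, he, rfl⟩ := hg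
        refine Eq.trans ?_ (hzk (k e))
        rw [Finset.sum_filter]
        refine Finset.sum_congr rfl fun e' he' => ?_
        by_cases hee : k e' = k e
        · rw [hee, if_pos rfl, if_pos rfl]
        · rw [if_neg hee, if_neg]
          intro hb
          exact hee (h.disjoint _ _ _ (hk e' he') (hb ▸ hk e he))
      · push Not at hg
        exact Finset.sum_eq_zero fun e he => if_neg (hg e he)
    have e1 := key a (fun e he => by
      rcases h.ends e he with ⟨h1, h2⟩ | ⟨h1, h2⟩
      · exact hbase _ _ h1
      · exact hbase _ _ h2) hz.1
    have e2 := key b (fun e he => by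
      rcases h.ends e he with ⟨h1, h2⟩ | ⟨h1, h2⟩
      · exact hbase _ _ h2
      · exact hbase _ _ h1) hz.2
    rw [← add_zero (0 : ℤ × ℤ → ZMod 2)]
    nth_rewrite 1 [← e1]
    rw [← e2, ← Finset.sum_add_distrib]
    refine Finset.sum_congr rfl fun e he => ?_
    rw [map_smul, hp1 e he, smul_add]
  · intro e he
    rw [Finset.sum_apply, Finset.sum_eq_single e]
    · simp [hp2 e he]
    · intro e' he' hne
      rw [Pi.smul_apply]
      by_cases h0 : p e' (f e) = 0
      · rw [h0, smul_zero]
      exfalso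
      rcases hp3 e' he' _ h0 with ⟨v, h1, h2⟩ | h1
      · rcases h.ends e he with ⟨h3, h4⟩ | ⟨h3, h4⟩
        · exact hab e he ((h.disjoint _ _ _ h3 h1).trans (h.disjoint _ _ _ h2 h4))
        · exact hab e he ((h.disjoint _ _ _ h4 h2).trans (h.disjoint _ _ _ h1 h3))
      · exact hne (h.injOn _ he' _ he h1.symm)
    · intro h'; exact absurd he h'
  · intro ε hε
    rw [Finset.sum_apply] at hε
    obtain ⟨e, he, hne⟩ := Finset.exists_ne_zero_of_sum_ne_zero hε
    have : p e ε ≠ 0 := fun h0 => hne (by rw [Pi.smul_apply, h0, smul_zero])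
    rcases hp3 e he ε this with h1 | h1
    · exact Or.inl h1
    · exact Or.inr ⟨e, he, h1⟩

/-- Sum the zero boundary over a branch set: edges inside it count twice, so only the edges `f e`
that leave it contribute. -/
lemma IsGridMinor.isCyc (h : IsGridMinor E a b C f) (hab : ∀ e ∈ E, ∀ e' ∈ E, a e ≠ b e')
    {w : GridEdge → ZMod 2} (hw : gridBoundary w = 0)
    (hsupp : ∀ ε, w ε ≠ 0 → (∃ v, ε.src ∈ C v ∧ ε.tgt ∈ C v) ∨ ∃ e ∈ E, ε = f e) :
    IsCyc E a b (fun e => w (f e)) := by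
  classical
  have key : ∀ x, ∑ e ∈ E, ((if a e = x then w (f e) else 0) +
      (if b e = x then w (f e) else 0)) = 0 := by
    intro x
    set K := (h.finite x).toFinset with hK
    have hmem : ∀ g, g ∈ K ↔ g ∈ C x := fun g => by simp [hK]
    -- This is the part of `w` on the edges `f e`; the rest, `w + w₀`, is supported inside branch
    -- sets.
    set w₀ : GridEdge → ZMod 2 := ∑ e ∈ E, w (f e) • Pi.single (f e) 1 with hw₀
    have hval : ∀ e ∈ E, w₀ (f e) = w (f e) := by
      intro e he
      rw [hw₀, Finset.sum_apply, Finset.sum_eq_single e]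
      · simp
      · intro e' he' hne
        rw [Pi.smul_apply, Pi.single_eq_of_ne, smul_zero]
        exact fun h' => hne (h.injOn _ he' _ he h'.symm)
      · intro h'; exact absurd he h'
    have hval0 : ∀ ε, (∀ e ∈ E, ε ≠ f e) → w₀ ε = 0 := by
      intro ε hε
      rw [hw₀, Finset.sum_apply]
      refine Finset.sum_eq_zero fun e he => ?_
      rw [Pi.smul_apply, Pi.single_eq_of_ne (hε e he), smul_zero]
    have h1 : ∑ g ∈ K, gridBoundary (w + w₀) g = 0 := by
      refine sum_gridBoundary_eq_zero fun ε hε => ?_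
      by_cases hf : ∃ e ∈ E, ε = f e
      · obtain ⟨e, he, rfl⟩ := hf
        rw [Pi.add_apply, hval e he, CharTwo.add_self_eq_zero] at hε
        exact absurd rfl hε
      · have hf' := hf
        push Not at hf'
        rw [Pi.add_apply, hval0 ε hf', add_zero] at hε
        rcases hsupp ε hε with ⟨v, h1, h2⟩ | h1
        · rw [hmem, hmem]
          constructor
          · intro h3; rwa [h.disjoint _ _ _ h3 h1]
          · intro h3; rwa [h.disjoint _ _ _ h3 h2]
        · exact absurd h1 hf
    rw [map_add, hw, zero_add, hw₀, map_sum] at h1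
    simp only [Finset.sum_apply] at h1
    rw [Finset.sum_comm] at h1
    refine Eq.trans ?_ h1
    refine Finset.sum_congr rfl fun e he => ?_
    simp only [map_smul, gridBoundary_single, Pi.smul_apply, Pi.add_apply, smul_eq_mul]
    rw [← Finset.mul_sum, Finset.sum_add_distrib]
    simp only [Pi.single_apply, Finset.sum_ite_eq', hmem, mul_add, mul_ite, mul_one, mul_zero]
    have hiff : ∀ v g, g ∈ C v → (g ∈ C x ↔ v = x) := fun v g hg =>
      ⟨fun h' => h.disjoint _ _ _ hg h', fun h' => h' ▸ hg⟩
    rcases h.ends e he with ⟨h3, h4⟩ | ⟨h3, h4⟩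
    · simp only [hiff _ _ h3, hiff _ _ h4]
    · simp only [hiff _ _ h3, hiff _ _ h4]
      exact add_comm _ _
  -- No vertex is an end under both `a` and `b`, so in `key` one of the two sums vanishes termwise.
  refine ⟨fun x => ?_, fun x => ?_⟩
  · by_cases hx : ∃ e ∈ E, a e = x
    · obtain ⟨e, he, rfl⟩ := hx
      refine Eq.trans ?_ (key (a e))
      rw [Finset.sum_filter]
      refine Finset.sum_congr rfl fun e' he' => ?_
      rw [if_neg (hab e he e' he').symm, add_zero]
    · push Not at hx
      rw [Finset.sum_filter]
      exact Finset.sum_eq_zero fun e he => if_neg (hx e he)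
  · by_cases hx : ∃ e ∈ E, b e = x
    · obtain ⟨e, he, rfl⟩ := hx
      refine Eq.trans ?_ (key (b e))
      rw [Finset.sum_filter]
      refine Finset.sum_congr rfl fun e' he' => ?_
      rw [if_neg (hab e' he' e he), zero_add]
    · push Not at hx
      rw [Finset.sum_filter]
      exact Finset.sum_eq_zero fun e he => if_neg (hx e he)

/-- A minor of the grid has an abstract dual. -/
theorem IsGridMinor.hasDual (h : IsGridMinor E a b C f)
    (hab : ∀ e ∈ E, ∀ e' ∈ E, a e ≠ b e') : HasDual E a b := by
  set allowed : GridEdge → Prop := fun ε => (∃ v, ε.src ∈ C v ∧ ε.tgt ∈ C v) ∨ ∃ e ∈ E, ε = f e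
    with hallowed
  -- Deleted grid edges merge the squares on their two sides. Contracted ones, inside branch sets,
  -- merge nothing and are simply absent from the dual.
  refine ⟨Quot (fun s t => ∃ ε, ¬ allowed ε ∧ s = side ε ∧ t = side' ε),
    fun e => Quot.mk _ (side (f e)), fun e => Quot.mk _ (side' (f e)), fun z => ⟨fun hz => ?_, ?_⟩⟩
  · obtain ⟨w, hw1, hw2, hw3⟩ := h.exists_lift (fun e he => hab e he e he) hz
    obtain ⟨c, hc⟩ := exists_coboundary_eq hw1
    refine ⟨Quot.lift c ?_, fun e he => ?_⟩
    · rintro _ _ ⟨ε, hε, rfl, rfl⟩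
      have h0 : w ε = 0 := by
        by_contra h0; exact hε (hw3 ε h0)
      rw [hc] at h0
      exact CharTwo.add_eq_zero.1 h0
    · rw [← hw2 e he]; exact hc _
  · rintro ⟨c, hc⟩
    rw [isCyc_congr hc]
    refine h.isCyc hab (gridBoundary_coboundary (fun g => c (Quot.mk _ g))) fun ε hε => ?_
    by_contra h0
    refine hε ?_
    rw [Quot.sound (r := fun s t => ∃ ε, ¬ allowed ε ∧ s = side ε ∧ t = side' ε) ⟨ε, h0, rfl, rfl⟩]
    exact CharTwo.add_self_eq_zero _

end Minor

/-! ### Discretising a drawing -/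

lemma gridAdj_right {C : Set (ℤ × ℤ)} {i j : ℤ} (h : (i, j) ∈ C) (h' : (i + 1, j) ∈ C) :
    GridAdj C (i, j) (i + 1, j) := ⟨h, h', ((i, j), true), Or.inl ⟨rfl, rfl⟩⟩

lemma gridAdj_up {C : Set (ℤ × ℤ)} {i j : ℤ} (h : (i, j) ∈ C) (h' : (i, j + 1) ∈ C) :
    GridAdj C (i, j) (i, j + 1) := ⟨h, h', ((i, j), false), Or.inl ⟨rfl, rfl⟩⟩

lemma reflTransGen_gridAdj_symm {C : Set (ℤ × ℤ)} {x y : ℤ × ℤ}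
    (h : Relation.ReflTransGen (GridAdj C) x y) : Relation.ReflTransGen (GridAdj C) y x :=
  haveI : Std.Symm (GridAdj C) := ⟨fun _ _ h => h.symm⟩
  Relation.ReflTransGen.stdSymm.symm _ _ h

lemma reflTransGen_gridAdj_mono {C D : Set (ℤ × ℤ)} (hCD : C ⊆ D) {x y : ℤ × ℤ}
    (h : Relation.ReflTransGen (GridAdj C) x y) : Relation.ReflTransGen (GridAdj D) x y :=
  Relation.ReflTransGen.mono (fun _ _ h => ⟨hCD h.1, hCD h.2.1, h.2.2⟩) _ _ h

lemma reflTransGen_row {C : Set (ℤ × ℤ)} {i i' j : ℤ}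
    (h : ∀ k ∈ Set.uIcc i i', (k, j) ∈ C) : Relation.ReflTransGen (GridAdj C) (i, j) (i', j) := by
  have key : ∀ i i' : ℤ, i ≤ i' → (∀ k, i ≤ k → k ≤ i' → (k, j) ∈ C) →
      Relation.ReflTransGen (GridAdj C) (i, j) (i', j) := by
    intro i i' hle
    induction i', hle using Int.leInduction with
    | base => intro _; exact Relation.ReflTransGen.refl
    | succ n hn ih =>
      intro hk
      exact (ih fun k h1 h2 => hk k h1 (by omega)).tail
        (gridAdj_right (hk n hn (by omega)) (hk (n + 1) (by omega) le_rfl))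
  rcases le_total i i' with hle | hle
  · exact key i i' hle fun k h1 h2 => h k (Set.mem_uIcc.2 (Or.inl ⟨h1, h2⟩))
  · exact reflTransGen_gridAdj_symm
      (key i' i hle fun k h1 h2 => h k (Set.mem_uIcc.2 (Or.inr ⟨h1, h2⟩)))

lemma reflTransGen_column {C : Set (ℤ × ℤ)} {i j j' : ℤ}
    (h : ∀ k ∈ Set.uIcc j j', (i, k) ∈ C) : Relation.ReflTransGen (GridAdj C) (i, j) (i, j') := by
  have key : ∀ j j' : ℤ, j ≤ j' → (∀ k, j ≤ k → k ≤ j' → (i, k) ∈ C) →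
      Relation.ReflTransGen (GridAdj C) (i, j) (i, j') := by
    intro j j' hle
    induction j', hle using Int.leInduction with
    | base => intro _; exact Relation.ReflTransGen.refl
    | succ n hn ih =>
      intro hk
      exact (ih fun k h1 h2 => hk k h1 (by omega)).tail
        (gridAdj_up (hk n hn (by omega)) (hk (n + 1) (by omega) le_rfl))
  rcases le_total j j' with hle | hle
  · exact key j j' hle fun k h1 h2 => h k (Set.mem_uIcc.2 (Or.inl ⟨h1, h2⟩))
  · exact reflTransGen_gridAdj_symm
      (key j' j hle fun k h1 h2 => h k (Set.mem_uIcc.2 (Or.inr ⟨h1, h2⟩)))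

lemma reflTransGen_corner {C : Set (ℤ × ℤ)} {i i' j j' : ℤ}
    (h : ∀ k ∈ Set.uIcc i i', (k, j) ∈ C) (h' : ∀ k ∈ Set.uIcc j j', (i', k) ∈ C) :
    Relation.ReflTransGen (GridAdj C) (i, j) (i', j') :=
  (reflTransGen_row h).trans (reflTransGen_column h')

lemma gridConnected_component {N : Set (ℤ × ℤ)} (w : ℤ × ℤ) :
    GridConnected {g | Relation.ReflTransGen (GridAdj N) w g} := by
  have key : ∀ g, Relation.ReflTransGen (GridAdj N) w g →
      Relation.ReflTransGen (GridAdj {g | Relation.ReflTransGen (GridAdj N) w g}) w g := by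
    intro g hg
    induction hg with
    | refl => exact Relation.ReflTransGen.refl
    | tail h1 h2 ih => exact ih.tail ⟨h1, h1.tail h2, h2.2.2⟩
  intro x hx y hy
  exact (reflTransGen_gridAdj_symm (key x hx)).trans (key y hy)

/-- A walk in `N` from `B` to `B'` has a part that leads from a neighbour of `B` to a neighbour
of `B'` outside `B` and `B'`. -/
lemma exists_middle {N B B' : Set (ℤ × ℤ)} (hBB' : Disjoint B B')
    (hfar : ∀ x ∈ B, ∀ y ∈ B', ¬ GridAdj N x y) {x y : ℤ × ℤ} (hx : x ∈ B) (hy : y ∈ B')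
    (h : Relation.ReflTransGen (GridAdj N) x y) :
    ∃ u ∈ B, ∃ v ∈ B', ∃ w w', GridAdj N u w ∧ GridAdj N w' v ∧ w ∈ N \ (B ∪ B') ∧
      Relation.ReflTransGen (GridAdj (N \ (B ∪ B'))) w w' := by
  by_contra hcon
  -- Along the walk, one remembers where it last left `B`; entering `B'` would complete the required
  -- part.
  have key : y ∈ B ∨ (y ∈ N \ (B ∪ B') ∧ ∃ u ∈ B, ∃ w, GridAdj N u w ∧ w ∈ N \ (B ∪ B') ∧
      Relation.ReflTransGen (GridAdj (N \ (B ∪ B'))) w y) := by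
    clear hy
    induction h with
    | refl => exact Or.inl hx
    | @tail p q _ hpq ih =>
      by_cases hqB : q ∈ B
      · exact Or.inl hqB
      by_cases hqB' : q ∈ B'
      · exfalso
        rcases ih with hp | ⟨-, u, hu, w, huw, hw, hwp⟩
        · exact hfar p hp q hqB' hpq
        · exact hcon ⟨u, hu, q, hqB', w, p, huw, hpq, hw, hwp⟩
      have hq : q ∈ N \ (B ∪ B') := ⟨hpq.2.1, by simp [hqB, hqB']⟩
      rcases ih with hp | ⟨hp, u, hu, w, huw, hw, hwp⟩
      · exact Or.inr ⟨hq, p, hp, q, hpq, hq, Relation.ReflTransGen.refl⟩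
      · exact Or.inr ⟨hq, u, hu, w, huw, hw, hwp.tail ⟨hp, hq, hpq.2.2⟩⟩
  rcases key with h1 | ⟨h1, -⟩
  · exact Set.disjoint_left.1 hBB' h1 hy
  · exact h1.2 (Or.inr hy)

/-- The point of the plane that represents a grid point, for the mesh size `δ`. -/
noncomputable def gridPoint (δ : ℝ) (g : ℤ × ℤ) : ℝ × ℝ := (δ * g.1, δ * g.2)

/-- The grid point to the lower left of a point in the plane. -/
noncomputable def roundPoint (δ : ℝ) (x : ℝ × ℝ) : ℤ × ℤ := (⌊x.1 / δ⌋, ⌊x.2 / δ⌋)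

lemma abs_mul_floor_sub_le {δ : ℝ} (hδ : 0 < δ) (x : ℝ) : |δ * ⌊x / δ⌋ - x| ≤ δ := by
  have h1 := Int.floor_le (x / δ)
  have h2 := Int.lt_floor_add_one (x / δ)
  rw [le_div_iff₀ hδ] at h1
  rw [div_lt_iff₀ hδ] at h2
  rw [abs_le]
  constructor <;> nlinarith

lemma dist_gridPoint_roundPoint {δ : ℝ} (hδ : 0 < δ) (x : ℝ × ℝ) :
    dist (gridPoint δ (roundPoint δ x)) x ≤ δ := by
  rw [Prod.dist_eq, max_le_iff, Real.dist_eq, Real.dist_eq]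
  exact ⟨abs_mul_floor_sub_le hδ _, abs_mul_floor_sub_le hδ _⟩

lemma finite_setOf_dist_gridPoint_le {δ : ℝ} (hδ : 0 < δ) (x : ℝ × ℝ) (R : ℝ) :
    {g | dist (gridPoint δ g) x ≤ R}.Finite := by
  refine ((Set.finite_Icc ⌊(x.1 - R) / δ⌋ ⌈(x.1 + R) / δ⌉).prod
    (Set.finite_Icc ⌊(x.2 - R) / δ⌋ ⌈(x.2 + R) / δ⌉)).subset ?_
  intro g hg
  rw [Set.mem_ofPred_eq, Prod.dist_eq, max_le_iff, Real.dist_eq, Real.dist_eq, abs_le, abs_le] at hg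
  have key : ∀ (n : ℤ) (y : ℝ), -R ≤ δ * n - y → δ * n - y ≤ R →
      n ∈ Set.Icc ⌊(y - R) / δ⌋ ⌈(y + R) / δ⌉ := by
    intro n y h1 h2
    constructor
    · have h3 := Int.floor_le ((y - R) / δ)
      rw [le_div_iff₀ hδ] at h3
      by_contra! h
      have : (n : ℝ) < ⌊(y - R) / δ⌋ := by exact_mod_cast h
      nlinarith
    · have h3 := Int.le_ceil ((y + R) / δ)
      rw [div_le_iff₀ hδ] at h3
      by_contra! h
      have : (⌈(y + R) / δ⌉ : ℝ) < n := by exact_mod_cast h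
      nlinarith
  exact ⟨key _ _ hg.1.1 hg.1.2, key _ _ hg.2.1 hg.2.2⟩

/-- The sup metric of `ℝ × ℝ` makes balls axis-parallel squares, which contain the L-shaped walks
between their grid points. -/
lemma gridConnected_box {δ : ℝ} (hδ : 0 < δ) (x : ℝ × ℝ) (R : ℝ) :
    GridConnected {g | dist (gridPoint δ g) x ≤ R} := by
  have hmem : ∀ g : ℤ × ℤ, g ∈ {g | dist (gridPoint δ g) x ≤ R} ↔
      |δ * g.1 - x.1| ≤ R ∧ |δ * g.2 - x.2| ≤ R := by
    intro g
    rw [Set.mem_ofPred_eq, Prod.dist_eq, max_le_iff, Real.dist_eq, Real.dist_eq]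
    rfl
  have conv : ∀ (y : ℝ) (i i' k : ℤ), |δ * i - y| ≤ R → |δ * i' - y| ≤ R → k ∈ Set.uIcc i i' →
      |δ * k - y| ≤ R := by
    intro y i i' k h1 h2 hk
    rw [abs_le] at h1 h2 ⊢
    rcases Set.mem_uIcc.1 hk with ⟨h3, h4⟩ | ⟨h3, h4⟩
    · have h3' : (i : ℝ) ≤ k := by exact_mod_cast h3
      have h4' : (k : ℝ) ≤ i' := by exact_mod_cast h4
      constructor <;> nlinarith
    · have h3' : (i' : ℝ) ≤ k := by exact_mod_cast h3
      have h4' : (k : ℝ) ≤ i := by exact_mod_cast h4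
      constructor <;> nlinarith
  rintro ⟨i, j⟩ h ⟨i', j'⟩ h'
  rw [hmem] at h h'
  refine reflTransGen_corner (fun k hk => ?_) (fun k hk => ?_)
  · rw [hmem]; exact ⟨conv _ _ _ _ h.1 h'.1 hk, h.2⟩
  · rw [hmem]; exact ⟨h'.1, conv _ _ _ _ h.2 h'.2 hk⟩

lemma dist_gridPoint_of_gridAdj {δ : ℝ} (hδ : 0 < δ) {C : Set (ℤ × ℤ)} {x y : ℤ × ℤ}
    (h : GridAdj C x y) : dist (gridPoint δ x) (gridPoint δ y) ≤ δ := by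
  obtain ⟨-, -, ⟨⟨i, j⟩, b⟩, h⟩ := h
  have key : dist (gridPoint δ (GridEdge.src ((i, j), b))) (gridPoint δ (GridEdge.tgt ((i, j), b)))
      ≤ δ := by
    rw [Prod.dist_eq, max_le_iff, Real.dist_eq, Real.dist_eq]
    have e1 : |δ * i - δ * ((i + 1 : ℤ) : ℝ)| ≤ δ := by
      push_cast; rw [show δ * i - δ * (i + 1) = -δ by ring, abs_neg, abs_of_pos hδ]
    have e2 : |δ * j - δ * ((j + 1 : ℤ) : ℝ)| ≤ δ := by
      push_cast; rw [show δ * j - δ * (j + 1) = -δ by ring, abs_neg, abs_of_pos hδ]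
    cases b
    · simp only [gridPoint, GridEdge.src, GridEdge.tgt, Bool.false_eq_true, if_false]
      exact ⟨by simpa using hδ.le, e2⟩
    · simp only [gridPoint, GridEdge.src, GridEdge.tgt, if_true]
      exact ⟨e1, by simpa using hδ.le⟩
  rcases h with ⟨rfl, rfl⟩ | ⟨rfl, rfl⟩
  · exact key
  · rw [dist_comm]; exact key

lemma abs_floor_sub_floor_le {δ : ℝ} (hδ : 0 < δ) {x y : ℝ} (h : |x - y| < δ) :
    ⌊y / δ⌋ ≤ ⌊x / δ⌋ + 1 ∧ ⌊x / δ⌋ ≤ ⌊y / δ⌋ + 1 := by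
  rw [abs_lt] at h
  constructor
  · rw [← Int.floor_add_one]
    refine Int.floor_mono ?_
    rw [div_add_one hδ.ne', div_le_div_iff_of_pos_right hδ]
    linarith
  · rw [← Int.floor_add_one]
    refine Int.floor_mono ?_
    rw [div_add_one hδ.ne', div_le_div_iff_of_pos_right hδ]
    linarith

/-- The grid points near a curve contain a walk from one end to the other. -/
lemma reflTransGen_near_curve {δ : ℝ} (hδ : 0 < δ) (γ : C(unitInterval, ℝ × ℝ)) (s t : unitInterval) :
    Relation.ReflTransGen (GridAdj {g | ∃ t, dist (gridPoint δ g) (γ t) ≤ 3 * δ})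
      (roundPoint δ (γ s)) (roundPoint δ (γ t)) := by
  -- Being joined by a walk is transitive and holds for nearby parameters, where rounded coordinates
  -- differ by at most one; the interval is connected.
  refine PreconnectedSpace.induction₂' (fun s t => Relation.ReflTransGen
    (GridAdj {g | ∃ t, dist (gridPoint δ g) (γ t) ≤ 3 * δ})
      (roundPoint δ (γ s)) (roundPoint δ (γ t))) (fun s => ?_) ?_ s t
  · have hev : ∀ᶠ t in nhds s, dist (γ t) (γ s) < δ :=
      γ.continuous.continuousAt.eventually (Metric.ball_mem_nhds _ hδ)
    filter_upwards [hev] with t ht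
    have main : Relation.ReflTransGen (GridAdj {g | ∃ t, dist (gridPoint δ g) (γ t) ≤ 3 * δ})
      (roundPoint δ (γ s)) (roundPoint δ (γ t)) := by
      rw [Prod.dist_eq, max_lt_iff, Real.dist_eq, Real.dist_eq] at ht
      have f1 := abs_floor_sub_floor_le hδ ht.1
      have f2 := abs_floor_sub_floor_le hδ ht.2
      have hmem : ∀ i j : ℤ, (i = ⌊(γ s).1 / δ⌋ ∨ i = ⌊(γ t).1 / δ⌋) →
          (j = ⌊(γ s).2 / δ⌋ ∨ j = ⌊(γ t).2 / δ⌋) →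
          (i, j) ∈ {g | ∃ t, dist (gridPoint δ g) (γ t) ≤ 3 * δ} := by
        intro i j hi hj
        refine ⟨s, ?_⟩
        rw [Prod.dist_eq, max_le_iff, Real.dist_eq, Real.dist_eq]
        have key : ∀ (x y : ℝ) (i : ℤ), |y - x| < δ → (i = ⌊x / δ⌋ ∨ i = ⌊y / δ⌋) →
            |δ * i - x| ≤ 3 * δ := by
          rintro x y i h (rfl | rfl)
          · have := abs_mul_floor_sub_le hδ x; linarith
          · have h1 := abs_mul_floor_sub_le hδ y
            have h2 := abs_add_le (δ * ⌊y / δ⌋ - y) (y - x)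
            rw [sub_add_sub_cancel] at h2
            linarith
        exact ⟨key _ _ _ ht.1 hi, key _ _ _ ht.2 hj⟩
      refine reflTransGen_corner (fun k hk => hmem _ _ ?_ (Or.inl rfl))
        (fun k hk => hmem _ _ (Or.inr rfl) ?_)
      · rw [Set.mem_uIcc] at hk; omega
      · rw [Set.mem_uIcc] at hk; omega
    exact ⟨main, reflTransGen_gridAdj_symm main⟩
  · exact ⟨fun _ _ _ h1 h2 => Relation.ReflTransGen.trans h1 h2⟩

lemma exists_pos_forall_mem {ι : Type*} (s : Finset ι) {P : ι → ℝ → Prop}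
    (hmono : ∀ i r r', r' ≤ r → P i r → P i r') (h : ∀ i ∈ s, ∃ r > 0, P i r) :
    ∃ r > 0, ∀ i ∈ s, P i r := by
  classical
  induction s using Finset.induction_on with
  | empty => exact ⟨1, one_pos, by simp⟩
  | insert i s hi ih =>
    obtain ⟨r, hr, h1⟩ := ih fun j hj => h j (Finset.mem_insert_of_mem hj)
    obtain ⟨r', hr', h2⟩ := h i (Finset.mem_insert_self _ _)
    refine ⟨min r r', lt_min hr hr', fun j hj => ?_⟩
    rcases Finset.mem_insert.1 hj with rfl | hj
    · exact hmono _ _ _ (min_le_right _ _) h2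
    · exact hmono _ _ _ (min_le_left _ _) (h1 j hj)

lemma exists_pos_lt_dist {X : Type*} [PseudoMetricSpace X] {s t : Set X} (hs : IsCompact s)
    (ht : IsClosed t) (hst : Disjoint s t) : ∃ r > (0 : ℝ), ∀ x ∈ s, ∀ y ∈ t, r < dist x y := by
  obtain ⟨r, hr, h⟩ := Metric.exists_pos_forall_lt_edist hs ht hst
  refine ⟨r, hr, fun x hx y hy => ?_⟩
  have := h x hx y hy
  rw [edist_nndist] at this
  exact_mod_cast this

/-- A drawing of a graph in the plane by curves, such that a curve passes through a vertex or
another curve in its ends only. -/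
structure IsDrawing {α β : Type*} (E : Finset β) (a b : β → α) (V : Finset α) (pt : α → ℝ × ℝ)
    (γ : β → C(unitInterval, ℝ × ℝ)) : Prop where
  mem : ∀ e ∈ E, a e ∈ V ∧ b e ∈ V
  left : ∀ e ∈ E, γ e 0 = pt (a e)
  right : ∀ e ∈ E, γ e 1 = pt (b e)
  point_ne : ∀ u ∈ V, ∀ v ∈ V, u ≠ v → pt u ≠ pt v
  ne_point : ∀ e ∈ E, ∀ v ∈ V, v ≠ a e → v ≠ b e → ∀ t, γ e t ≠ pt v
  ne_curve : ∀ e ∈ E, ∀ e' ∈ E, e ≠ e' → ∀ s t, γ e s ≠ pt (a e) → γ e s ≠ pt (b e) →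
    γ e s ≠ γ e' t

/-! ### From a drawing to a grid minor. -/

section Drawing

variable {α β : Type*} [DecidableEq α] [DecidableEq β] {E : Finset β} {a b : β → α} {V : Finset α}
  {pt : α → ℝ × ℝ} {γ : β → C(unitInterval, ℝ × ℝ)}

/-- The factor 5 leaves room for two boxes of radius `2 * r` and one mesh width between them. -/
lemma IsDrawing.exists_radius (h : IsDrawing E a b V pt γ) : ∃ r > 0,
    (∀ u ∈ V, ∀ v ∈ V, u ≠ v → 5 * r < dist (pt u) (pt v)) ∧
    ∀ e ∈ E, ∀ v ∈ V, v ≠ a e → v ≠ b e → ∀ t, 5 * r < dist (γ e t) (pt v) := by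
  obtain ⟨r₁, h₁, k₁⟩ := exists_pos_forall_mem (V ×ˢ V)
    (P := fun p r => p.1 ≠ p.2 → 5 * r < dist (pt p.1) (pt p.2))
    (fun p r r' hr hp hne => by have := hp hne; linarith) (by
      rintro ⟨u, v⟩ huv
      rw [Finset.mem_product] at huv
      by_cases huv' : u = v
      · exact ⟨1, one_pos, fun hne => absurd huv' hne⟩
      · have := dist_pos.2 (h.point_ne u huv.1 v huv.2 huv')
        exact ⟨dist (pt u) (pt v) / 10, by linarith, fun _ => by simp only; linarith⟩)
  obtain ⟨r₂, h₂, k₂⟩ := exists_pos_forall_mem (E ×ˢ V)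
    (P := fun p r => p.2 ≠ a p.1 → p.2 ≠ b p.1 → ∀ t, 5 * r < dist (γ p.1 t) (pt p.2))
    (fun p r r' hr hp h1 h2 t => by have := hp h1 h2 t; linarith) (by
      rintro ⟨e, v⟩ hev
      rw [Finset.mem_product] at hev
      by_cases hv : v ≠ a e ∧ v ≠ b e
      · obtain ⟨r, hr, hd⟩ := exists_pos_lt_dist (isCompact_range (γ e).continuous)
          (isClosed_singleton (x := pt v)) (by
            rw [Set.disjoint_singleton_right]
            rintro ⟨t, ht⟩
            exact h.ne_point e hev.1 v hev.2 hv.1 hv.2 t ht)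
        refine ⟨r / 5, by linarith, fun _ _ t => ?_⟩
        have := hd _ ⟨t, rfl⟩ _ rfl
        simp only
        linarith
      · exact ⟨1, one_pos, fun h1 h2 => absurd ⟨h1, h2⟩ hv⟩)
  refine ⟨min r₁ r₂, lt_min h₁ h₂, fun u hu v hv hne => ?_, fun e he v hv h1 h2 t => ?_⟩
  · have := k₁ (u, v) (Finset.mem_product.2 ⟨hu, hv⟩) hne
    have := min_le_left r₁ r₂
    simp only at *
    linarith
  · have := k₂ (e, v) (Finset.mem_product.2 ⟨he, hv⟩) h1 h2 t
    have := min_le_right r₁ r₂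
    simp only at *
    linarith

/-- Curves may meet at common ends; the part of a curve at distance at least `r` from its ends is
compact and disjoint from each other curve. -/
lemma IsDrawing.exists_separation (h : IsDrawing E a b V pt γ) {r : ℝ} (hr : 0 < r) : ∃ d > 0,
    ∀ e ∈ E, ∀ e' ∈ E, e ≠ e' → ∀ s t, r ≤ dist (γ e s) (pt (a e)) →
      r ≤ dist (γ e s) (pt (b e)) → d < dist (γ e s) (γ e' t) := by
  obtain ⟨d, hd, k⟩ := exists_pos_forall_mem (E ×ˢ E)
    (P := fun p d => p.1 ≠ p.2 → ∀ s t, r ≤ dist (γ p.1 s) (pt (a p.1)) →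
      r ≤ dist (γ p.1 s) (pt (b p.1)) → d < dist (γ p.1 s) (γ p.2 t))
    (fun p r r' hr hp h1 s t h2 h3 => by have := hp h1 s t h2 h3; linarith) (by
      rintro ⟨e, e'⟩ hee
      rw [Finset.mem_product] at hee
      by_cases hne : e = e'
      · exact ⟨1, one_pos, fun h1 => absurd hne h1⟩
      have hcl : IsClosed {s | r ≤ dist (γ e s) (pt (a e)) ∧ r ≤ dist (γ e s) (pt (b e))} :=
        IsClosed.inter (s₁ := {s | r ≤ dist (γ e s) (pt (a e))})
          (s₂ := {s | r ≤ dist (γ e s) (pt (b e))})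
          (isClosed_le continuous_const ((γ e).continuous.dist continuous_const))
          (isClosed_le continuous_const ((γ e).continuous.dist continuous_const))
      obtain ⟨d, hd, hd'⟩ := exists_pos_lt_dist (hcl.isCompact.image (γ e).continuous)
        (isCompact_range (γ e').continuous).isClosed (by
          rw [Set.disjoint_left]
          rintro _ ⟨s, ⟨h1, h2⟩, rfl⟩ ⟨t, ht⟩
          refine h.ne_curve e hee.1 e' hee.2 hne s t ?_ ?_ ht.symm
          · intro h0; rw [h0, dist_self] at h1; linarith
          · intro h0; rw [h0, dist_self] at h2; linarith)
      exact ⟨d, hd, fun _ s t h1 h2 => hd' _ ⟨s, ⟨h1, h2⟩, rfl⟩ _ ⟨t, rfl⟩⟩)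
  exact ⟨d, hd, fun e he e' he' hne => k (e, e') (Finset.mem_product.2 ⟨he, he'⟩) hne⟩

/-- A bipartite graph that has been drawn in the plane is a minor of the grid. -/
theorem IsDrawing.exists_isGridMinor (h : IsDrawing E a b V pt γ)
    (hab : ∀ e ∈ E, ∀ e' ∈ E, a e ≠ b e') : ∃ C f, IsGridMinor E a b C f := by
  classical
  obtain ⟨r, hr, hVV, hEV⟩ := h.exists_radius
  obtain ⟨d, hd, hEE⟩ := h.exists_separation hr
  -- Two corridors of width `3 * δ` cannot meet where the curves are more than `d` apart, and a
  -- curve point within `3 * δ` of a grid point outside a box of radius `2 * r` is at distance at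
  -- least `r` from its centre.
  set δ : ℝ := min r d / 10 with hδdef
  have hδ : 0 < δ := div_pos (lt_min hr hd) (by norm_num)
  have hδr : 10 * δ ≤ r := by have := min_le_left r d; rw [hδdef]; linarith
  have hδd : 10 * δ ≤ d := by have := min_le_right r d; rw [hδdef]; linarith
  set B : α → Set (ℤ × ℤ) := fun v => {g | dist (gridPoint δ g) (pt v) ≤ 2 * r} with hB
  set N : β → Set (ℤ × ℤ) := fun e => {g | ∃ t, dist (gridPoint δ g) (γ e t) ≤ 3 * δ} with hN
  set M : β → Set (ℤ × ℤ) := fun e => N e \ (B (a e) ∪ B (b e)) with hM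
  have hBB : ∀ u ∈ V, ∀ v ∈ V, u ≠ v → ∀ g, g ∈ B u → g ∉ B v := by
    intro u hu v hv hne g h1 h2
    have h1 : dist (gridPoint δ g) (pt u) ≤ 2 * r := h1
    have h2 : dist (gridPoint δ g) (pt v) ≤ 2 * r := h2
    have h3 := hVV u hu v hv hne
    have h4 := dist_triangle_left (pt u) (pt v) (gridPoint δ g)
    linarith
  have hfar : ∀ u ∈ V, ∀ v ∈ V, u ≠ v → ∀ x ∈ B u, ∀ y ∈ B v, ∀ C, ¬ GridAdj C x y := by
    intro u hu v hv hne x hx y hy C hxy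
    have h1 : dist (gridPoint δ x) (pt u) ≤ 2 * r := hx
    have h2 : dist (gridPoint δ y) (pt v) ≤ 2 * r := hy
    have h3 := hVV u hu v hv hne
    have h4 := dist_triangle_left (pt u) (pt v) (gridPoint δ x)
    have h5 := dist_triangle (gridPoint δ x) (gridPoint δ y) (pt v)
    have h6 := dist_gridPoint_of_gridAdj hδ hxy
    linarith
  have hMB : ∀ e ∈ E, ∀ v ∈ V, ∀ g ∈ M e, g ∉ B v := by
    intro e he v hv g hg hgv
    by_cases h1 : v = a e
    · exact hg.2 (Or.inl (h1 ▸ hgv))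
    by_cases h2 : v = b e
    · exact hg.2 (Or.inr (h2 ▸ hgv))
    obtain ⟨t, ht⟩ := hg.1
    have hgv : dist (gridPoint δ g) (pt v) ≤ 2 * r := hgv
    have h3 := hEV e he v hv h1 h2 t
    have h4 := dist_triangle_left (γ e t) (pt v) (gridPoint δ g)
    linarith
  have hMM : ∀ e ∈ E, ∀ e' ∈ E, e ≠ e' → ∀ g ∈ M e, g ∉ M e' := by
    intro e he e' he' hne g hg hg'
    obtain ⟨t, ht⟩ := hg.1
    obtain ⟨t', ht'⟩ := hg'.1
    have far : ∀ v, g ∉ B v → r ≤ dist (γ e t) (pt v) := by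
      intro v hv
      have hv : ¬ dist (gridPoint δ g) (pt v) ≤ 2 * r := hv
      have h4 := dist_triangle (gridPoint δ g) (γ e t) (pt v)
      linarith
    have h3 := hEE e he e' he' hne t t' (far _ fun h' => hg.2 (Or.inl h'))
      (far _ fun h' => hg.2 (Or.inr h'))
    have h4 := dist_triangle_left (γ e t) (γ e' t') (gridPoint δ g)
    linarith
  have hround : ∀ v, roundPoint δ (pt v) ∈ B v := by
    intro v
    have := dist_gridPoint_roundPoint hδ (pt v)
    change dist (gridPoint δ (roundPoint δ (pt v))) (pt v) ≤ 2 * r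
    linarith
  have hmid : ∀ e ∈ E, ∃ u ∈ B (a e), ∃ v ∈ B (b e), ∃ w w', GridAdj (N e) u w ∧
      GridAdj (N e) w' v ∧ w ∈ M e ∧ Relation.ReflTransGen (GridAdj (M e)) w w' := by
    intro e he
    have hm := h.mem e he
    have hne := hab e he e he
    refine exists_middle (Set.disjoint_left.2 fun g => hBB _ hm.1 _ hm.2 hne g)
      (fun x hx y hy => hfar _ hm.1 _ hm.2 hne x hx y hy _) (hround _) (hround _) ?_
    have := reflTransGen_near_curve hδ (γ e) 0 1
    rwa [h.left e he, h.right e he] at this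
  choose! u hu v hv w w' huw hwv hw hww using hmid
  set W : β → Set (ℤ × ℤ) := fun e => {g | Relation.ReflTransGen (GridAdj (M e)) (w e) g} with hW
  have hWM : ∀ e ∈ E, W e ⊆ M e := by
    intro e he g hg
    rcases Relation.ReflTransGen.cases_tail hg with h1 | ⟨x, -, h2⟩
    · rw [h1]; exact hw e he
    · exact h2.2.1
  have hedge : ∀ e ∈ E, ∃ ε : GridEdge, (ε.src = w' e ∧ ε.tgt = v e) ∨
      (ε.src = v e ∧ ε.tgt = w' e) := fun e he => (hwv e he).2.2
  choose! f hf using hedge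
  -- The connected piece `W e` of the corridor goes wholly to the branch set of `a e`; the grid edge
  -- from it into the box of `b e` then represents `e`.
  set C : α → Set (ℤ × ℤ) := fun x => {g | x ∈ V ∧ (g ∈ B x ∨ ∃ e ∈ E, a e = x ∧ g ∈ W e)} with hC
  have hw'W : ∀ e ∈ E, w' e ∈ W e := fun e he => hww e he
  refine ⟨C, f, ?_, ?_, ?_, ?_, ?_⟩
  · intro x
    have h1 : (B x).Finite := finite_setOf_dist_gridPoint_le hδ _ _
    have h2 : ∀ e, (N e).Finite := by
      intro e
      obtain ⟨R, hR⟩ := (isCompact_range (γ e).continuous).isBounded.subset_closedBall 0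
      refine (finite_setOf_dist_gridPoint_le hδ 0 (R + 3 * δ)).subset ?_
      rintro g ⟨t, ht⟩
      have h3 : dist (γ e t) 0 ≤ R := hR ⟨t, rfl⟩
      have h4 := dist_triangle (gridPoint δ g) (γ e t) 0
      change dist _ _ ≤ _
      linarith
    have h3 : (⋃ e ∈ E, N e).Finite := E.finite_toSet.biUnion fun e _ => h2 e
    refine (h1.union h3).subset ?_
    rintro g ⟨-, hg | ⟨e, he, -, hg⟩⟩
    · exact Or.inl hg
    · exact Or.inr (Set.mem_biUnion he (hWM e he hg).1)
  · intro x
    have key : ∀ g ∈ C x, ∃ k ∈ B x, Relation.ReflTransGen (GridAdj (C x)) g k := by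
      rintro g ⟨hx, hg | ⟨e, he, rfl, hg⟩⟩
      · exact ⟨g, hg, Relation.ReflTransGen.refl⟩
      · have hWC : W e ⊆ C (a e) := fun k hk => ⟨hx, Or.inr ⟨e, he, rfl, hk⟩⟩
        have hwW : w e ∈ W e := Relation.ReflTransGen.refl
        refine ⟨u e, hu e he, (reflTransGen_gridAdj_mono hWC
          (gridConnected_component (w e) g hg (w e) hwW)).tail ?_⟩
        exact ⟨hWC hwW, ⟨hx, Or.inl (hu e he)⟩, (huw e he).symm.2.2⟩
    intro g hg k hk
    obtain ⟨g', hg', h1⟩ := key g hg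
    obtain ⟨k', hk', h2⟩ := key k hk
    have hBC : B x ⊆ C x := fun y hy => ⟨hg.1, Or.inl hy⟩
    exact (h1.trans (reflTransGen_gridAdj_mono hBC
      (gridConnected_box hδ _ _ g' hg' k' hk'))).trans (reflTransGen_gridAdj_symm h2)
  · rintro x y g ⟨hx, hgx⟩ ⟨hy, hgy⟩
    by_contra hne
    rcases hgx with hgx | ⟨e, he, rfl, hgx⟩ <;> rcases hgy with hgy | ⟨e', he', rfl, hgy⟩
    · exact hBB x hx y hy hne g hgx hgy
    · exact hMB e' he' x hx g (hWM e' he' hgy) hgx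
    · exact hMB e he y hy g (hWM e he hgx) hgy
    · exact hMM e he e' he' (fun h' => hne (h' ▸ rfl)) g (hWM e he hgx) (hWM e' he' hgy)
  · intro e he e' he' hff
    by_contra hne
    have h1 := hf e he
    have h2 := hf e' he'
    rw [← hff] at h2
    have hw1 := hWM e he (hw'W e he)
    have hw2 := hWM e' he' (hw'W e' he')
    have n1 : w' e ≠ w' e' := fun h' => hMM e he e' he' hne _ hw1 (h' ▸ hw2)
    have n2 : w' e ≠ v e' := fun h' =>
      hMB e he (b e') (h.mem e' he').2 _ hw1 (h' ▸ hv e' he')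
    rcases h1 with ⟨h1, h1'⟩ | ⟨h1, h1'⟩ <;> rcases h2 with ⟨h2, h2'⟩ | ⟨h2, h2'⟩
    · exact n1 (h1.symm.trans h2)
    · exact n2 (h1.symm.trans h2)
    · exact n2 (h1'.symm.trans h2')
    · exact n1 (h1'.symm.trans h2')
  · intro e he
    have h1 : w' e ∈ C (a e) := ⟨(h.mem e he).1, Or.inr ⟨e, he, rfl, hw'W e he⟩⟩
    have h2 : v e ∈ C (b e) := ⟨(h.mem e he).2, Or.inl (hv e he)⟩
    rcases hf e he with ⟨h3, h4⟩ | ⟨h3, h4⟩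
    · left; rw [h3, h4]; exact ⟨h1, h2⟩
    · right; rw [h3, h4]; exact ⟨h2, h1⟩

end Drawing

/-! ### From graphs to end maps -/

/-- `E` is the edge set of the graph `G`, and `a e ∈ A`, `b e ∉ A` are the ends of `e`. -/
structure IsEnds {α β : Type*} (G : Graph α β) (A : Set α) (E : Finset β) (a b : β → α) :
    Prop where
  mem_iff : ∀ e, e ∈ E ↔ e ∈ G.edgeSet
  isLink : ∀ e ∈ E, G.IsLink e (a e) (b e)
  left_mem : ∀ e ∈ E, a e ∈ A
  right_notMem : ∀ e ∈ E, b e ∉ A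

section Ends

variable {α β : Type*} {G : Graph α β} {A : Set α} {E S : Finset β} {a b : β → α}

lemma exists_isEnds (hfin : G.vertexSet.Finite) (hne : G.vertexSet.Nonempty) (hcubic : G.IsCubic)
    (hA : ∀ e x y, G.IsLink e x y → (x ∈ A ↔ y ∉ A)) : ∃ E a b, IsEnds G A E a b := by
  classical
  have hE : G.edgeSet.Finite := by
    refine (hfin.biUnion (t := G.incidenceSet) fun x hx => ?_).subset fun e he => ?_
    · refine Set.finite_of_encard_le_coe (k := 3) ?_
      exact le_self_add.trans (hcubic x hx).le
    · obtain ⟨x, y, h⟩ := G.exists_isLink_of_mem_edgeSet he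
      exact Set.mem_biUnion h.left_mem h.inc_left
  have hends : ∀ e : G.edgeSet, ∃ p : α × α, G.IsLink e p.1 p.2 ∧ p.1 ∈ A ∧ p.2 ∉ A := by
    rintro ⟨e, he⟩
    obtain ⟨x, y, h⟩ := G.exists_isLink_of_mem_edgeSet he
    by_cases hx : x ∈ A
    · exact ⟨(x, y), h, hx, (hA e x y h).1 hx⟩
    · exact ⟨(y, x), h.symm, by by_contra hy; exact hx ((hA e x y h).2 hy), hx⟩
  choose p hp using hends
  -- An arbitrary value for both end maps off the edge set.
  obtain ⟨v, -⟩ := hne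
  refine ⟨hE.toFinset, fun e => if he : e ∈ G.edgeSet then (p ⟨e, he⟩).1 else v,
      fun e => if he : e ∈ G.edgeSet then (p ⟨e, he⟩).2 else v, ⟨fun e => by simp, ?_, ?_, ?_⟩⟩
  all_goals
    intro e he
    have he' := hE.mem_toFinset.1 he
    simp only [he', dif_pos]
  · exact (hp ⟨e, he'⟩).1
  · exact (hp ⟨e, he'⟩).2.1
  · exact (hp ⟨e, he'⟩).2.2

namespace IsEnds

lemma inc_iff (h : IsEnds G A E a b) {e : β} {x : α} :
    G.Inc e x ↔ e ∈ E ∧ (x = a e ∨ x = b e) := by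
  constructor
  · intro hx
    have he := (h.mem_iff e).2 hx.edge_mem
    exact ⟨he, hx.eq_or_eq_of_isLink (h.isLink e he)⟩
  · rintro ⟨he, rfl | rfl⟩
    exacts [(h.isLink e he).inc_left, (h.isLink e he).inc_right]

lemma inc_iff_left (h : IsEnds G A E a b) {e : β} {x : α} (hx : x ∈ A) :
    G.Inc e x ↔ e ∈ E ∧ a e = x := by
  rw [h.inc_iff]
  refine and_congr_right fun he => ⟨?_, fun h' => Or.inl h'.symm⟩
  rintro (rfl | rfl)
  exacts [rfl, absurd hx (h.right_notMem e he)]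

lemma inc_iff_right (h : IsEnds G A E a b) {e : β} {x : α} (hx : x ∉ A) :
    G.Inc e x ↔ e ∈ E ∧ b e = x := by
  rw [h.inc_iff]
  refine and_congr_right fun he => ⟨?_, fun h' => Or.inr h'.symm⟩
  rintro (rfl | rfl)
  exacts [absurd (h.left_mem e he) hx, rfl]

lemma left_ne_right (h : IsEnds G A E a b) {e f : β} (he : e ∈ E) (hf : f ∈ E) : a e ≠ b f :=
  fun h' => h.right_notMem f hf (h' ▸ h.left_mem e he)

lemma not_isLink_self (h : IsEnds G A E a b) (e : β) (x : α) : ¬ G.IsLink e x x := by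
  intro hx
  have he := (h.mem_iff e).2 hx.edge_mem
  rcases (h.isLink e he).eq_and_eq_or_eq_and_eq hx with ⟨h1, h2⟩ | ⟨h1, h2⟩ <;>
    exact h.left_ne_right he he (h1.trans h2.symm)

lemma deg_eq (h : IsEnds G A E a b) {H : Graph α β} (hH : H ≤ G) (x : α) :
    H.deg x = (H.incidenceSet x).encard := by
  have : H.loopSet x = ∅ := Set.eq_empty_iff_forall_notMem.2 fun e he =>
    h.not_isLink_self e x (Graph.IsLink.mono hH he)
  rw [Graph.deg, this, Set.encard_empty, add_zero]

variable [DecidableEq α] [DecidableEq β]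

lemma deg_eq_left (h : IsEnds G A E a b) (hS : S ⊆ E) {H : Graph α β} (hH : H ≤ G) {x : α}
    (hx : x ∈ A) (hinc : ∀ e, H.Inc e x ↔ e ∈ S ∧ G.Inc e x) : H.deg x = degOn S a x := by
  rw [h.deg_eq hH, degOn, ← Set.encard_coe_eq_coe_finsetCard]
  congr 1
  ext e
  rw [Graph.mem_incidenceSet, hinc, h.inc_iff_left hx]
  simp only [Finset.coe_filter, Set.mem_ofPred_eq]
  exact ⟨fun h' => ⟨h'.1, h'.2.2⟩, fun h' => ⟨h'.1, hS h'.1, h'.2⟩⟩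

lemma deg_eq_right (h : IsEnds G A E a b) (hS : S ⊆ E) {H : Graph α β} (hH : H ≤ G) {x : α}
    (hx : x ∉ A) (hinc : ∀ e, H.Inc e x ↔ e ∈ S ∧ G.Inc e x) : H.deg x = degOn S b x := by
  rw [h.deg_eq hH, degOn, ← Set.encard_coe_eq_coe_finsetCard]
  congr 1
  ext e
  rw [Graph.mem_incidenceSet, hinc, h.inc_iff_right hx]
  simp only [Finset.coe_filter, Set.mem_ofPred_eq]
  exact ⟨fun h' => ⟨h'.1, h'.2.2⟩, fun h' => ⟨h'.1, hS h'.1, h'.2⟩⟩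

lemma cubic (h : IsEnds G A E a b) (hcubic : G.IsCubic) : Cubic E a b := by
  intro e he
  have hinc : ∀ x f, G.Inc f x ↔ f ∈ E ∧ G.Inc f x := fun x f =>
    ⟨fun hf => ⟨(h.mem_iff f).2 hf.edge_mem, hf⟩, And.right⟩
  have h1 := hcubic _ (h.isLink e he).left_mem
  have h2 := hcubic _ (h.isLink e he).right_mem
  rw [h.deg_eq_left subset_rfl le_rfl (h.left_mem e he) (hinc _)] at h1
  rw [h.deg_eq_right subset_rfl le_rfl (h.right_notMem e he) (hinc _)] at h2
  exact ⟨by exact_mod_cast h1, by exact_mod_cast h2⟩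

lemma exists_inc (h : IsEnds G A E a b) (hcubic : G.IsCubic) {x : α} (hx : x ∈ G.vertexSet) :
    ∃ e ∈ E, G.Inc e x := by
  by_contra! hne
  have h1 := hcubic x hx
  have h2 : G.incidenceSet x = ∅ := Set.eq_empty_iff_forall_notMem.2 fun e he =>
    hne e ((h.mem_iff e).2 (Graph.Inc.edge_mem he)) he
  rw [h.deg_eq le_rfl, h2, Set.encard_empty] at h1
  norm_num at h1

lemma share_of_inc (h : IsEnds G A E a b) {e f : β} {x : α} (he : G.Inc e x) (hf : G.Inc f x) :
    a e = a f ∨ b e = b f := by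
  by_cases hx : x ∈ A
  · exact Or.inl (((h.inc_iff_left hx).1 he).2.trans ((h.inc_iff_left hx).1 hf).2.symm)
  · exact Or.inr (((h.inc_iff_right hx).1 he).2.trans ((h.inc_iff_right hx).1 hf).2.symm)

/-- A closed set with an edge of `E` at a vertex contains all edges there, so it spreads along walks
in `G`. -/
lemma conn (h : IsEnds G A E a b) (hconn : G.IsConnected) : Conn E a b := by
  rintro X hX ⟨e, he, hXe⟩ f hf
  have step : ∀ {g g' x}, X g → G.Inc g x → G.Inc g' x → X g' := fun {g g' x} hg hx hx' =>
    hX g g' ⟨(h.inc_iff.1 hx).1, (h.inc_iff.1 hx').1, h.share_of_inc hx hx'⟩ hg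
  have key : ∀ y, Relation.ReflTransGen G.Adj (a e) y → ∃ g, X g ∧ G.Inc g y := by
    intro y hy
    induction hy with
    | refl => exact ⟨e, hXe, (h.isLink e he).inc_left⟩
    | tail _ hyz ih =>
      obtain ⟨g, hg, hgy⟩ := ih
      obtain ⟨g', hg'⟩ := hyz
      exact ⟨g', step hg hgy hg'.inc_left, hg'.inc_right⟩
  obtain ⟨g, hg, hgf⟩ := key _ (hconn.2 _ (h.isLink e he).left_mem _ (h.isLink f hf).left_mem)
  exact step hg hgf (h.isLink f hf).inc_left

/-- A plane embedding, with every edge directed from `a e` to `b e`, is a drawing. -/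
lemma exists_isDrawing (h : IsEnds G A E a b) (hfin : G.vertexSet.Finite)
    (φ : G.PlaneEmbedding) : ∃ V pt γ, IsDrawing E a b V pt γ := by
  let c : C(EuclideanSpace ℝ (Fin 2), ℝ × ℝ) := ⟨fun v => (v 0, v 1), by fun_prop⟩
  have hc : Function.Injective c := by
    intro v w hvw
    have hvw' : (v 0, v 1) = (w 0, w 1) := hvw
    rw [Prod.mk.injEq] at hvw'
    ext i
    fin_cases i
    exacts [hvw'.1, hvw'.2]
  -- An arc that runs from `b e` to `a e` is reversed.
  have harc : ∀ e, ∃ η : C(unitInterval, EuclideanSpace ℝ (Fin 2)), e ∈ E →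
      η 0 = φ.point (a e) ∧ η 1 = φ.point (b e) ∧
      ∀ t, t ≠ 0 → t ≠ 1 → ∃ t', t' ≠ 0 ∧ t' ≠ 1 ∧ η t = φ.arc e t' := by
    intro e
    by_cases he : e ∈ E
    · rcases φ.arc_ends e _ _ (h.isLink e he) with ⟨h0, h1⟩ | ⟨h0, h1⟩
      · exact ⟨φ.arc e, fun _ => ⟨h0, h1, fun t h0 h1 => ⟨t, h0, h1, rfl⟩⟩⟩
      · refine ⟨(φ.arc e).comp ⟨unitInterval.symm, unitInterval.continuous_symm⟩,
          fun _ => ⟨?_, ?_, fun t ht0 ht1 => ⟨unitInterval.symm t, ?_, ?_, rfl⟩⟩⟩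
        · simpa using h1
        · simpa using h0
        · intro h'
          exact ht1 (by rw [← unitInterval.symm_symm t, h', unitInterval.symm_zero])
        · intro h'
          exact ht0 (by rw [← unitInterval.symm_symm t, h', unitInterval.symm_one])
    · exact ⟨φ.arc e, fun h' => absurd h' he⟩
  choose η hη using harc
  have hV : ∀ {v}, v ∈ hfin.toFinset ↔ v ∈ G.vertexSet := hfin.mem_toFinset
  have hpoint : ∀ e ∈ E, ∀ v ∈ G.vertexSet, v ≠ a e → v ≠ b e → ∀ t, η e t ≠ φ.point v := by
    intro e he v hv ha hb t ht
    obtain ⟨h0, h1, hi⟩ := hη e he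
    by_cases t0 : t = 0
    · rw [t0, h0] at ht
      exact ha (φ.point_injOn (h.isLink e he).left_mem hv ht).symm
    by_cases t1 : t = 1
    · rw [t1, h1] at ht
      exact hb (φ.point_injOn (h.isLink e he).right_mem hv ht).symm
    obtain ⟨t', t0', t1', h'⟩ := hi t t0 t1
    exact φ.arc_ne_point e ((h.mem_iff e).1 he) v hv t' t0' t1' (h' ▸ ht)
  refine ⟨hfin.toFinset, fun v => c (φ.point v), fun e => c.comp (η e), ?_, ?_, ?_, ?_, ?_, ?_⟩
  · exact fun e he => ⟨hV.2 (h.isLink e he).left_mem, hV.2 (h.isLink e he).right_mem⟩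
  · exact fun e he => congrArg c (hη e he).1
  · exact fun e he => congrArg c (hη e he).2.1
  · exact fun u hu v hv huv h' => huv (φ.point_injOn (hV.1 hu) (hV.1 hv) (hc h'))
  · exact fun e he v hv ha hb t h' => hpoint e he v (hV.1 hv) ha hb t (hc h')
  · intro e he e' he' hne s t hsa hsb hst
    have hst : η e s = η e' t := hc hst
    obtain ⟨h0, h1, hi⟩ := hη e he
    obtain ⟨h0', h1', hi'⟩ := hη e' he'
    have s0 : s ≠ 0 := by rintro rfl; exact hsa (congrArg c h0)
    have s1 : s ≠ 1 := by rintro rfl; exact hsb (congrArg c h1)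
    obtain ⟨s', s0', s1', hs'⟩ := hi s s0 s1
    by_cases t0 : t = 0
    · refine φ.arc_ne_point e ((h.mem_iff e).1 he) _ (h.isLink e' he').left_mem s' s0' s1' ?_
      rw [← hs', hst, t0, h0']
    by_cases t1 : t = 1
    · refine φ.arc_ne_point e ((h.mem_iff e).1 he) _ (h.isLink e' he').right_mem s' s0' s1' ?_
      rw [← hs', hst, t1, h1']
    obtain ⟨t', t0', t1', ht'⟩ := hi' t t0 t1
    exact φ.arc_disjoint e ((h.mem_iff e).1 he) e' ((h.mem_iff e').1 he') hne s' t' s0' s1' t0' t1'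
      (by rw [← hs', ← ht', hst])

/-- `TwoFactor` controls only ends of edges; since `G` is cubic, every vertex is one. -/
lemma deg_of_twoFactor (h : IsEnds G A E a b) (hcubic : G.IsCubic) (hS : TwoFactor E S a b)
    {H : Graph α β} (hH : H ≤ G) {x : α} (hx : x ∈ G.vertexSet)
    (hinc : ∀ e, H.Inc e x ↔ e ∈ S ∧ G.Inc e x) : H.deg x = 2 := by
  obtain ⟨e, he, hex⟩ := h.exists_inc hcubic hx
  by_cases hxA : x ∈ A
  · rw [h.deg_eq_left hS.1 hH hxA hinc, ← ((h.inc_iff_left hxA).1 hex).2, (hS.2 e he).1]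
    rfl
  · rw [h.deg_eq_right hS.1 hH hxA hinc, ← ((h.inc_iff_right hxA).1 hex).2, (hS.2 e he).2]
    rfl

/-- The component of an edge in a 2-factor, as a graph. -/
lemma exists_twoFactor_cycle (h : IsEnds G A E a b) (hfin : G.vertexSet.Finite)
    (hcubic : G.IsCubic) (hS : TwoFactor E S a b) {e₁ : β} (he₁ : e₁ ∈ S) :
    ∃ F C : Graph α β, F.IsTwoFactorOf G ∧ C.IsCycleGraph ∧ C ≤ F ∧
      ∀ e ∈ S, Linked S a b e₁ e → e ∈ C.edgeSet := by
  -- Every edge of `S` at a vertex of `X` is linked to `e₁`, so the subgraph of the 2-factor induced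
  -- on `X` loses no degree and is a whole component.
  set X : Set α := {x | ∃ e ∈ S, Linked S a b e₁ e ∧ G.Inc e x} with hX
  have hXV : X ⊆ G.vertexSet := fun x ⟨e, _, _, hx⟩ => hx.vertex_mem
  set F : Graph α β := G.restrict (S : Set β) with hF
  have hFG : F ≤ G := Graph.restrict_le
  have hCF : F.induce X ≤ F := Graph.induce_le hXV
  have hlink : ∀ e ∈ S, Linked S a b e₁ e → (F.induce X).IsLink e (a e) (b e) :=
    fun e he hl => ⟨⟨he, h.isLink e (hS.1 he)⟩, ⟨e, he, hl, (h.isLink e (hS.1 he)).inc_left⟩,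
      ⟨e, he, hl, (h.isLink e (hS.1 he)).inc_right⟩⟩
  have hclosed : ∀ e ∈ S, ∀ x ∈ X, G.Inc e x → Linked S a b e₁ e := by
    rintro e he x ⟨f, hf, hl, hfx⟩ hx
    exact hl.tail ⟨hf, he, h.share_of_inc hfx hx⟩
  have hinc : ∀ x ∈ X, ∀ e, (F.induce X).Inc e x ↔ e ∈ S ∧ G.Inc e x := by
    intro x hx e
    constructor
    · rintro ⟨y, hy⟩
      exact ⟨hy.1.1, y, hy.1.2⟩
    · rintro ⟨he, hex⟩
      have hl := hlink e he (hclosed e he x hx hex)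
      rcases (h.inc_iff.1 hex).2 with rfl | rfl
      exacts [hl.inc_left, hl.inc_right]
  have hreach : ∀ e, Linked S a b e₁ e →
      e ∈ S ∧ Relation.ReflTransGen (F.induce X).Adj (a e₁) (a e) := by
    intro e hl
    induction hl with
    | refl => exact ⟨he₁, .refl⟩
    | @tail e f hl hef ih =>
      refine ⟨hef.2.1, ?_⟩
      rcases hef.2.2 with h' | h'
      · rw [← h']; exact ih.2
      · have l1 := hlink e hef.1 hl
        have l2 := hlink f hef.2.1 (hl.tail hef)
        rw [← h'] at l2
        exact (ih.2.tail l1.adj).tail l2.adj.symm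
  have hreach' : ∀ x ∈ X, Relation.ReflTransGen (F.induce X).Adj (a e₁) x := by
    rintro x ⟨e, he, hl, hx⟩
    rcases (h.inc_iff.1 hx).2 with rfl | rfl
    · exact (hreach e hl).2
    · exact (hreach e hl).2.tail (hlink e he hl).adj
  have hsymm : ∀ x y, Relation.ReflTransGen (F.induce X).Adj x y →
      Relation.ReflTransGen (F.induce X).Adj y x := by
    intro x y hxy
    induction hxy with
    | refl => exact .refl
    | tail _ h1 ih => exact ih.head h1.symm
  refine ⟨F, F.induce X, ⟨⟨hFG, rfl⟩, fun x hx => ?_⟩, ⟨hfin.subset hXV, ⟨?_, ?_⟩, ?_⟩, hCF,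
    fun e he hl => (hlink e he hl).edge_mem⟩
  · refine h.deg_of_twoFactor hcubic hS hFG hx fun e => ?_
    rw [hF, Graph.restrict_inc, and_comm, Finset.mem_coe]
  · exact ⟨a e₁, e₁, he₁, .refl _, (h.isLink e₁ (hS.1 he₁)).inc_left⟩
  · exact fun x hx y hy => (hsymm _ _ (hreach' x hx)).trans (hreach' y hy)
  · exact fun x hx => h.deg_of_twoFactor hcubic hS (hCF.trans hFG) (hXV hx) (hinc x hx)

end IsEnds

end Ends

end BipartiteEdges

open BipartiteEdges in
theorem theorem5 {α β : Type*} (G : Graph α β) (hfin : G.vertexSet.Finite)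
    (hconn : G.IsConnected) (hplanar : G.IsPlanar) (hcubic : G.IsCubic)
    (hbip : G.IsBipartite) (e₁ e₂ : β) (he₁ : e₁ ∈ G.edgeSet) (he₂ : e₂ ∈ G.edgeSet) :
    ∃ F C : Graph α β, F.IsTwoFactorOf G ∧ C.IsCycleGraph ∧ C ≤ F ∧
      e₁ ∈ C.edgeSet ∧ e₂ ∈ C.edgeSet := by
  classical
  obtain ⟨A, hA⟩ := hbip
  obtain ⟨φ⟩ := hplanar
  obtain ⟨E, a, b, h⟩ := exists_isEnds hfin hconn.1 hcubic hA
  have hab : ∀ e ∈ E, ∀ e' ∈ E, a e ≠ b e' := fun e he e' he' => h.left_ne_right he he'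
  obtain ⟨V, pt, γ, hdraw⟩ := h.exists_isDrawing hfin φ
  obtain ⟨C, f, hgrid⟩ := hdraw.exists_isGridMinor hab
  obtain ⟨S, hS, h1, h2, h12⟩ := pairsOnCycle_of_hasDual (h.conn hconn) (h.cubic hcubic)
    (hgrid.hasDual hab) e₁ ((h.mem_iff e₁).2 he₁) e₂ ((h.mem_iff e₂).2 he₂)
  obtain ⟨F, C, hF, hC, hCF, hmem⟩ := h.exists_twoFactor_cycle hfin hcubic hS h1
  exact ⟨F, C, hF, hC, hCF, hmem e₁ h1 (.refl _), hmem e₂ h2 h12⟩
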